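/- **Notation.** For $\tau$ in the upper half plane $\mathcal H$ let $L_\tau=\mathbb Z+\mathbb Z\tau$ and $E_\tau=\mathbb C/L_\tau$. A torsion point $P=(r,s)\in(\mathbb Q/\mathbb Z)^2$ stands, for every $\tau$, for the image of $\alpha=r\tau+s$ in $E_\tau$; $\oplus,\ominus,[m]$ are the group operations, $O$ is the origin, and $E[N]$ is the group of $N$-torsion points. Let $\wp,\zeta$ be the Weierstrass functions of $L_\tau$, and let $2\eta_1=2\zeta(1/2)$, $2\eta_2=2\zeta(\tau/2)$ be the quasi-periods of $\zeta$ for $1$ and $\tau$. For $P\neq O$ put $$x_P(\tau)=\wp(\alpha),\qquad y_P(\tau)=\tfrac12\wp'(\alpha),\qquad \lambda_P(\tau)=-E_1(\tau,P)=-\bigl(\zeta(\alpha)-2r\eta_2-2s\eta_1\bigr),$$ where $E_1(\tau,P)$ is Hecke's Eisenstein series of weight $1$, and put $x_O=y_O=\lambda_O=0$. These are modular forms of weights $2,3,1$ on $\Gamma(N)$ if $P\in E[N]$. Let $\mathcal E_3^N$ be the $\mathbb C$-span of $\{y_P: P\in E[N]\}$ (the Eisenstein series of weight $3$ on $\Gamma(N)$).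 **Proposition 4.11.** Let $n,\ell\ge 1$ be integers. (1) Let $A,B\in E[n\ell]$ and $s\in\mathbb Z$. Then, modulo $\mathcal E_3^{n\ell}$, the sum $$\sum_{T\in E[n]} x_{A\oplus T}\,\lambda_{B\ominus[s]T}$$ is congruent to a finite $\mathbb C$-linear combination of terms $x_{[a]A\oplus[b]B}\,\lambda_{[c]A\oplus[d]B}$ with $a,b,c,d\in\mathbb Z$ and $a-sb\equiv c-sd\equiv 0\pmod n$. (2) Likewise, for $A,B\in E[n\ell]$ and $s\in\mathbb Z$, the sum $$\sum_{T\in E[n]} x_{A\ominus[s]T}\,\lambda_{B\oplus T}$$ is congruent modulo $\mathcal E_3^{n\ell}$ to a finite $\mathbb C$-linear combination of terms $x_{[a]A\oplus[b]B}\,\lambda_{[c]A\oplus[d]B}$ with $a,b,c,d\in\mathbb Z$ and $-sa+b\equiv -sc+d\equiv 0\pmod n$. (3) If $P,Q\in E[n\ell]$, then the trace $$\sum_{\gamma\in\Gamma(n\ell)\backslash\Gamma(\ell)}(x_P\lambda_Q)|_3\gamma$$ of $x_P\lambda_Q$ from $\Gamma(n\ell)$ to $\Gamma(\ell)$ is congruent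 modulo $\mathcal E_3^{\ell}$ to a finite $\mathbb C$-linear combination of terms $x_R\lambda_S$ with $R,S\in E[\ell]$. -/

import Mathlib

open scoped MatrixGroups ModularForm

noncomputable section

namespace TorsionForms

/-- The lattice `L_τ = ℤ + ℤ τ` of a point `τ` of the upper half plane. -/
def latticeOf (τ : UpperHalfPlane) : PeriodPair where
  ω₁ := 1
  ω₂ := τ
  indep := by
    rw [LinearIndependent.pair_iff]
    intro s t h
    have him := congrArg Complex.im h
    have hre := congrArg Complex.re h
    simp at him hre
    have ht : t = 0 := him.resolve_right τ.im_ne_zero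
    subst ht
    simpa using hre

/-- The Weierstrass zeta function `ζ(z) = 1/z + ∑_{0 ≠ ω ∈ L} (1/(z-ω) + 1/ω + z/ω²)` of a lattice.
Since `1 / 0 = 0`, the term `ω = 0` of the (absolutely convergent) series below is `1 / z`. -/
def weierstrassZeta (L : PeriodPair) (z : ℂ) : ℂ :=
  ∑' l : L.lattice, (1 / (z - l) + 1 / (l : ℂ) + z / (l : ℂ) ^ 2)

/-- The torsion points of the varying elliptic curve `E_τ = ℂ / L_τ`: the pair `(r, s) ∈ (ℚ/ℤ)²`
stands for the image of `r τ + s` in `E_τ`, for every `τ`. -/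
abbrev TorsionPoint : Type := Fin 2 → AddCircle (1 : ℚ)

/-- The group `E[n]` of `n`-torsion points. -/
abbrev torsion (n : ℕ) : AddSubgroup TorsionPoint := AddSubgroup.torsionBy TorsionPoint (n : ℤ)

theorem finite_torsion (n : ℕ) [NeZero n] : Finite (torsion n) := by
  have h := Set.Finite.pi' (fun _ : Fin 2 ↦
    AddCircle.finite_torsion (1 : ℚ) (Nat.pos_of_ne_zero (NeZero.ne n)))
  refine (h.subset fun P hP i ↦ ?_).to_subtype
  have hP' : (n : ℤ) • P = 0 := hP
  simpa using congrFun hP' i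

instance (n : ℕ) [NeZero n] : Fintype (torsion n) :=
  have := finite_torsion n
  Fintype.ofFinite _

/-- A rational number representing a class in `ℚ/ℤ`. Below it is used only inside expressions
that do not depend on the choice of the representative. -/
def coord (u : AddCircle (1 : ℚ)) : ℚ := Quotient.out u

theorem coe_coord (u : AddCircle (1 : ℚ)) : (coord u : AddCircle (1 : ℚ)) = u :=
  Quotient.out_eq u

/-- A lift `α = r τ + s` to `ℂ` of a torsion point of `E_τ`. -/
def lift (P : TorsionPoint) (τ : UpperHalfPlane) : ℂ := coord (P 0) * τ + coord (P 1)

open scoped Classical in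
/-- The `x`-coordinate `x_P(τ) = ℘(α; L_τ)` of a torsion point `P`, with `x_O = 0` at the
origin `O`. -/
def xForm (P : TorsionPoint) (τ : UpperHalfPlane) : ℂ :=
  if P = 0 then 0 else (latticeOf τ).weierstrassP (lift P τ)

open scoped Classical in
/-- The `y`-coordinate `y_P(τ) = ℘'(α; L_τ) / 2` of a torsion point `P`, with `y_O = 0`. -/
def yForm (P : TorsionPoint) (τ : UpperHalfPlane) : ℂ :=
  if P = 0 then 0 else (latticeOf τ).derivWeierstrassP (lift P τ) / 2

open scoped Classical in
/-- Hecke's Eisenstein series of weight one, as a division value of the Weierstrass zeta function: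
`E₁(τ, P) = ζ(α) - r · 2η₂ - s · 2η₁` for `α = r τ + s ∉ L_τ`, and `E₁(τ, O) = 0`.
Here `2η₂ = 2ζ(τ/2)` and `2η₁ = 2ζ(1/2)` are the quasi-periods, that is,
`ζ(z + τ) = ζ(z) + 2η₂` and `ζ(z + 1) = ζ(z) + 2η₁`. -/
def eisensteinOne (P : TorsionPoint) (τ : UpperHalfPlane) : ℂ :=
  if P = 0 then 0 else
    weierstrassZeta (latticeOf τ) (lift P τ)
      - coord (P 0) * (2 * weierstrassZeta (latticeOf τ) (τ / 2))
      - coord (P 1) * (2 * weierstrassZeta (latticeOf τ) (1 / 2))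

/-- The weight one form `λ_P = -E₁(τ, P)`. -/
def lambdaForm (P : TorsionPoint) (τ : UpperHalfPlane) : ℂ := -eisensteinOne P τ

/-- The space `𝓔₃` of Eisenstein series of weight three and level `Γ(N)`: the `ℂ`-span of the
forms `y_P` with `P ∈ E[N]`. -/
def eisensteinSpaceThree (N : ℕ) : Submodule ℂ (UpperHalfPlane → ℂ) :=
  Submodule.span ℂ {f | ∃ P ∈ torsion N, f = yForm P}

/-- The trace `∑_{γ ∈ Γ(N) \ Γ(M)} f |₃ γ` in weight three of a function `f` that is invariant
under `Γ(N)`, where `M ∣ N`. As `g` runs over representatives of the left cosets of `Γ(N)` in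
`Γ(M)`, its inverse runs over representatives of the right cosets. -/
def traceThree (N M : ℕ) [NeZero N] (f : UpperHalfPlane → ℂ) : UpperHalfPlane → ℂ :=
  letI : Fintype (CongruenceSubgroup.Gamma M ⧸
      (CongruenceSubgroup.Gamma N).subgroupOf (CongruenceSubgroup.Gamma M)) :=
    Subgroup.fintypeQuotientOfFiniteIndex
  ∑ q : CongruenceSubgroup.Gamma M ⧸
      (CongruenceSubgroup.Gamma N).subgroupOf (CongruenceSubgroup.Gamma M),
    f ∣[(3 : ℤ)] ((Quotient.out q : CongruenceSubgroup.Gamma M) : SL(2, ℤ))⁻¹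

end TorsionForms

end

/-! Everything rests on the addition formula of ζ, read on torsion points:
$(x_P-x_Q)(\lambda_P+\lambda_Q-\lambda_{P+Q})=y_P-y_Q$ (`form_relation`), and on the distribution
relations: summed over the $k$-division points of $C$, the forms $x,\lambda,y$ give $k^2x_C$,
$k\lambda_C$, $k^3y_C$.

For a subgroup $H$ of torsion points let $V(H)$ be `productSpace H`. The sums in (1) and (2) run
over all solutions $(X,Y)$ of a linear system $Xm_1+Ym_2=C$ of determinant $\pm n$ with $C\in H^2$.
That such a sum of $x_X\lambda_Y$ lies in $V(H)$ is `fiberSum_mem`, a descent on the determinant: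
the addition formula links the sums for $(m_1,m_2)$, $(m_1-m_2,m_2)$, $(m_2,m_1-m_2)$ and
$(m_1,m_2-m_1)$ (`fiberSum_recursion`), the distribution relations strip common factors from $m_1$
and $m_2$, and at determinant $\pm1$ Cramer's rule puts the solutions into $H^2$. Taking $H$
generated by the two entries of $C$ yields the congruence conditions.

For the trace it is enough to write every element of $V(E[n\ell])$ as an element of $V(E[\ell])$
plus differences $g-g|\gamma$ with $\gamma\in\Gamma(\ell)$, since the trace kills these
(`productSpace_le_sup`). This is done one prime $p$ at a time. If $P\in E[\ell]$, or if $Q\equiv wP$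
modulo $E[\ell]$, the translates by $E[p]$ outside level $\ell$ are conjugate under $\Gamma(\ell)$,
and their sum is governed by a distribution relation or by the fibre sums above. In the remaining
case $Q$ is averaged over transvections fixing $P$; expanding $\lambda$ as its own finite Fourier
transform (`lambdaForm_eq_sum`), only points aligned with $P$ modulo $p$ survive the average
(`mul_mem_sup`).

The analytic identities come from Liouville's theorem. Fourier self-duality is the constant term of
the partial fraction expansion of the Kronecker function $\sigma(z+v)e^{-cz}/(\sigma(z)\sigma(v))$,
and the Legendre relation with its correct sign makes the Fourier coefficients independent of
$\tau$. -/

open scoped MatrixGroups ModularForm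

noncomputable section

namespace TorsionForms

open Filter Topology

/-! ### The Weierstrass zeta function and its quasi-periods. -/

section Zeta

variable (L : PeriodPair)

/-- The Weierstrass zeta function with the `l₀`-term missing. -/
def zetaExcept (l₀ z : ℂ) : ℂ :=
  ∑' l : L.lattice, if l.1 = l₀ then 0 else (1 / (z - l) + 1 / (l : ℂ) + z / (l : ℂ) ^ 2)

/-- The three fractions combine to $s^2/(l^2(s-l))$ and $|s-l|\ge|l|/2$; the resulting cubic decay
is summable over a lattice of rank two. -/
theorem zeta_term_bound {r : ℝ} (hr : 0 < r) {s : ℂ} (hs : ‖s‖ < r) {l : ℂ} (h : 2 * r ≤ ‖l‖) :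
    ‖1 / (s - l) + 1 / l + s / l ^ 2‖ ≤ 2 * r ^ 2 * ‖l‖ ^ (-3 : ℝ) := by
  have hl : 0 < ‖l‖ := by linarith
  have hl0 : l ≠ 0 := norm_pos_iff.mp hl
  have hsl : ‖l‖ / 2 ≤ ‖s - l‖ := by
    rw [norm_sub_rev]
    exact .trans (by linarith) (norm_sub_norm_le l s)
  have hsl0 : s - l ≠ 0 := norm_pos_iff.mp (by linarith)
  have e : 1 / (s - l) + 1 / l + s / l ^ 2 = s ^ 2 / (l ^ 2 * (s - l)) := by
    field_simp
    ring
  rw [e, norm_div, norm_mul, norm_pow, norm_pow]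
  calc ‖s‖ ^ 2 / (‖l‖ ^ 2 * ‖s - l‖) ≤ r ^ 2 / (‖l‖ ^ 2 * (‖l‖ / 2)) := by gcongr
    _ = 2 * r ^ 2 / ‖l‖ ^ 3 := by field_simp
    _ = _ := by norm_cast

theorem hasSumLocallyUniformly_zetaExcept (l₀ : ℂ) :
    HasSumLocallyUniformly (fun (l : L.lattice) (z : ℂ) ↦
      if l.1 = l₀ then 0 else (1 / (z - l) + 1 / (l : ℂ) + z / (l : ℂ) ^ 2)) (zetaExcept L l₀) := by
  refine L.hasSumLocallyUniformly_aux (u := (2 * · ^ 2 * ‖·‖ ^ (-3 : ℝ))) _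
    (fun _ _ ↦ (ZLattice.summable_norm_rpow _ _ (by simp; norm_num)).mul_left _) fun r hr ↦
    Filter.eventually_atTop.mpr ⟨2 * r, ?_⟩
  rintro _ h s hs l rfl
  split_ifs
  · rw [norm_zero]; positivity
  · exact zeta_term_bound hr hs h

theorem differentiableOn_zeta_term {l l₀ : ℂ} (hl : l ∈ L.lattice) (h : l ≠ l₀) :
    DifferentiableOn ℂ (fun z : ℂ ↦ 1 / (z - l) + 1 / l + z / l ^ 2) (L.lattice \ {l₀})ᶜ := by
  intro x hx
  have : x - l ≠ 0 := by
    rw [sub_ne_zero]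
    rintro rfl
    exact hx ⟨hl, h⟩
  exact DifferentiableAt.differentiableWithinAt (.add (.add_const _ (.div (by fun_prop)
    (by fun_prop) this)) (by fun_prop))

theorem differentiableOn_zetaExcept (l₀ : ℂ) :
    DifferentiableOn ℂ (zetaExcept L l₀) (L.lattice \ {l₀})ᶜ := by
  refine (hasSumLocallyUniformly_zetaExcept L l₀).hasSumLocallyUniformlyOn.differentiableOn
    (.of_forall fun s ↦ .fun_sum fun i hi ↦ ?_) L.isOpen_compl_lattice_sdiff
  split_ifs with h
  · simp
  · exact differentiableOn_zeta_term L i.2 h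

theorem deriv_zetaExcept (l₀ : ℂ) :
    Set.EqOn (deriv (zetaExcept L l₀)) (-L.weierstrassPExcept l₀) (L.lattice \ {l₀})ᶜ := by
  refine ((hasSumLocallyUniformly_zetaExcept L l₀).tendstoLocallyUniformlyOn.deriv
    (.of_forall fun s ↦ ?_) L.isOpen_compl_lattice_sdiff).unique ?_
  · refine .fun_sum fun i hi ↦ ?_
    split_ifs with h
    · simp
    · exact differentiableOn_zeta_term L i.2 h
  · refine (L.hasSumLocallyUniformly_weierstrassPExcept l₀).tendstoLocallyUniformlyOn.neg.congr ?_
    intro s z hz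
    simp only [Function.comp_apply, Pi.neg_apply]
    rw [deriv_fun_sum, ← Finset.sum_neg_distrib]
    · congr with l
      split_ifs with h
      · simp
      have hzl : z - l ≠ 0 := by
        rw [sub_ne_zero]
        rintro rfl
        exact hz ⟨l.2, h⟩
      have h1 : HasDerivAt (fun z : ℂ ↦ 1 / (z - l) + 1 / (l : ℂ) + z / (l : ℂ) ^ 2)
          ((0 * (z - l) - 1 * 1) / (z - l) ^ 2 + 1 / (l : ℂ) ^ 2) z :=
        (((hasDerivAt_const z (1 : ℂ)).div ((hasDerivAt_id z).sub_const _) hzl).add_const _).add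
          ((hasDerivAt_id z).div_const _)
      rw [h1.deriv]
      ring
    · intro l hl
      split_ifs with h
      · simp
      · exact (differentiableOn_zeta_term L l.2 h).differentiableAt
          (L.isOpen_compl_lattice_sdiff.mem_nhds hz)

theorem zetaExcept_add (l₀ : L.lattice) (z : ℂ) :
    zetaExcept L l₀ z + (1 / (z - l₀) + 1 / (l₀ : ℂ) + z / (l₀ : ℂ) ^ 2) = weierstrassZeta L z := by
  trans zetaExcept L l₀ z + ∑' i : L.lattice, if i.1 = l₀.1 then
      (1 / (z - l₀) + 1 / (l₀ : ℂ) + z / (l₀ : ℂ) ^ 2) else 0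
  · simp
  rw [zetaExcept, weierstrassZeta, ← Summable.tsum_add]
  · congr with w; split_ifs <;> simp only [zero_add, add_zero, *]
  · exact ⟨_, (hasSumLocallyUniformly_zetaExcept L l₀).hasSum⟩
  · exact summable_of_hasFiniteSupport ((Set.finite_singleton l₀).subset (by simp))

/-- Omitting a point outside the lattice omits nothing. With `l₀ = ω₁ / 2` this transfers the facts
about `zetaExcept` to ζ itself. -/
theorem zetaExcept_of_notMem {l₀ : ℂ} (hl : l₀ ∉ L.lattice) :
    zetaExcept L l₀ = weierstrassZeta L := by
  ext z
  rw [zetaExcept, weierstrassZeta]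
  congr! 2 with l
  rw [if_neg]
  rintro rfl
  exact hl l.2

theorem differentiableOn_zeta : DifferentiableOn ℂ (weierstrassZeta L) (L.lattice : Set ℂ)ᶜ := by
  rw [← zetaExcept_of_notMem L L.ω₁_div_two_notMem_lattice]
  convert! differentiableOn_zetaExcept L _
  simp [L.ω₁_div_two_notMem_lattice]

theorem analyticAt_zeta {z : ℂ} (hz : z ∉ L.lattice) : AnalyticAt ℂ (weierstrassZeta L) z :=
  (differentiableOn_zeta L).analyticAt (L.isClosed_lattice.isOpen_compl.mem_nhds hz)

theorem hasDerivAt_zeta {z : ℂ} (hz : z ∉ L.lattice) :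
    HasDerivAt (weierstrassZeta L) (-L.weierstrassP z) z := by
  have h := (analyticAt_zeta L hz).differentiableAt.hasDerivAt
  have h2 := deriv_zetaExcept L (L.ω₁ / 2) (x := z) (by simp [hz])
  rw [zetaExcept_of_notMem L L.ω₁_div_two_notMem_lattice,
    L.weierstrassPExcept_of_notMem _ L.ω₁_div_two_notMem_lattice] at h2
  rwa [h2] at h

theorem zeta_neg (z : ℂ) : weierstrassZeta L (-z) = -weierstrassZeta L z := by
  simp only [weierstrassZeta]
  rw [← (Equiv.neg L.lattice).tsum_eq, ← tsum_neg]
  congr with l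
  simp only [Equiv.neg_apply, NegMemClass.coe_neg]
  rw [show -z - -(l : ℂ) = -(z - l) by ring, one_div_neg_eq_neg_one_div, one_div_neg_eq_neg_one_div]
  ring

theorem isPreconnected_compl_lattice : IsPreconnected (L.lattice : Set ℂ)ᶜ := by
  have : (L.lattice : Set ℂ).Countable := L.latticeEquivProd.toEquiv.countable_iff.mpr inferInstance
  exact (this.isConnected_compl_of_one_lt_rank (by simp)).isPreconnected

theorem add_coe_mem_lattice_iff {z : ℂ} (l : L.lattice) : z + l ∈ L.lattice ↔ z ∈ L.lattice :=
  L.lattice.toAddSubgroup.add_mem_cancel_right l.2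

/-- The quasi-periods of the zeta function. -/
def quasiPeriod (l : L.lattice) : ℂ :=
  weierstrassZeta L (L.ω₁ / 2 + l) - weierstrassZeta L (L.ω₁ / 2)

/-- The difference of the two zeta values has derivative $\wp(z)-\wp(z+l)=0$ on the complement of
the countable lattice, which is connected. -/
theorem zeta_add_coe_of_notMem {z : ℂ} (hz : z ∉ L.lattice) (l : L.lattice) :
    weierstrassZeta L (z + l) = weierstrassZeta L z + quasiPeriod L l := by
  have hd : ∀ z ∉ L.lattice,
      HasDerivAt (fun z ↦ weierstrassZeta L (z + l) - weierstrassZeta L z) 0 z := by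
    intro z hz
    have h1 := (hasDerivAt_zeta L
      (fun h ↦ hz ((add_coe_mem_lattice_iff L l).mp h))).comp_add_const z (l : ℂ)
    rw [L.weierstrassP_add_coe] at h1
    exact (h1.sub (hasDerivAt_zeta L hz)).congr_deriv (sub_self _)
  have := L.isClosed_lattice.isOpen_compl.is_const_of_deriv_eq_zero (isPreconnected_compl_lattice L)
    (f := fun z ↦ weierstrassZeta L (z + l) - weierstrassZeta L z)
    (fun z hz ↦ (hd z hz).differentiableAt.differentiableWithinAt)
    (fun z hz ↦ (hd z hz).deriv) hz L.ω₁_div_two_notMem_lattice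
  rw [quasiPeriod, ← this]
  ring

/-- Near a lattice point the zeta function is `1 / (z - l)` up to a continuous function. -/
theorem tendsto_zeta_sub (l : L.lattice) :
    Tendsto (fun z ↦ weierstrassZeta L z - 1 / (z - l)) (𝓝[≠] (l : ℂ))
      (𝓝 (weierstrassZeta L l)) := by
  have hc : ContinuousAt (fun z ↦ zetaExcept L l z + (1 / (l : ℂ) + z / (l : ℂ) ^ 2)) l :=
    ((differentiableOn_zetaExcept L l).differentiableAt
      (L.compl_lattice_sdiff_singleton_mem_nhds _)).continuousAt.add (by fun_prop)
  have h := hc.tendsto.mono_left (nhdsWithin_le_nhds (s := {(l : ℂ)}ᶜ))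
  simp only [← zetaExcept_add L l]
  convert! h using 2
  · ring
  · simp

/-- Because `1 / 0 = 0`, the value of ζ at a pole is the value of its regular part there. Comparing
the limits of the regular parts at $z$ and $z+l$ extends quasi-periodicity to the poles. -/
theorem zeta_add_coe (z : ℂ) (l : L.lattice) :
    weierstrassZeta L (z + l) = weierstrassZeta L z + quasiPeriod L l := by
  by_cases hz : z ∈ L.lattice
  · have h1 := tendsto_zeta_sub L ⟨z, hz⟩
    have h2 := tendsto_zeta_sub L (⟨z, hz⟩ + l)
    have h3 : Tendsto (fun w : ℂ ↦ w + l) (𝓝[≠] z) (𝓝[≠] (z + l)) := by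
      refine tendsto_nhdsWithin_iff.mpr ⟨?_, ?_⟩
      · exact ((continuous_id.add continuous_const).tendsto z).mono_left nhdsWithin_le_nhds
      · filter_upwards [self_mem_nhdsWithin] with w hw
        simpa using hw
    have h4 := h2.comp h3
    have h5 := h1.add_const (quasiPeriod L l)
    refine tendsto_nhds_unique (h4.congr' ?_) h5
    have : ∀ᶠ w in 𝓝[≠] z, w ∉ L.lattice := by
      have := L.compl_lattice_sdiff_singleton_mem_nhds z
      filter_upwards [nhdsWithin_le_nhds this, self_mem_nhdsWithin] with w hw hw2 hw3
      exact hw ⟨hw3, hw2⟩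
    filter_upwards [this] with w hw
    simp only [Function.comp_apply, zeta_add_coe_of_notMem L hw, Submodule.coe_add]
    rw [add_sub_add_right_eq_sub]
    ring
  · exact zeta_add_coe_of_notMem L hz l

@[simp] theorem zeta_zero : weierstrassZeta L 0 = 0 := by
  simpa [← CharZero.eq_neg_self_iff] using zeta_neg L 0

theorem zeta_coe (l : L.lattice) : weierstrassZeta L l = quasiPeriod L l := by
  simpa using zeta_add_coe L 0 l

theorem quasiPeriod_add (l m : L.lattice) :
    quasiPeriod L (l + m) = quasiPeriod L l + quasiPeriod L m := by
  rw [← zeta_coe, Submodule.coe_add, zeta_add_coe, zeta_coe]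

/-- The quasi-periods as a homomorphism. -/
def quasiPeriodHom : L.lattice →+ ℂ :=
  AddMonoidHom.mk' (quasiPeriod L) (quasiPeriod_add L)

/-- Quasi-periodicity at $-l/2$ combined with oddness. It identifies the constants $2\zeta(\tau/2)$
and $2\zeta(1/2)$ in the definition of $E_1$ with quasi-periods. -/
theorem two_mul_zeta_half (l : L.lattice) : 2 * weierstrassZeta L (l / 2) = quasiPeriod L l := by
  have := zeta_add_coe L (-(l / 2)) l
  rw [zeta_neg, show -((l : ℂ) / 2) + l = l / 2 by ring] at this
  linear_combination this

end Zeta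

end TorsionForms

namespace TorsionForms

open Filter Topology

/-! ### Removable singularities and Liouville's theorem for elliptic functions. -/

section Liouville

variable (L : PeriodPair)

/-- `f` agrees with an analytic function in a punctured neighbourhood of `x`. -/
def RemovableAt (f : ℂ → ℂ) (x : ℂ) : Prop :=
  ∃ g : ℂ → ℂ, AnalyticAt ℂ g x ∧ f =ᶠ[𝓝[≠] x] g

theorem RemovableAt.of_analyticAt {f : ℂ → ℂ} {x : ℂ} (h : AnalyticAt ℂ f x) : RemovableAt f x :=
  ⟨f, h, .rfl⟩

theorem tendsto_add_const_nhdsNE (x l : ℂ) : Tendsto (fun z : ℂ ↦ z + l) (𝓝[≠] x) (𝓝[≠] (x + l)) := by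
  refine tendsto_nhdsWithin_iff.mpr ⟨?_, ?_⟩
  · exact ((continuous_id.add continuous_const).tendsto x).mono_left nhdsWithin_le_nhds
  · filter_upwards [self_mem_nhdsWithin] with w hw
    simpa using hw

/-- Removability can be checked after translation by a period. -/
theorem RemovableAt.of_periodic {f : ℂ → ℂ} {x l : ℂ} (h : RemovableAt f (x + l))
    (hp : ∀ᶠ z in 𝓝[≠] x, f (z + l) = f z) : RemovableAt f x := by
  obtain ⟨g, hg, he⟩ := h
  refine ⟨fun z ↦ g (z + l), hg.comp_of_eq (by fun_prop) rfl, ?_⟩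
  filter_upwards [hp, (tendsto_add_const_nhdsNE x l).eventually he] with z h1 h2
  rw [← h1, h2]

/-- The punctured limit is a choice-free way to fill in removable singularities: it agrees with
every local analytic model on a full neighbourhood, so the local models glue. -/
theorem RemovableAt.limUnder_eventuallyEq {f g : ℂ → ℂ} {x : ℂ} (hg : AnalyticAt ℂ g x)
    (he : f =ᶠ[𝓝[≠] x] g) : (fun y ↦ limUnder (𝓝[≠] y) f) =ᶠ[𝓝 x] g := by
  have key : ∀ y, AnalyticAt ℂ g y → f =ᶠ[𝓝[≠] y] g → limUnder (𝓝[≠] y) f = g y := by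
    intro y hy h
    exact ((hy.continuousAt.tendsto.mono_left nhdsWithin_le_nhds).congr' h.symm).limUnder_eq
  have h1 : ∀ᶠ y in 𝓝[≠] x, f =ᶠ[𝓝 y] g := eventually_nhdsNE_eventually_nhds_iff.mpr he
  have h2 : ∀ᶠ y in 𝓝[≠] x, limUnder (𝓝[≠] y) f = g y := by
    filter_upwards [h1, nhdsWithin_le_nhds hg.eventually_analyticAt] with y hy hy2
    exact key y hy2 (nhdsWithin_le_nhds hy)
  rw [nhdsWithin, eventually_inf_principal] at h2
  filter_upwards [h2] with y hy
  by_cases hyx : y = x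
  · subst hyx
    exact key y hg he
  · exact hy hyx

/-- An elliptic function without poles is constant. -/
theorem elliptic_eventually_const {f : ℂ → ℂ} (hr : ∀ x, RemovableAt f x)
    (hp : ∀ l ∈ L.lattice, ∀ x, ∀ᶠ z in 𝓝[≠] x, f (z + l) = f z) :
    ∃ c, ∀ x, f =ᶠ[𝓝[≠] x] fun _ ↦ c := by
  choose g hg he using hr
  -- `F` is `f` with all singularities filled in. It is entire and periodic, hence has compact
  -- range, and Liouville applies.
  set F : ℂ → ℂ := fun y ↦ limUnder (𝓝[≠] y) f with hF
  have hFg : ∀ x, F =ᶠ[𝓝 x] g x := fun x ↦ RemovableAt.limUnder_eventuallyEq (hg x) (he x)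
  have hFd : Differentiable ℂ F := fun x ↦ ((hg x).congr (hFg x).symm).differentiableAt
  have hFf : ∀ x, f =ᶠ[𝓝[≠] x] F := fun x ↦ (he x).trans (nhdsWithin_le_nhds (hFg x).symm)
  have hFp : ∀ z w, w ∈ L.lattice → F (z + w) = F z := by
    intro z w hw
    have h1 : Tendsto f (𝓝[≠] z) (𝓝 (F z)) :=
      (hFd.continuous.continuousAt.tendsto.mono_left nhdsWithin_le_nhds).congr' (hFf z).symm
    have h2 : Tendsto f (𝓝[≠] (z + w)) (𝓝 (F (z + w))) :=
      (hFd.continuous.continuousAt.tendsto.mono_left nhdsWithin_le_nhds).congr' (hFf _).symm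
    exact tendsto_nhds_unique ((h2.comp (tendsto_add_const_nhdsNE z w)).congr' (hp w hw z)) h1
  refine ⟨F 0, fun x ↦ (hFf x).trans (.of_forall fun y ↦ ?_)⟩
  exact hFd.apply_eq_apply_of_bounded (IsZLattice.isCompact_range_of_periodic L.lattice _
    hFd.continuous hFp).isBounded y 0

theorem elliptic_const {f : ℂ → ℂ} (hr : ∀ x, RemovableAt f x)
    (hp : ∀ l ∈ L.lattice, ∀ x, ∀ᶠ z in 𝓝[≠] x, f (z + l) = f z) :
    ∃ c, ∀ x, ContinuousAt f x → f x = c := by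
  obtain ⟨c, hc⟩ := elliptic_eventually_const L hr hp
  refine ⟨c, fun x hx ↦ ?_⟩
  exact tendsto_nhds_unique (hx.tendsto.mono_left nhdsWithin_le_nhds)
    (tendsto_const_nhds.congr' (hc x).symm)

end Liouville

/-! ### The addition formula of the zeta function. -/

section AdditionFormula

variable (L : PeriodPair)

theorem analyticAt_P {z : ℂ} (hz : z ∉ L.lattice) : AnalyticAt ℂ L.weierstrassP z :=
  L.analyticOnNhd_weierstrassP z hz

theorem analyticAt_P' {z : ℂ} (hz : z ∉ L.lattice) : AnalyticAt ℂ L.derivWeierstrassP z :=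
  L.analyticOnNhd_derivWeierstrassP z hz

theorem eventually_notMem_lattice (x : ℂ) : ∀ᶠ w in 𝓝[≠] x, w ∉ L.lattice := by
  have := L.compl_lattice_sdiff_singleton_mem_nhds x
  filter_upwards [nhdsWithin_le_nhds this, self_mem_nhdsWithin] with w hw hw2 hw3
  exact hw ⟨hw3, hw2⟩

theorem analyticAt_zetaExcept (l : ℂ) : AnalyticAt ℂ (zetaExcept L l) l :=
  (differentiableOn_zetaExcept L l).analyticAt (L.compl_lattice_sdiff_singleton_mem_nhds _)

theorem zeta_eq_except_zero (z : ℂ) : weierstrassZeta L z = zetaExcept L 0 z + 1 / z := by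
  simpa using (zetaExcept_add L 0 z).symm

theorem P_eq_except_zero (z : ℂ) : L.weierstrassP z = L.weierstrassPExcept 0 z + 1 / z ^ 2 := by
  simpa using (L.weierstrassPExcept_add 0 z).symm

theorem P'_eq_except_zero (z : ℂ) :
    L.derivWeierstrassP z = L.derivWeierstrassPExcept 0 z - 2 / z ^ 3 := by
  simpa using (L.derivWeierstrassPExcept_sub 0 z).symm

theorem zetaExcept_zero_zero : zetaExcept L 0 0 = 0 := by
  simpa using (zeta_eq_except_zero L 0).symm

theorem hasDerivAt_zetaExcept_zero : HasDerivAt (zetaExcept L 0) 0 0 := by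
  have h := (analyticAt_zetaExcept L 0).differentiableAt.hasDerivAt
  rwa [deriv_zetaExcept L 0 (by simp), Pi.neg_apply, L.weierstrassPExcept_zero, neg_zero] at h

/-- The defect of the addition formula of the zeta function. -/
def additionDefect (v u : ℂ) : ℂ :=
  (L.weierstrassP u - L.weierstrassP v) *
      (weierstrassZeta L u + weierstrassZeta L v - weierstrassZeta L (u + v)) +
    (L.derivWeierstrassP u - L.derivWeierstrassP v) / 2

theorem additionDefect_add_coe (v u : ℂ) (l : L.lattice) :
    additionDefect L v (u + l) = additionDefect L v u := by
  rw [additionDefect, additionDefect, L.weierstrassP_add_coe, L.derivWeierstrassP_add_coe,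
    zeta_add_coe, show u + l + v = u + v + l by ring, zeta_add_coe]
  ring

theorem analyticAt_additionDefect {v u : ℂ} (hu : u ∉ L.lattice) (huv : u + v ∉ L.lattice) :
    AnalyticAt ℂ (additionDefect L v) u := by
  have h1 := analyticAt_P L hu
  have h2 := analyticAt_P' L hu
  have h3 := analyticAt_zeta L hu
  have h4 : AnalyticAt ℂ (fun u ↦ weierstrassZeta L (u + v)) u :=
    (analyticAt_zeta L huv).comp_of_eq (by fun_prop) rfl
  unfold additionDefect
  fun_prop

theorem exists_analyticAt_eq_pow_mul {N : ℂ → ℂ} {x : ℂ} (hN : AnalyticAt ℂ N x) (n : ℕ)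
    (h : ∀ i < n, iteratedDeriv i N x = 0) :
    ∃ M : ℂ → ℂ, AnalyticAt ℂ M x ∧ ∀ᶠ z in 𝓝 x, N z = (z - x) ^ n * M z := by
  simpa using (natCast_le_analyticOrderAt hN).mp
    ((natCast_le_analyticOrderAt_iff_iteratedDeriv_eq_zero hN).mpr h)

/-- The terms in $u^{-3}$ cancel, and what remains of the polar part is $(B+uA)/u^2$. Its numerator
vanishes to order two, since $B(0)=0$ and $B'(0)=\wp(v)=-A(0)$. -/
theorem removableAt_additionDefect_zero {v : ℂ} (hv : v ∉ L.lattice) :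
    RemovableAt (additionDefect L v) 0 := by
  have h4 : AnalyticAt ℂ (fun u ↦ weierstrassZeta L (u + v)) 0 :=
    (analyticAt_zeta L hv).comp_of_eq (by fun_prop) (by simp)
  have h5 := analyticAt_zetaExcept L 0
  have h6 := L.analyticAt_weierstrassPExcept 0
  have h7 := L.analyticAt_derivWeierstrassPExcept 0
  set B : ℂ → ℂ := fun u ↦ zetaExcept L 0 u + weierstrassZeta L v - weierstrassZeta L (u + v)
    with hB
  set A : ℂ → ℂ := fun u ↦ L.weierstrassPExcept 0 u - L.weierstrassP v with hA
  have hBa : AnalyticAt ℂ B 0 := by fun_prop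
  have hAa : AnalyticAt ℂ A 0 := by fun_prop
  have hB' : HasDerivAt B (L.weierstrassP v) 0 := by
    have h := (hasDerivAt_zeta L (z := 0 + v) (by simpa using hv)).comp_add_const 0 v
    have := ((hasDerivAt_zetaExcept_zero L).add_const (weierstrassZeta L v)).sub h
    simpa using! this
  have hN' : HasDerivAt (fun u ↦ B u + u * A u) 0 0 := by
    have := hB'.add ((hasDerivAt_id (0 : ℂ)).mul hAa.differentiableAt.hasDerivAt)
    refine this.congr_deriv ?_
    simp [hA]
  obtain ⟨M, hM, hMe⟩ := exists_analyticAt_eq_pow_mul (N := fun u ↦ B u + u * A u) (x := 0)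
    (by fun_prop) 2 (by
      intro i hi
      interval_cases i
      · simp [hB, zetaExcept_zero_zero]
      · rw [iteratedDeriv_one, hN'.deriv])
  refine ⟨fun u ↦ M u + A u * B u + (L.derivWeierstrassPExcept 0 u - L.derivWeierstrassP v) / 2,
    by fun_prop, ?_⟩
  filter_upwards [nhdsWithin_le_nhds hMe, self_mem_nhdsWithin] with u hu hu0
  have hu0 : u ≠ 0 := hu0
  have hM' : M u = (B u + u * A u) / u ^ 2 := by
    rw [hu]
    field_simp
    ring
  rw [hM', additionDefect, zeta_eq_except_zero, P_eq_except_zero, P'_eq_except_zero]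
  simp only [hA, hB]
  field_simp
  ring

/-- The simple pole of $\zeta(u+v)$ at $u=-v$ meets the zero of $\wp(u)-\wp(v)$ there, which exists
because ℘ is even. -/
theorem removableAt_additionDefect_neg {v : ℂ} (hv : v ∉ L.lattice) :
    RemovableAt (additionDefect L v) (-v) := by
  have hv' : -v ∉ L.lattice := by simpa using hv
  have h1 := analyticAt_P L hv'
  have h2 := analyticAt_P' L hv'
  have h3 := analyticAt_zeta L hv'
  have h5 : AnalyticAt ℂ (fun u ↦ zetaExcept L 0 (u + v)) (-v) :=
    (analyticAt_zetaExcept L 0).comp_of_eq (by fun_prop) (by simp)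
  obtain ⟨M, hM, hMe⟩ := exists_analyticAt_eq_pow_mul
    (N := fun u ↦ L.weierstrassP u - L.weierstrassP v) (x := -v) (by fun_prop) 1 (by
      intro i hi
      interval_cases i
      simp)
  refine ⟨fun u ↦ (L.weierstrassP u - L.weierstrassP v) *
      (weierstrassZeta L u + weierstrassZeta L v - zetaExcept L 0 (u + v)) - M u +
    (L.derivWeierstrassP u - L.derivWeierstrassP v) / 2, by fun_prop, ?_⟩
  filter_upwards [nhdsWithin_le_nhds hMe, self_mem_nhdsWithin] with u hu hu0
  have hu0 : u + v ≠ 0 := fun h ↦ hu0 (by simpa using eq_neg_of_add_eq_zero_left h)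
  have hM' : M u = (L.weierstrassP u - L.weierstrassP v) / (u + v) := by
    rw [hu]
    field_simp
    ring
  rw [hM', additionDefect, zeta_eq_except_zero L (u + v)]
  field_simp
  ring

theorem exists_additionDefect_eq {v : ℂ} (hv : v ∉ L.lattice) :
    ∃ c, ∀ u, u ∉ L.lattice → u + v ∉ L.lattice → additionDefect L v u = c := by
  have hr : ∀ x, RemovableAt (additionDefect L v) x := by
    intro x
    by_cases hx : x ∈ L.lattice
    · refine RemovableAt.of_periodic (l := -x) ?_ (.of_forall fun z ↦
        additionDefect_add_coe L v z ⟨-x, by simpa using hx⟩)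
      rw [add_neg_cancel]
      exact removableAt_additionDefect_zero L hv
    by_cases hxv : x + v ∈ L.lattice
    · refine RemovableAt.of_periodic (l := -(x + v)) ?_ (.of_forall fun z ↦
        additionDefect_add_coe L v z ⟨-(x + v), neg_mem hxv⟩)
      rw [show x + -(x + v) = -v by ring]
      exact removableAt_additionDefect_neg L hv
    exact .of_analyticAt (analyticAt_additionDefect L hx hxv)
  obtain ⟨c, hc⟩ := elliptic_const L hr
    (fun l hl x ↦ .of_forall fun z ↦ additionDefect_add_coe L v z ⟨l, hl⟩)
  exact ⟨c, fun u hu huv ↦ hc u (analyticAt_additionDefect L hu huv).continuousAt⟩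

/-- The defect is constant in $u$ and visibly zero at $u=v$, provided that $2v$ is not a period. -/
theorem additionDefect_eq_zero {u v : ℂ} (hu : u ∉ L.lattice) (hv : v ∉ L.lattice)
    (huv : u + v ∉ L.lattice) : additionDefect L v u = 0 := by
  have key : ∀ {u v : ℂ}, u ∉ L.lattice → v ∉ L.lattice → u + v ∉ L.lattice → v + v ∉ L.lattice →
      additionDefect L v u = 0 := by
    intro u v hu hv huv hvv
    obtain ⟨c, hc⟩ := exists_additionDefect_eq L hv
    rw [hc u hu huv, ← hc v hv hvv]
    simp [additionDefect]
  by_cases hvv : v + v ∈ L.lattice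
  -- If $2v$ is a period, the constant is evaluated at $u=\omega_1/3$ instead. The defect is
  -- antisymmetric in $u,v$, so the case already settled applies with the two exchanged, as
  -- $2\omega_1/3$ is not a period.
  · obtain ⟨c, hc⟩ := exists_additionDefect_eq L hv
    have h1 : L.ω₁ / 3 ∉ L.lattice := by
      intro h
      have := (L.mul_ω₁_add_mul_ω₂_mem_lattice (α := 1 / 3) (β := 0)).mp
        (by convert! h using 1; push_cast; ring)
      norm_num at this
    have h2 : L.ω₁ / 3 + L.ω₁ / 3 ∉ L.lattice := by
      intro h
      have := (L.mul_ω₁_add_mul_ω₂_mem_lattice (α := 2 / 3) (β := 0)).mp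
        (by convert! h using 1; push_cast; ring)
      norm_num at this
    have h3 : L.ω₁ / 3 + v ∉ L.lattice := by
      intro h
      apply h2
      have := L.lattice.sub_mem (L.lattice.add_mem h h) hvv
      convert this using 1
      ring
    rw [hc u hu huv, ← hc _ h1 h3]
    have := key hv h1 (by rwa [add_comm]) h2
    rw [additionDefect] at this ⊢
    rw [add_comm (L.ω₁ / 3) v]
    linear_combination -this
  · exact key hu hv huv hvv

theorem addition_formula {u v : ℂ} (hu : u ∉ L.lattice) (hv : v ∉ L.lattice)
    (huv : u + v ∉ L.lattice) : (L.weierstrassP u - L.weierstrassP v) *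
      (weierstrassZeta L u + weierstrassZeta L v - weierstrassZeta L (u + v)) =
    -(L.derivWeierstrassP u - L.derivWeierstrassP v) / 2 := by
  have := additionDefect_eq_zero L hu hv huv
  rw [additionDefect] at this
  linear_combination this

end AdditionFormula

end TorsionForms

namespace TorsionForms

open Filter Topology

/-! ### The Weierstrass sigma function. -/

section Sigma

variable (L : PeriodPair)

/-- The factor of the Weierstrass sigma function at a lattice point; it is `1` for `l = 0`. -/
def sigmaFactor (l z : ℂ) : ℂ := (1 - z / l) * Complex.exp (z / l + (z / l) ^ 2 / 2)

/-- The Weierstrass sigma function divided by its argument. -/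
def sigmaQuot (z : ℂ) : ℂ := ∏' l : L.lattice, (1 + (sigmaFactor l z - 1))

/-- The Weierstrass sigma function. -/
def sigma (z : ℂ) : ℂ := z * sigmaQuot L z

/-- The derivative of $(1-w)e^{w+w^2/2}$ is $-w^2e^{w+w^2/2}$, so the mean value inequality gives
cubic smallness. The constant is $e^2$ because $|w+w^2/2|\le 2$ on the unit disc. -/
theorem elementaryFactor_bound {w : ℂ} (hw : ‖w‖ ≤ 1) :
    ‖(1 - w) * Complex.exp (w + w ^ 2 / 2) - 1‖ ≤ Real.exp 2 * ‖w‖ ^ 3 := by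
  have hd : ∀ x ∈ Metric.closedBall (0 : ℂ) ‖w‖, HasDerivWithinAt
      (fun w ↦ (1 - w) * Complex.exp (w + w ^ 2 / 2)) (-x ^ 2 * Complex.exp (x + x ^ 2 / 2))
      (Metric.closedBall (0 : ℂ) ‖w‖) x := by
    intro x _
    have h1 : HasDerivAt (fun w : ℂ ↦ w + w ^ 2 / 2) (1 + (2 : ℕ) * x ^ (2 - 1) * 1 / 2) x :=
      (hasDerivAt_id x).add (((hasDerivAt_id x).pow 2).div_const 2)
    have h2 := ((hasDerivAt_id x).const_sub 1).mul h1.cexp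
    refine (h2.congr_deriv ?_).hasDerivWithinAt
    simp only [id]
    push_cast
    ring
  have hb : ∀ x ∈ Metric.closedBall (0 : ℂ) ‖w‖,
      ‖-x ^ 2 * Complex.exp (x + x ^ 2 / 2)‖ ≤ Real.exp 2 * ‖w‖ ^ 2 := by
    intro x hx
    have hx' : ‖x‖ ≤ ‖w‖ := by simpa using hx
    rw [norm_mul, norm_neg, norm_pow, mul_comm]
    gcongr
    refine (Complex.norm_exp_le_exp_norm _).trans (Real.exp_le_exp.mpr ?_)
    refine (norm_add_le _ _).trans ?_
    rw [norm_div, norm_pow]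
    have : ‖x‖ ^ 2 ≤ 1 := pow_le_one₀ (norm_nonneg _) (hx'.trans hw)
    norm_num
    linarith
  have := (convex_closedBall (0 : ℂ) ‖w‖).norm_image_sub_le_of_norm_hasDerivWithin_le hd hb
    (x := 0) (y := w) (by simp) (by simp)
  simp only [sub_zero, zero_pow, ne_eq, OfNat.ofNat_ne_zero, not_false_eq_true, zero_div, add_zero,
    Complex.exp_zero, mul_one] at this
  exact this.trans (le_of_eq (by ring))

theorem sigmaFactor_sub_one_bound {r : ℝ} {z l : ℂ} (hz : ‖z‖ ≤ r) (h : r ≤ ‖l‖) :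
    ‖sigmaFactor l z - 1‖ ≤ Real.exp 2 * r ^ 3 * ‖l‖ ^ (-3 : ℝ) := by
  by_cases hl : l = 0
  · subst hl
    have : (0 : ℝ) ≤ r := (norm_nonneg z).trans hz
    simp only [sigmaFactor, div_zero, sub_zero, one_mul]
    norm_num
  have hl' : 0 < ‖l‖ := norm_pos_iff.mpr hl
  have hw : ‖z / l‖ ≤ 1 := by
    rw [norm_div]
    exact div_le_one_of_le₀ (hz.trans h) hl'.le
  refine (elementaryFactor_bound hw).trans ?_
  rw [norm_div]
  calc Real.exp 2 * (‖z‖ / ‖l‖) ^ 3 ≤ Real.exp 2 * (r / ‖l‖) ^ 3 := by gcongr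
    _ = Real.exp 2 * r ^ 3 * (‖l‖ ^ 3)⁻¹ := by rw [div_pow]; field_simp
    _ = _ := by norm_cast

theorem differentiable_sigmaFactor (l : ℂ) : Differentiable ℂ (sigmaFactor l) := by
  unfold sigmaFactor
  fun_prop

theorem sigmaFactor_ne_zero {z : ℂ} (hz : z ∉ (L.lattice : Set ℂ) \ {0}) (l : L.lattice) :
    sigmaFactor l z ≠ 0 := by
  refine mul_ne_zero ?_ (Complex.exp_ne_zero _)
  intro h
  by_cases hl : (l : ℂ) = 0
  · simp [hl] at h
  · have : z = l := by
      field_simp at h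
      linear_combination -h
    exact hz ⟨this ▸ l.2, this ▸ hl⟩

theorem summable_bound (C : ℝ) : Summable fun l : L.lattice ↦ C * ‖(l : ℂ)‖ ^ (-3 : ℝ) :=
  (ZLattice.summable_norm_rpow L.lattice (-3) (by simp; norm_num)).mul_left C

theorem eventually_cofinite_le_norm (r : ℝ) :
    ∀ᶠ l : L.lattice in cofinite, r ≤ ‖(l : ℂ)‖ := by
  refine (isCompact_iff_finite.mp (isCompact_closedBall (0 : L.lattice) r)).subset ?_
  intro l hl
  have : ‖(l : ℂ)‖ < r := by simpa using hl
  simpa using this.le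

theorem hasProdLocallyUniformlyOn_sigmaQuot (r : ℝ) :
    HasProdLocallyUniformlyOn (fun (l : L.lattice) z ↦ 1 + (sigmaFactor l z - 1)) (sigmaQuot L)
      (Metric.ball 0 r) := by
  refine Summable.hasProdLocallyUniformlyOn_one_add Metric.isOpen_ball
    (summable_bound L (Real.exp 2 * r ^ 3)) ?_ ?_
  · filter_upwards [eventually_cofinite_le_norm L r] with l hl z hz
    exact sigmaFactor_sub_one_bound (by simpa using (mem_ball_zero_iff.mp hz).le) hl
  · intro l
    have := (differentiable_sigmaFactor (l : ℂ)).continuous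
    fun_prop

theorem differentiable_sigmaQuot : Differentiable ℂ (sigmaQuot L) := by
  intro z
  have h := (hasProdLocallyUniformlyOn_sigmaQuot L (‖z‖ + 1)).differentiableOn
    (.of_forall fun s ↦ ?_) Metric.isOpen_ball
  · exact h.differentiableAt (Metric.isOpen_ball.mem_nhds (by simp))
  · refine DifferentiableOn.fun_finsetProd fun l _ ↦ ?_
    have := differentiable_sigmaFactor (l : ℂ)
    fun_prop

theorem differentiable_sigma : Differentiable ℂ (sigma L) :=
  differentiable_id.mul (differentiable_sigmaQuot L)

theorem sigmaQuot_ne_zero {z : ℂ} (hz : z ∉ (L.lattice : Set ℂ) \ {0}) : sigmaQuot L z ≠ 0 := by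
  refine tprod_one_add_ne_zero_of_summable (fun l ↦ ?_) ?_
  · rw [add_sub_cancel]
    exact sigmaFactor_ne_zero L hz l
  · refine Summable.of_norm_bounded_eventually (summable_bound L (Real.exp 2 * ‖z‖ ^ 3)) ?_
    filter_upwards [eventually_cofinite_le_norm L ‖z‖] with l hl
    rw [norm_norm]
    exact sigmaFactor_sub_one_bound le_rfl hl

theorem sigma_ne_zero {z : ℂ} (hz : z ∉ L.lattice) : sigma L z ≠ 0 :=
  mul_ne_zero (fun h ↦ hz (h ▸ zero_mem _)) (sigmaQuot_ne_zero L fun h ↦ hz h.1)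

theorem sigmaQuot_zero : sigmaQuot L 0 = 1 := by
  simp [sigmaQuot, sigmaFactor]

theorem sigmaQuot_neg (z : ℂ) : sigmaQuot L (-z) = sigmaQuot L z := by
  rw [sigmaQuot, sigmaQuot, ← (Equiv.neg L.lattice).tprod_eq]
  congr with l
  simp [sigmaFactor]

/-- Logarithmic differentiation of the product, factor by factor. The factor at $l=0$ is constantly
$1$, so the product contributes `zetaExcept L 0`; the factor $z$ supplies the missing $1/z$. -/
theorem logDeriv_sigma {z : ℂ} (hz : z ∉ L.lattice) : logDeriv (sigma L) z = weierstrassZeta L z := by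
  have hz0 : z ≠ 0 := fun h ↦ hz (h ▸ zero_mem _)
  have hterm : ∀ l : L.lattice, logDeriv (fun z ↦ 1 + (sigmaFactor l z - 1)) z =
      if l.1 = 0 then 0 else (1 / (z - l) + 1 / (l : ℂ) + z / (l : ℂ) ^ 2) := by
    intro l
    have he : (fun z ↦ 1 + (sigmaFactor l z - 1)) = sigmaFactor l := by
      ext; ring
    rw [he]
    split_ifs with hl
    · have : sigmaFactor (l : ℂ) = fun _ ↦ 1 := by
        ext; simp [sigmaFactor, hl]
      rw [this]
      simp
    · have hzl : z - l ≠ 0 := by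
        rw [sub_ne_zero]
        rintro rfl
        exact hz l.2
      have hzl' : 1 - z / l ≠ 0 := by
        intro h
        apply hzl
        field_simp at h
        linear_combination -h
      unfold sigmaFactor
      rw [logDeriv_mul (f := fun z : ℂ ↦ 1 - z / l)
        (g := fun z : ℂ ↦ Complex.exp (z / l + (z / l) ^ 2 / 2)) z hzl' (Complex.exp_ne_zero _) (by fun_prop) (by fun_prop)]
      have h1 : HasDerivAt (fun z : ℂ ↦ 1 - z / l) (-(1 / l)) z :=
        ((hasDerivAt_id z).div_const (l : ℂ)).const_sub 1
      have h2 : HasDerivAt (fun z : ℂ ↦ z / l + (z / l) ^ 2 / 2)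
          (1 / (l : ℂ) + (2 : ℕ) * (z / (l : ℂ)) ^ (2 - 1) * (1 / (l : ℂ)) / 2) z :=
        ((hasDerivAt_id z).div_const (l : ℂ)).add
          ((((hasDerivAt_id z).div_const (l : ℂ)).pow 2).div_const 2)
      rw [logDeriv_apply, logDeriv_apply, h1.deriv, h2.cexp.deriv]
      field_simp
      grind
  have hsum := (hasSumLocallyUniformly_zetaExcept L 0).hasSum (x := z)
  have hq := logDeriv_tprod_eq_tsum Metric.isOpen_ball (x := z) (s := Metric.ball 0 (‖z‖ + 1))
    (by simp) (f := fun (l : L.lattice) z ↦ 1 + (sigmaFactor l z - 1)) (fun l ↦ by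
      rw [add_sub_cancel]
      exact sigmaFactor_ne_zero L (fun h ↦ hz h.1) l)
    (fun l ↦ by
      have := differentiable_sigmaFactor (l : ℂ)
      fun_prop)
    (by simpa only [hterm] using hsum.summable)
    (hasProdLocallyUniformlyOn_sigmaQuot L _).multipliableLocallyUniformlyOn
    (sigmaQuot_ne_zero L (fun h ↦ hz h.1))
  have hs : sigma L = fun z ↦ z * sigmaQuot L z := rfl
  rw [hs, logDeriv_mul (f := fun z ↦ z) (g := sigmaQuot L) z hz0
    (sigmaQuot_ne_zero L (fun h ↦ hz h.1)) (by fun_prop) (differentiable_sigmaQuot L z)]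
  have hq' : logDeriv (sigmaQuot L) z = zetaExcept L 0 z := by
    refine hq.trans ?_
    simp only [hterm]
    rfl
  rw [hq', zeta_eq_except_zero, logDeriv_id', add_comm]

theorem hasDerivAt_sigma {z : ℂ} (hz : z ∉ L.lattice) :
    HasDerivAt (sigma L) (weierstrassZeta L z * sigma L z) z := by
  have h := (differentiable_sigma L z).hasDerivAt
  have h2 := logDeriv_sigma L hz
  rw [logDeriv_apply, div_eq_iff (sigma_ne_zero L hz)] at h2
  rwa [h2] at h

/-- The sigma function is quasi-periodic. -/
theorem exists_sigma_add_coe (l : L.lattice) : ∃ c ≠ 0, ∀ z,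
    sigma L (z + l) = c * Complex.exp (quasiPeriod L l * z) * sigma L z := by
  -- The logarithmic derivative of $\sigma(z+l)/\sigma(z)$ is the quasi-period, so `F` is constant
  -- off the lattice; density of the complement recovers the identity at the zeros of σ.
  set F : ℂ → ℂ := fun z ↦ sigma L (z + l) * Complex.exp (-(quasiPeriod L l * z)) / sigma L z
  have hmem : ∀ {z}, z ∉ L.lattice → z + l ∉ L.lattice := fun hz h ↦
    hz ((add_coe_mem_lattice_iff L l).mp h)
  have hd : ∀ z ∉ L.lattice, HasDerivAt F 0 z := by
    intro z hz
    have h1 := (hasDerivAt_sigma L (hmem hz)).comp_add_const z (l : ℂ)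
    have h2 := ((hasDerivAt_id z).const_mul (quasiPeriod L l)).neg.cexp
    refine ((h1.mul h2).div (hasDerivAt_sigma L hz) (sigma_ne_zero L hz)).congr_deriv ?_
    have := sigma_ne_zero L hz
    rw [zeta_add_coe]
    simp only [id]
    field_simp
    simp
    ring
  have hconst := fun z (hz : z ∉ L.lattice) ↦
    L.isClosed_lattice.isOpen_compl.is_const_of_deriv_eq_zero (isPreconnected_compl_lattice L)
    (f := F) (fun z hz ↦ (hd z hz).differentiableAt.differentiableWithinAt)
    (fun z hz ↦ (hd z hz).deriv) hz L.ω₁_div_two_notMem_lattice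
  refine ⟨F (L.ω₁ / 2), ?_, ?_⟩
  · have h1 := sigma_ne_zero L L.ω₁_div_two_notMem_lattice
    have h2 := sigma_ne_zero L (hmem L.ω₁_div_two_notMem_lattice)
    exact div_ne_zero (mul_ne_zero h2 (Complex.exp_ne_zero _)) h1
  · have hσ := (differentiable_sigma L).continuous
    have hdense : Dense (L.lattice : Set ℂ)ᶜ := by
      have : (L.lattice : Set ℂ).Countable := L.latticeEquivProd.toEquiv.countable_iff.mpr inferInstance
      exact this.dense_compl ℂ
    refine congrFun (Continuous.ext_on hdense (f := fun z ↦ sigma L (z + l))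
      (g := fun z ↦ F (L.ω₁ / 2) * Complex.exp (quasiPeriod L l * z) * sigma L z)
      (by fun_prop) (by fun_prop) fun z hz ↦ ?_)
    have h0 := sigma_ne_zero L hz
    rw [← hconst z hz]
    simp only [F, Complex.exp_neg]
    field_simp

end Sigma

/-! ### The Kronecker function. -/

section Kronecker

variable (L : PeriodPair)

/-- The function `σ(z + v) / (σ(z) σ(v)) * exp (-c z)`. -/
def kronecker (v c z : ℂ) : ℂ :=
  sigma L (z + v) / (sigma L z * sigma L v) * Complex.exp (-(c * z))

theorem kronecker_add_coe (v c z : ℂ) (l : L.lattice) : kronecker L v c (z + l) =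
    Complex.exp (quasiPeriod L l * v - c * l) * kronecker L v c z := by
  obtain ⟨a, ha, h⟩ := exists_sigma_add_coe L l
  rw [kronecker, kronecker, show z + l + v = z + v + l by ring, h, h]
  rw [show quasiPeriod L l * (z + v) = quasiPeriod L l * z + quasiPeriod L l * v by ring,
    show -(c * (z + l)) = -(c * z) + -(c * l) by ring, sub_eq_add_neg, Complex.exp_add,
    Complex.exp_add, Complex.exp_add]
  have := Complex.exp_ne_zero (quasiPeriod L l * z)
  field_simp

theorem analyticAt_sigma (z : ℂ) : AnalyticAt ℂ (sigma L) z := (differentiable_sigma L).analyticAt z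

theorem analyticAt_kronecker {v c z : ℂ} (hv : v ∉ L.lattice) (hz : z ∉ L.lattice) :
    AnalyticAt ℂ (kronecker L v c) z := by
  have h1 := analyticAt_sigma L z
  have h2 : AnalyticAt ℂ (fun z ↦ sigma L (z + v)) z :=
    (analyticAt_sigma L _).comp_of_eq (by fun_prop) rfl
  have h3 := mul_ne_zero (sigma_ne_zero L hz) (sigma_ne_zero L hv)
  unfold kronecker
  fun_prop (disch := assumption)

/-- The Laurent expansion of the Kronecker function at the origin. -/
theorem exists_kronecker_eq {v : ℂ} (hv : v ∉ L.lattice) (c : ℂ) : ∃ M : ℂ → ℂ, AnalyticAt ℂ M 0 ∧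
    M 0 = weierstrassZeta L v - c ∧ ∀ᶠ z in 𝓝[≠] 0, kronecker L v c z = 1 / z + M z := by
  -- $\sigma(z)/z$ is even, so it has no linear term. Hence the constant term of the Laurent
  -- expansion comes only from $\sigma(z+v)$ and the exponential.
  have hS : HasDerivAt (sigmaQuot L) 0 0 := by
    have h := (differentiable_sigmaQuot L 0).hasDerivAt
    have h3 := deriv_comp_neg (sigmaQuot L) 0
    simp only [sigmaQuot_neg, neg_zero] at h3
    rw [CharZero.eq_neg_self_iff] at h3
    rwa [h3] at h
  have hSa := (differentiable_sigmaQuot L).analyticAt 0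
  have h2 : AnalyticAt ℂ (fun z ↦ sigma L (z + v)) 0 :=
    (analyticAt_sigma L _).comp_of_eq (by fun_prop) rfl
  have hσv := sigma_ne_zero L hv
  have hS0 : sigmaQuot L 0 * sigma L v ≠ 0 := by rwa [sigmaQuot_zero, one_mul]
  set q : ℂ → ℂ := fun z ↦
    sigma L (z + v) / (sigmaQuot L z * sigma L v) * Complex.exp (-(c * z)) - 1 with hq
  have hqa : AnalyticAt ℂ q 0 := by fun_prop (disch := assumption)
  have hq0 : q 0 = 0 := by
    simp [hq, sigmaQuot_zero, hσv]
  have hq' : HasDerivAt q (weierstrassZeta L v - c) 0 := by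
    have h1 := (hasDerivAt_sigma L (z := 0 + v) (by simpa using hv)).comp_add_const 0 v
    have h3 := ((hasDerivAt_id (0 : ℂ)).const_mul c).neg.cexp
    refine (((h1.div (hS.mul_const (sigma L v)) hS0).mul h3).sub_const 1).congr_deriv ?_
    simp [sigmaQuot_zero]
    field_simp
    ring
  obtain ⟨M, hM, hMe⟩ := exists_analyticAt_eq_pow_mul hqa 1 (by
    intro i hi
    interval_cases i
    simpa using hq0)
  refine ⟨M, hM, ?_, ?_⟩
  · have : HasDerivAt q (1 * M 0 + 0 * deriv M 0) 0 := by
      refine ((hasDerivAt_id (0 : ℂ)).mul hM.differentiableAt.hasDerivAt).congr_of_eventuallyEq ?_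
      filter_upwards [hMe] with z hz
      simpa using hz
    simpa using this.unique hq'
  · filter_upwards [nhdsWithin_le_nhds hMe, self_mem_nhdsWithin] with z hz hz0
    have hz0 : z ≠ 0 := hz0
    have : M z = q z / z := by
      rw [hz]
      field_simp
      ring
    simp only [this, hq, kronecker, show sigma L z = z * sigmaQuot L z from rfl]
    field_simp
    ring

end Kronecker

end TorsionForms

namespace TorsionForms

open Filter Topology

/-! ### Elliptic functions with one simple pole and the Legendre relation up to sign. -/

section Legendre

variable (L : PeriodPair)

theorem analyticAt_comp_neg {f : ℂ → ℂ} {z : ℂ} (h : AnalyticAt ℂ f (-z)) :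
    AnalyticAt ℂ (fun z ↦ f (-z)) z :=
  h.comp_of_eq (by fun_prop) rfl

theorem analyticAt_comp_add_const {f : ℂ → ℂ} {z a : ℂ} (h : AnalyticAt ℂ f (z + a)) :
    AnalyticAt ℂ (fun z ↦ f (z + a)) z :=
  h.comp_of_eq (by fun_prop) rfl

theorem half_add_half_notMem_lattice : L.ω₂ / 2 + L.ω₁ / 2 ∉ L.lattice := by
  intro h
  have := (L.mul_ω₁_add_mul_ω₂_mem_lattice (α := 1 / 2) (β := 1 / 2)).mp
    (by convert! h using 1; push_cast; ring)
  norm_num at this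

/-- Up to a constant, an elliptic function with one simple pole vanishes at the half periods. -/
theorem exists_eq_at_half_periods {f : ℂ → ℂ} (hf : ∀ z ∉ L.lattice, AnalyticAt ℂ f z)
    (hp : ∀ l ∈ L.lattice, ∀ z ∉ L.lattice, f (z + l) = f z)
    (h0 : RemovableAt (fun z ↦ f z - 1 / z) 0) :
    ∃ c, ∀ z ∉ L.lattice, z + z ∈ L.lattice → f z = c := by
  -- The poles of $f(z)$ and $f(-z)$ cancel, so the sum is constant, and the two summands agree at
  -- half periods.
  have hr : ∀ x, RemovableAt (fun z ↦ f z + f (-z)) x := by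
    intro x
    by_cases hx : x ∈ L.lattice
    · refine RemovableAt.of_periodic (l := -x) ?_ ?_
      · rw [add_neg_cancel]
        obtain ⟨g, hg, he⟩ := h0
        refine ⟨fun z ↦ g z + g (-z), hg.add (analyticAt_comp_neg (by simpa using hg)), ?_⟩
        have he' : ∀ᶠ z in 𝓝[≠] (0 : ℂ), f (-z) - 1 / (-z) = g (-z) := by
          have : Tendsto (fun z : ℂ ↦ -z) (𝓝[≠] 0) (𝓝[≠] 0) := by
            refine tendsto_nhdsWithin_iff.mpr ⟨?_, ?_⟩
            · exact (by simpa using (continuous_neg (G := ℂ)).tendsto 0 :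
                Tendsto (fun z : ℂ ↦ -z) (𝓝 0) (𝓝 0)).mono_left nhdsWithin_le_nhds
            · filter_upwards [self_mem_nhdsWithin] with w hw
              simpa using hw
          exact this.eventually he
        filter_upwards [he, he'] with z h1 h2
        rw [← h1, ← h2, div_neg]
        ring
      · filter_upwards [eventually_notMem_lattice L x] with z hz
        rw [hp _ (by simpa using hx) z hz, neg_add, neg_neg, hp x hx _ (by simpa using hz)]
    · exact .of_analyticAt ((hf x hx).add (analyticAt_comp_neg (hf _ (by simpa using hx))))
  obtain ⟨c, hc⟩ := elliptic_const L hr (fun l hl x ↦ by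
    filter_upwards [eventually_notMem_lattice L x] with z hz
    rw [hp _ hl z hz, neg_add, hp _ (neg_mem hl) _ (by simpa using hz)])
  refine ⟨c / 2, fun z hz hzz ↦ ?_⟩
  have h1 := hc z ((hf z hz).add (analyticAt_comp_neg (hf _ (by simpa using hz)))).continuousAt
  have h2 := hp _ hzz (-z) (by simpa using hz)
  rw [neg_add_cancel_left] at h2
  simp only [← h2] at h1
  linear_combination h1 / 2

/-- There is no elliptic function with a single simple pole. -/
theorem not_exists_simple_pole {f : ℂ → ℂ} (hf : ∀ z ∉ L.lattice, AnalyticAt ℂ f z)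
    (hp : ∀ l ∈ L.lattice, ∀ z ∉ L.lattice, f (z + l) = f z)
    (h0 : RemovableAt (fun z ↦ f z - 1 / z) 0) : False := by
  have m1 := L.ω₁_div_two_notMem_lattice
  have m2 := L.ω₂_div_two_notMem_lattice
  have m3 := half_add_half_notMem_lattice L
  obtain ⟨c, hc⟩ := exists_eq_at_half_periods L hf hp h0
  have c1 := hc _ m1 (by rw [add_halves]; exact L.ω₁_mem_lattice)
  have c2 := hc _ m2 (by rw [add_halves]; exact L.ω₂_mem_lattice)
  -- The product of $f(z)-c$ and $f(z+w)-c$ is elliptic without poles: the simple pole of each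
  -- factor meets a zero of the other. Its constant value is zero, as seen at $\omega_2/2$. Near the
  -- origin $f\ne c$, so $f=c$ near $w$ and hence everywhere off the lattice, a contradiction.
  set w := L.ω₁ / 2 with hw
  obtain ⟨g, hg, he⟩ := h0
  have hww : w + w ∈ L.lattice := by rw [hw, add_halves]; exact L.ω₁_mem_lattice
  have hshift : ∀ x l, l ∈ L.lattice → ∀ᶠ z in 𝓝[≠] x,
      (f (z + l) - c) * (f (z + l + w) - c) = (f z - c) * (f (z + w) - c) := by
    intro x l hl
    filter_upwards [eventually_notMem_lattice L x,
      (tendsto_add_const_nhdsNE x w).eventually (eventually_notMem_lattice L (x + w))] with z h1 h2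
    rw [hp l hl z h1, show z + l + w = z + w + l by ring, hp l hl _ h2]
  have hshift' : ∀ x, ∀ᶠ z in 𝓝[≠] x,
      (f (z + w) - c) * (f (z + w + w) - c) = (f z - c) * (f (z + w) - c) := by
    intro x
    filter_upwards [eventually_notMem_lattice L x] with z h1
    rw [add_assoc, hp _ hww z h1, mul_comm]
  have hr0 : RemovableAt (fun z ↦ (f z - c) * (f (z + w) - c)) 0 := by
    have ha : AnalyticAt ℂ (fun z ↦ f (z + w) - c) 0 :=
      (analyticAt_comp_add_const (hf _ (by simpa using m1))).sub analyticAt_const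
    obtain ⟨M, hM, hMe⟩ := exists_analyticAt_eq_pow_mul ha 1 (by
      intro i hi
      interval_cases i
      simp [c1])
    refine ⟨fun z ↦ (g z - c) * (f (z + w) - c) + M z, by fun_prop, ?_⟩
    filter_upwards [he, nhdsWithin_le_nhds hMe, self_mem_nhdsWithin] with z h1 h2 h3
    have h3 : z ≠ 0 := h3
    have hM' : M z = (f (z + w) - c) / z := by
      rw [h2]
      field_simp
      ring
    rw [hM', ← h1]
    field_simp
    ring
  have hr : ∀ x, RemovableAt (fun z ↦ (f z - c) * (f (z + w) - c)) x := by
    intro x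
    have hrL : ∀ x ∈ L.lattice, RemovableAt (fun z ↦ (f z - c) * (f (z + w) - c)) x := by
      intro x hx
      refine RemovableAt.of_periodic (l := -x) ?_ (hshift x _ (neg_mem hx))
      rwa [add_neg_cancel]
    by_cases hx : x ∈ L.lattice
    · exact hrL x hx
    by_cases hxw : x + w ∈ L.lattice
    · exact RemovableAt.of_periodic (l := w) (hrL _ hxw) (hshift' x)
    exact .of_analyticAt (((hf x hx).sub analyticAt_const).mul
      ((analyticAt_comp_add_const (hf _ hxw)).sub analyticAt_const))
  obtain ⟨C, hC⟩ := elliptic_const L hr (fun l hl x ↦ hshift x l hl)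
  have hC0 : ∀ z ∉ L.lattice, z + w ∉ L.lattice → (f z - c) * (f (z + w) - c) = C := fun z h1 h2 ↦
    hC z (((hf z h1).sub analyticAt_const).mul
      ((analyticAt_comp_add_const (hf _ h2)).sub analyticAt_const)).continuousAt
  have hCz : C = 0 := by
    rw [← hC0 _ m2 m3, c2, sub_self, zero_mul]
  -- near the origin `f` is not equal to `c`
  have hne : ∀ᶠ z in 𝓝[≠] (0 : ℂ), f z ≠ c := by
    have h1 : Tendsto (fun z ↦ z * (g z - c)) (𝓝[≠] 0) (𝓝 0) := by
      have h : ContinuousAt (fun z ↦ z * (g z - c)) 0 := by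
        have := hg.continuousAt
        fun_prop
      have h2 := h.tendsto.mono_left (nhdsWithin_le_nhds (s := {(0 : ℂ)}ᶜ))
      simpa using h2
    have h2 : ∀ᶠ z in 𝓝[≠] (0 : ℂ), z * (g z - c) ≠ -1 := h1.eventually_ne (by norm_num)
    filter_upwards [he, h2, self_mem_nhdsWithin] with z h3 h4 h5 h6
    have h5 : z ≠ 0 := h5
    apply h4
    rw [← h3, h6]
    field_simp
    ring
  have hzero : ∀ᶠ z in 𝓝[≠] (0 + w), f z = c := by
    have h1 : ∀ᶠ z in 𝓝[≠] (0 : ℂ), f (z + w) = c := by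
      filter_upwards [hne, eventually_notMem_lattice L 0,
        (tendsto_add_const_nhdsNE 0 w).eventually (eventually_notMem_lattice L (0 + w))]
        with z h1 h2 h3
      have := hC0 z h2 h3
      rw [hCz, mul_eq_zero, sub_eq_zero, sub_eq_zero] at this
      exact this.resolve_left h1
    have h2 := (tendsto_add_const_nhdsNE (0 + w) (-w))
    rw [add_neg_cancel_right] at h2
    filter_upwards [h2.eventually h1] with z hz
    simpa using hz
  have hfa : AnalyticOnNhd ℂ f (L.lattice : Set ℂ)ᶜ := fun z hz ↦ hf z hz
  have heq := hfa.eqOn_of_preconnected_of_frequently_eq (analyticOnNhd_const (v := c))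
    (isPreconnected_compl_lattice L) (z₀ := 0 + w) (by simpa using m1) hzero.frequently
  obtain ⟨z, h1, h2⟩ := (hne.and (eventually_notMem_lattice L 0)).exists
  exact h1 (heq h2)

/-- The two basic periods as elements of the lattice. -/
def period₁ : L.lattice := ⟨L.ω₁, L.ω₁_mem_lattice⟩
def period₂ : L.lattice := ⟨L.ω₂, L.ω₂_mem_lattice⟩

/-- The Legendre determinant `η₁ ω₂ - η₂ ω₁`. -/
def legendre : ℂ := quasiPeriod L (period₁ L) * L.ω₂ - quasiPeriod L (period₂ L) * L.ω₁

/-- The multiplier of σ under $\omega_1+\omega_2$ can be computed by adding the periods in either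
order; the two results differ by the factor $e^{\eta_1\omega_2-\eta_2\omega_1}$. -/
theorem exp_legendre : Complex.exp (legendre L) = 1 := by
  obtain ⟨a, ha, h1⟩ := exists_sigma_add_coe L (period₁ L)
  obtain ⟨b, hb, h2⟩ := exists_sigma_add_coe L (period₂ L)
  have e1 : (period₁ L : ℂ) = L.ω₁ := rfl
  have e2 : (period₂ L : ℂ) = L.ω₂ := rfl
  rw [e1] at h1
  rw [e2] at h2
  have h3 := h1 (L.ω₁ / 2 + L.ω₂)
  have h4 := h2 (L.ω₁ / 2 + L.ω₁)
  rw [h2] at h3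
  rw [h1, add_right_comm, h3] at h4
  have h5 := sigma_ne_zero L L.ω₁_div_two_notMem_lattice
  rw [legendre, Complex.exp_sub, div_eq_one_iff_eq (Complex.exp_ne_zero _)]
  rw [mul_add, mul_add, Complex.exp_add, Complex.exp_add] at h4
  have n1 := Complex.exp_ne_zero (quasiPeriod L (period₁ L) * (L.ω₁ / 2))
  have n2 := Complex.exp_ne_zero (quasiPeriod L (period₂ L) * (L.ω₁ / 2))
  have h6 : a * b * Complex.exp (quasiPeriod L (period₁ L) * (L.ω₁ / 2)) *
      Complex.exp (quasiPeriod L (period₂ L) * (L.ω₁ / 2)) * sigma L (L.ω₁ / 2) ≠ 0 := by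
    simp [ha, hb, h5]
  apply mul_left_cancel₀ h6
  linear_combination h4

theorem quasiPeriod_zsmul (n : ℤ) (l : L.lattice) : quasiPeriod L (n • l) = n * quasiPeriod L l := by
  have := map_zsmul (quasiPeriodHom L) n l
  simpa [quasiPeriodHom] using this

theorem exists_eq_periods (l : L.lattice) : ∃ i j : ℤ, l = i • period₂ L + j • period₁ L := by
  obtain ⟨m, n, h⟩ := PeriodPair.mem_lattice.mp l.2
  refine ⟨n, m, Subtype.ext ?_⟩
  rw [← h]
  simp [period₁, period₂, add_comm]

theorem quasiPeriod_eq (i j : ℤ) : quasiPeriod L (i • period₂ L + j • period₁ L) =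
    i * quasiPeriod L (period₂ L) + j * quasiPeriod L (period₁ L) := by
  rw [quasiPeriod_add, quasiPeriod_zsmul, quasiPeriod_zsmul]

theorem coe_periods (i j : ℤ) : ((i • period₂ L + j • period₁ L : L.lattice) : ℂ) =
    i * L.ω₂ + j * L.ω₁ := by
  simp [period₁, period₂]

/-- The multiplier of the normalized Kronecker function. -/
theorem kronecker_add_periods (r s z : ℂ) (i j : ℤ) :
    kronecker L (r * L.ω₂ + s * L.ω₁)
      (r * quasiPeriod L (period₂ L) + s * quasiPeriod L (period₁ L)) (z + (i * L.ω₂ + j * L.ω₁)) =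
    Complex.exp ((j * r - i * s) * legendre L) * kronecker L (r * L.ω₂ + s * L.ω₁)
      (r * quasiPeriod L (period₂ L) + s * quasiPeriod L (period₁ L)) z := by
  rw [← coe_periods, kronecker_add_coe, quasiPeriod_eq, coe_periods, legendre]
  congr 2
  ring

/-- A weak form of the Legendre relation. -/
theorem legendre_relation : ∃ d : ℤ, (d = 1 ∨ d = -1) ∧
    legendre L = 2 * Real.pi * Complex.I * d := by
  obtain ⟨d, hd⟩ := Complex.exp_eq_one_iff.mp (exp_legendre L)
  refine ⟨d, ?_, by rw [hd]; ring⟩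
  by_contra hne
  -- If $d\ne\pm1$ there is a non-integral $r$ with $rd\in\mathbb Z$. The Kronecker function at
  -- $v=r\omega_2$ then has trivial multipliers, so it would be elliptic with a single simple pole.
  obtain ⟨r, m, hr, hm⟩ : ∃ (r : ℚ) (m : ℤ), r.den ≠ 1 ∧ r * d = m := by
    by_cases h0 : d = 0
    · exact ⟨1 / 2, 0, by norm_num, by simp [h0]⟩
    · refine ⟨1 / d, 1, fun h ↦ ?_, by field_simp; simp⟩
      have h1 := Rat.coe_int_num_of_den_eq_one h
      have h2 : ((1 / d : ℚ).num * d : ℤ) = 1 := by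
        have : (((1 / d : ℚ).num * d : ℤ) : ℚ) = 1 := by
          push_cast
          rw [h1]
          field_simp
        exact_mod_cast this
      rcases Int.eq_one_or_neg_one_of_mul_eq_one' h2 with h | h <;> omega
  have hv : (r : ℂ) * L.ω₂ + (0 : ℂ) * L.ω₁ ∉ L.lattice := by
    intro h
    have := (L.mul_ω₁_add_mul_ω₂_mem_lattice (α := 0) (β := r)).mp
      (by convert! h using 1; push_cast; ring)
    exact hr this.2
  refine not_exists_simple_pole L (fun z hz ↦ analyticAt_kronecker L (c := r * quasiPeriod L (period₂ L) + (0 : ℂ) * quasiPeriod L (period₁ L)) hv hz) ?_ ?_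
  · intro l hl z hz
    obtain ⟨i, j, h⟩ := exists_eq_periods L ⟨l, hl⟩
    have h' : l = i * L.ω₂ + j * L.ω₁ := by
      rw [← coe_periods, ← h]
    rw [h', kronecker_add_periods, Complex.exp_eq_one_iff.mpr ⟨j * m, ?_⟩, one_mul]
    rw [hd]
    have : (r : ℂ) * d = m := by exact_mod_cast hm
    push_cast
    linear_combination (j * (2 * Real.pi * Complex.I) : ℂ) * this
  · obtain ⟨M, hM, -, hMe⟩ := exists_kronecker_eq L hv (r * quasiPeriod L (period₂ L) + (0 : ℂ) * quasiPeriod L (period₁ L))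
    refine ⟨M, hM, ?_⟩
    filter_upwards [hMe] with z hz
    rw [hz]
    ring

end Legendre

end TorsionForms

namespace TorsionForms

open Filter Topology

/-! ### Finite Fourier self-duality of the normalized zeta values. -/

section Fourier

variable (L : PeriodPair)

theorem sum_range_add_of_periodic {M : Type*} [AddCommGroup M] {N : ℕ} {f : ℤ → M}
    (hf : ∀ i, f (i + N) = f i) (k : ℤ) :
    ∑ i ∈ Finset.range N, f (i + k) = ∑ i ∈ Finset.range N, f i := by
  have key : ∀ k : ℤ, ∑ i ∈ Finset.range N, f (i + (k + 1)) = ∑ i ∈ Finset.range N, f (i + k) := by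
    intro k
    have h1 := Finset.sum_range_succ' (fun i : ℕ ↦ f (i + k)) N
    rw [Finset.sum_range_succ] at h1
    have h2 : f ((N : ℤ) + k) = f k := by rw [add_comm, hf]
    simp only [h2, Nat.cast_zero, zero_add, Nat.cast_add, Nat.cast_one] at h1
    rw [add_right_cancel h1]
    exact Finset.sum_congr rfl fun i _ ↦ by ring_nf
  induction k using Int.induction_on with
  | zero => simp
  | succ n ih => rw [key, ih]
  | pred n ih =>
    rw [← ih, ← key]
    simp

theorem sum_range_range_add_of_periodic {M : Type*} [AddCommGroup M] {N : ℕ}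
    {f : ℤ → ℤ → M} (h1 : ∀ i j, f (i + N) j = f i j) (h2 : ∀ i j, f i (j + N) = f i j)
    (k m : ℤ) : ∑ i ∈ Finset.range N, ∑ j ∈ Finset.range N, f (i + k) (j + m) =
      ∑ i ∈ Finset.range N, ∑ j ∈ Finset.range N, f i j := by
  rw [← sum_range_add_of_periodic (f := fun i ↦ ∑ j ∈ Finset.range N, f i j)
    (fun i ↦ Finset.sum_congr rfl fun j _ ↦ h1 i j) k]
  exact Finset.sum_congr rfl fun i _ ↦ sum_range_add_of_periodic (h2 _) m

/-- The zeta function, made periodic by subtracting a real-linear function. -/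
def zetaNorm (r s : ℂ) : ℂ := weierstrassZeta L (r * L.ω₂ + s * L.ω₁)
  - r * quasiPeriod L (period₂ L) - s * quasiPeriod L (period₁ L)

theorem zeta_add_periods (z : ℂ) (i j : ℤ) : weierstrassZeta L (z + (i * L.ω₂ + j * L.ω₁)) =
    weierstrassZeta L z + (i * quasiPeriod L (period₂ L) + j * quasiPeriod L (period₁ L)) := by
  rw [← coe_periods, zeta_add_coe, quasiPeriod_eq]

theorem zetaNorm_add_int (r s : ℂ) (i j : ℤ) : zetaNorm L (r + i) (s + j) = zetaNorm L r s := by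
  rw [zetaNorm, zetaNorm, show (r + i) * L.ω₂ + (s + j) * L.ω₁ =
    r * L.ω₂ + s * L.ω₁ + (i * L.ω₂ + j * L.ω₁) by ring, zeta_add_periods]
  ring

theorem zetaNorm_neg (r s : ℂ) : zetaNorm L (-r) (-s) = -zetaNorm L r s := by
  rw [zetaNorm, zetaNorm, show -r * L.ω₂ + -s * L.ω₁ = -(r * L.ω₂ + s * L.ω₁) by ring, zeta_neg]
  ring

/-- The character of `(ℤ/N)²` attached to the point `(a/N, b/N)`. -/
def weilChar (N : ℕ) (a b i j : ℤ) : ℂ :=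
  Complex.exp ((j * (a / N) - i * (b / N)) * legendre L)

theorem weilChar_add (N : ℕ) (a b i j k m : ℤ) :
    weilChar L N a b (i + k) (j + m) = weilChar L N a b i j * weilChar L N a b k m := by
  rw [weilChar, weilChar, weilChar, ← Complex.exp_add]
  push_cast
  ring_nf

theorem exp_int_mul_legendre (n : ℤ) : Complex.exp (n * legendre L) = 1 := by
  rw [Complex.exp_int_mul, exp_legendre, one_zpow]

theorem weilChar_eq_one_of_dvd {N : ℕ} (hN : N ≠ 0) {a b i j : ℤ}
    (h : (N : ℤ) ∣ j * a - i * b) : weilChar L N a b i j = 1 := by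
  obtain ⟨k, hk⟩ := h
  rw [← exp_int_mul_legendre L k, weilChar]
  congr 2
  have : (j * a - i * b : ℂ) = N * k := by exact_mod_cast hk
  field_simp
  linear_combination this

/-- Nondegeneracy of the pairing. The Legendre relation up to sign suffices, because $d=\pm1$ is a
unit. -/
theorem dvd_of_weilChar_eq_one {N : ℕ} (hN : N ≠ 0) {a b i j : ℤ}
    (h : weilChar L N a b i j = 1) : (N : ℤ) ∣ j * a - i * b := by
  obtain ⟨d, hd, hD⟩ := legendre_relation L
  rw [weilChar, hD, Complex.exp_eq_one_iff] at h
  obtain ⟨k, hk⟩ := h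
  have hpi := Complex.two_pi_I_ne_zero
  have h1 : ((j * a - i * b) * d : ℂ) = N * k := by
    apply mul_left_cancel₀ hpi
    field_simp at hk
    linear_combination 2 * Real.pi * Complex.I * hk
  have h2 : (j * a - i * b) * d = N * k := by exact_mod_cast h1
  rcases hd with rfl | rfl
  · exact ⟨k, by linarith⟩
  · exact ⟨-k, by linarith⟩

theorem weilChar_add_left {N : ℕ} (hN : N ≠ 0) (a b i j : ℤ) :
    weilChar L N a b (i + N) j = weilChar L N a b i j := by
  have := weilChar_add L N a b i j N 0
  rwa [add_zero, weilChar_eq_one_of_dvd L hN (i := N) (j := 0) ⟨-b, by ring⟩, mul_one] at this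

theorem weilChar_add_right {N : ℕ} (hN : N ≠ 0) (a b i j : ℤ) :
    weilChar L N a b i (j + N) = weilChar L N a b i j := by
  have := weilChar_add L N a b i j 0 N
  rwa [add_zero, weilChar_eq_one_of_dvd L hN (i := 0) (j := N) ⟨a, by ring⟩, mul_one] at this

/-- The term of the partial fraction expansion of the Kronecker function. -/
def kroneckerTerm (N : ℕ) (w : ℂ) (i j : ℤ) : ℂ :=
  weierstrassZeta L (w - (i * L.ω₂ + j * L.ω₁) / N) +
    (i * quasiPeriod L (period₂ L) + j * quasiPeriod L (period₁ L)) / N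

theorem kroneckerTerm_add_left {N : ℕ} (hN : N ≠ 0) (w : ℂ) (i j : ℤ) :
    kroneckerTerm L N w (i + N) j = kroneckerTerm L N w i j := by
  have hN' : (N : ℂ) ≠ 0 := by exact_mod_cast hN
  have := zeta_add_periods L (w - ((i + N) * L.ω₂ + j * L.ω₁) / N) 1 0
  rw [kroneckerTerm, kroneckerTerm, show w - (i * L.ω₂ + j * L.ω₁) / N =
    w - ((i + N) * L.ω₂ + j * L.ω₁) / N + (((1 : ℤ) : ℂ) * L.ω₂ + ((0 : ℤ) : ℂ) * L.ω₁) by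
      push_cast; field_simp; ring, this]
  push_cast
  field_simp
  ring

theorem kroneckerTerm_add_right {N : ℕ} (hN : N ≠ 0) (w : ℂ) (i j : ℤ) :
    kroneckerTerm L N w i (j + N) = kroneckerTerm L N w i j := by
  have hN' : (N : ℂ) ≠ 0 := by exact_mod_cast hN
  have := zeta_add_periods L (w - (i * L.ω₂ + (j + N) * L.ω₁) / N) 0 1
  rw [kroneckerTerm, kroneckerTerm, show w - (i * L.ω₂ + j * L.ω₁) / N =
    w - (i * L.ω₂ + (j + N) * L.ω₁) / N + (((0 : ℤ) : ℂ) * L.ω₂ + ((1 : ℤ) : ℂ) * L.ω₁) by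
      push_cast; field_simp; ring, this]
  push_cast
  field_simp
  ring

theorem kroneckerTerm_shift {N : ℕ} (w : ℂ) (i j k m : ℤ) :
    kroneckerTerm L N (w + (k * L.ω₂ + m * L.ω₁) / N) (i + k) (j + m) =
    kroneckerTerm L N w i j +
      (k * quasiPeriod L (period₂ L) + m * quasiPeriod L (period₁ L)) / N := by
  rw [kroneckerTerm, kroneckerTerm]
  push_cast
  ring_nf

/-- The sum of the partial fraction expansion of the Kronecker function. -/
def kroneckerSum (N : ℕ) (a b : ℤ) (w : ℂ) : ℂ :=
  ∑ i ∈ Finset.range N, ∑ j ∈ Finset.range N, weilChar L N a b i j * kroneckerTerm L N w i j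

theorem exists_weilChar_ne_one {N : ℕ} (hN : N ≠ 0) {a b : ℤ} (hab : ¬((N : ℤ) ∣ a ∧ (N : ℤ) ∣ b)) :
    ∃ k m, weilChar L N a b k m ≠ 1 := by
  by_contra! h
  refine hab ⟨?_, ?_⟩
  · simpa using dvd_of_weilChar_eq_one L hN (h 0 1)
  · simpa using dvd_of_weilChar_eq_one L hN (h 1 0)

theorem sum_weilChar {N : ℕ} (hN : N ≠ 0) {a b : ℤ} (hab : ¬((N : ℤ) ∣ a ∧ (N : ℤ) ∣ b)) :
    ∑ i ∈ Finset.range N, ∑ j ∈ Finset.range N, weilChar L N a b i j = 0 := by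
  obtain ⟨k, m, hkm⟩ := exists_weilChar_ne_one L hN hab
  have := sum_range_range_add_of_periodic (weilChar_add_left L hN a b)
    (weilChar_add_right L hN a b) k m
  simp only [weilChar_add, ← Finset.sum_mul] at this
  by_contra h
  exact hkm (mul_eq_left₀ h |>.mp this)

/-- Reindexing by $(k,m)$ produces the character value and an additive constant from the
quasi-periods; the constant is multiplied by the sum of a nontrivial character and disappears. -/
theorem kroneckerSum_shift {N : ℕ} (hN : N ≠ 0) {a b : ℤ} (hab : ¬((N : ℤ) ∣ a ∧ (N : ℤ) ∣ b))
    (w : ℂ) (k m : ℤ) : kroneckerSum L N a b (w + (k * L.ω₂ + m * L.ω₁) / N) =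
      weilChar L N a b k m * kroneckerSum L N a b w := by
  rw [kroneckerSum, ← sum_range_range_add_of_periodic (f := fun i j ↦ weilChar L N a b i j *
    kroneckerTerm L N (w + (k * L.ω₂ + m * L.ω₁) / N) i j)
    (fun i j ↦ by rw [weilChar_add_left L hN, kroneckerTerm_add_left L hN])
    (fun i j ↦ by rw [weilChar_add_right L hN, kroneckerTerm_add_right L hN]) k m]
  simp only [weilChar_add, kroneckerTerm_shift, mul_add, Finset.sum_add_distrib]
  have h := sum_weilChar L hN hab
  have e : ∀ c : ℂ, ∑ i ∈ Finset.range N, ∑ j ∈ Finset.range N,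
      weilChar L N a b i j * weilChar L N a b k m * c = 0 := by
    intro c
    simp only [mul_assoc, ← Finset.sum_mul, h, zero_mul]
  rw [e, add_zero, kroneckerSum, Finset.mul_sum]
  refine Finset.sum_congr rfl fun i _ ↦ ?_
  rw [Finset.mul_sum]
  exact Finset.sum_congr rfl fun j _ ↦ by ring

theorem div_notMem_lattice {N : ℕ} (hN : N ≠ 0) {a b : ℤ} (hab : ¬((N : ℤ) ∣ a ∧ (N : ℤ) ∣ b)) :
    (a / N : ℂ) * L.ω₂ + (b / N : ℂ) * L.ω₁ ∉ L.lattice := by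
  intro h
  have hN' : (N : ℂ) ≠ 0 := by exact_mod_cast hN
  obtain ⟨i, j, hij⟩ := exists_eq_periods L ⟨_, h⟩
  have h1 := congrArg (Subtype.val) hij
  rw [coe_periods] at h1
  have h2 := LinearIndependent.pair_iff.mp L.indep ((b / N : ℝ) - j) ((a / N : ℝ) - i) (by
    simp
    linear_combination h1)
  have hN'' : (N : ℝ) ≠ 0 := by exact_mod_cast hN
  refine hab ⟨⟨i, ?_⟩, ⟨j, ?_⟩⟩
  · have := h2.2
    field_simp at this
    have h3 : (a : ℝ) = N * i := by linear_combination this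
    exact_mod_cast h3
  · have := h2.1
    field_simp at this
    have h3 : (b : ℝ) = N * j := by linear_combination this
    exact_mod_cast h3

/-- The values of the Kronecker function minus its partial fraction expansion. -/
def kroneckerDiff (N : ℕ) (a b : ℤ) (w : ℂ) : ℂ :=
  kronecker L (a / N * L.ω₂ + b / N * L.ω₁)
    (a / N * quasiPeriod L (period₂ L) + b / N * quasiPeriod L (period₁ L)) (N * w) -
    kroneckerSum L N a b w / N

theorem kroneckerDiff_shift {N : ℕ} (hN : N ≠ 0) {a b : ℤ} (hab : ¬((N : ℤ) ∣ a ∧ (N : ℤ) ∣ b))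
    (w : ℂ) (k m : ℤ) : kroneckerDiff L N a b (w + (k * L.ω₂ + m * L.ω₁) / N) =
      weilChar L N a b k m * kroneckerDiff L N a b w := by
  have hN' : (N : ℂ) ≠ 0 := by exact_mod_cast hN
  rw [kroneckerDiff, kroneckerDiff, kroneckerSum_shift L hN hab, mul_add, mul_div_cancel₀ _ hN',
    kronecker_add_periods, weilChar]
  ring

/-- Weight one duality: the function `zetaNorm` on `(1/N)ℤ²` is its own Fourier transform. -/
theorem zetaNorm_eq_sum {N : ℕ} (hN : N ≠ 0) {a b : ℤ} (hab : ¬((N : ℤ) ∣ a ∧ (N : ℤ) ∣ b)) :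
    zetaNorm L (a / N) (b / N) = -(1 / N) * ∑ i ∈ Finset.range N, ∑ j ∈ Finset.range N,
      weilChar L N a b i j * zetaNorm L (i / N) (j / N) := by
  -- The Kronecker function at $Nw$ and the character sum of zeta values divided by $N$ have the
  -- same poles, and the same multipliers under translation by $\frac1N L$. Their difference
  -- therefore vanishes, and its constant term at $w=0$ is the asserted identity.
  have hN' : (N : ℂ) ≠ 0 := by exact_mod_cast hN
  have hv := div_notMem_lattice L hN hab
  set v : ℂ := a / N * L.ω₂ + b / N * L.ω₁ with hvdef
  set c : ℂ := a / N * quasiPeriod L (period₂ L) + b / N * quasiPeriod L (period₁ L) with hcdef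
  obtain ⟨M, hM, hM0, hMe⟩ := exists_kronecker_eq L hv c
  -- the regular part of the sum at the origin
  set s : Finset (ℕ × ℕ) := Finset.range N ×ˢ Finset.range N with hs
  have h00 : ((0, 0) : ℕ × ℕ) ∈ s := by simp [hs, Nat.pos_of_ne_zero hN]
  set R : ℂ → ℂ := fun w ↦ ∑ p ∈ s.erase (0, 0),
    weilChar L N a b p.1 p.2 * kroneckerTerm L N w p.1 p.2 with hR
  have hterm : ∀ w : ℂ, ∀ i j : ℤ, w - (i * L.ω₂ + j * L.ω₁) / N ∉ L.lattice →
      AnalyticAt ℂ (fun w ↦ kroneckerTerm L N w i j) w := by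
    intro w i j h
    unfold kroneckerTerm
    exact AnalyticAt.add ((analyticAt_zeta L h).comp_of_eq (by fun_prop) rfl) analyticAt_const
  have hRa : AnalyticAt ℂ R 0 := by
    refine Finset.analyticAt_fun_sum _ fun p hp ↦ analyticAt_const.mul (hterm _ _ _ ?_)
    have h1 : ¬((N : ℤ) ∣ p.1 ∧ (N : ℤ) ∣ p.2) := by
      rintro ⟨h1, h2⟩
      have hp' := Finset.mem_erase.mp hp
      obtain ⟨h3, h4⟩ := Finset.mem_product.mp hp'.2
      apply hp'.1
      exact Prod.ext (Nat.eq_zero_of_dvd_of_lt (by exact_mod_cast h1) (Finset.mem_range.mp h3))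
        (Nat.eq_zero_of_dvd_of_lt (by exact_mod_cast h2) (Finset.mem_range.mp h4))
    have h2 := div_notMem_lattice L hN h1
    intro h3
    apply h2
    have h4 := neg_mem h3
    convert! h4 using 1
    ring
  have hsum : ∀ w, kroneckerSum L N a b w = weierstrassZeta L w + R w := by
    intro w
    rw [kroneckerSum, ← Finset.sum_product', ← Finset.add_sum_erase _ _ h00]
    simp [weilChar, kroneckerTerm, hR, hs]
  have hMN : AnalyticAt ℂ (fun w ↦ M (N * w)) 0 := hM.comp_of_eq (by fun_prop) (by simp)
  have hza := analyticAt_zetaExcept L 0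
  set g : ℂ → ℂ := fun w ↦ M (N * w) - (zetaExcept L 0 w + R w) / N with hg
  have hga : AnalyticAt ℂ g 0 := hMN.sub ((hza.add hRa).div analyticAt_const hN')
  have hge : kroneckerDiff L N a b =ᶠ[𝓝[≠] 0] g := by
    have ht : Tendsto (fun w : ℂ ↦ N * w) (𝓝[≠] 0) (𝓝[≠] 0) := by
      refine tendsto_nhdsWithin_iff.mpr ⟨?_, ?_⟩
      · have : Continuous fun w : ℂ ↦ N * w := by fun_prop
        exact (by simpa using this.tendsto 0 :
          Tendsto (fun w : ℂ ↦ N * w) (𝓝 0) (𝓝 0)).mono_left nhdsWithin_le_nhds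
      · filter_upwards [self_mem_nhdsWithin] with w hw
        simpa [hN] using hw
    filter_upwards [ht.eventually hMe, self_mem_nhdsWithin] with w hw hw0
    have hw0 : w ≠ 0 := hw0
    simp only [kroneckerDiff, ← hvdef, ← hcdef]
    rw [hw, hsum, zeta_eq_except_zero, hg]
    field_simp
    ring
  have hr : ∀ x, RemovableAt (kroneckerDiff L N a b) x := by
    intro x
    by_cases hx : N * x ∈ L.lattice
    · obtain ⟨k, m, hkm⟩ := exists_eq_periods L ⟨_, hx⟩
      have h1 := congrArg (Subtype.val) hkm
      rw [coe_periods] at h1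
      have hxe : x = (k * L.ω₂ + m * L.ω₁) / N := by
        rw [← h1]
        field_simp
      refine ⟨fun z ↦ weilChar L N a b k m * g (z + -x), ?_, ?_⟩
      · exact analyticAt_const.mul (analyticAt_comp_add_const (by simpa using hga))
      · have ht := tendsto_add_const_nhdsNE x (-x)
        rw [add_neg_cancel] at ht
        filter_upwards [ht.eventually hge] with z hz
        rw [← hz, ← kroneckerDiff_shift L hN hab, ← hxe, neg_add_cancel_right]
    · refine .of_analyticAt ?_
      unfold kroneckerDiff
      refine AnalyticAt.sub ((analyticAt_kronecker L hv hx).comp_of_eq (by fun_prop) rfl) ?_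
      unfold kroneckerSum
      refine AnalyticAt.div (Finset.analyticAt_fun_sum _ fun i _ ↦ Finset.analyticAt_fun_sum _ fun j _ ↦
        analyticAt_const.mul (hterm _ _ _ fun h ↦ hx ?_)) analyticAt_const hN'
      have h1 : ((i : ℤ) : ℂ) * L.ω₂ + ((j : ℤ) : ℂ) * L.ω₁ ∈ L.lattice := by
        rw [← coe_periods]
        exact Subtype.prop _
      have h2 := add_mem (L.lattice.smul_mem (N : ℤ) h) h1
      convert! h2 using 1
      simp
      field_simp
      ring
  obtain ⟨C, hC⟩ := elliptic_eventually_const L hr (fun l hl x ↦ .of_forall fun z ↦ by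
    obtain ⟨k, m, hkm⟩ := exists_eq_periods L ⟨_, hl⟩
    have h1 := congrArg (Subtype.val) hkm
    rw [coe_periods] at h1
    have h2 := kroneckerDiff_shift L hN hab z (N * k) (N * m)
    rw [weilChar_eq_one_of_dvd L hN ⟨m * a - k * b, by ring⟩, one_mul] at h2
    rw [← h2, show l = _ from h1]
    congr 2
    push_cast
    field_simp)
  -- Some translation by a point of $\frac1N L$ multiplies the constant by a character value
  -- different from $1$.
  have hC0 : C = 0 := by
    obtain ⟨k, m, hkm⟩ := exists_weilChar_ne_one L hN hab
    have h1 := (tendsto_add_const_nhdsNE 0 ((k * L.ω₂ + m * L.ω₁) / N)).eventually (hC _)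
    obtain ⟨z, hz1, hz2⟩ := (h1.and (hC 0)).exists
    rw [kroneckerDiff_shift L hN hab, hz2] at hz1
    by_contra h
    exact hkm (mul_eq_right₀ h |>.mp hz1)
  have hg0 : g 0 = 0 := by
    refine tendsto_nhds_unique (l := 𝓝[≠] (0 : ℂ))
      (hga.continuousAt.tendsto.mono_left nhdsWithin_le_nhds)
      (Tendsto.congr' (f₁ := fun _ ↦ C) ?_ (by rw [hC0]; exact tendsto_const_nhds))
    filter_upwards [hge, hC 0] with z h1 h2
    rw [← h1, h2]
  have hZ : zetaNorm L (a / N) (b / N) = M 0 := by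
    rw [hM0, zetaNorm, hcdef, hvdef]
    ring
  -- At the origin each term is a normalized zeta value at $-(i,j)/N$; oddness gives the sign, and
  -- the omitted index $(0,0)$ carries the value zero.
  have hR0 : R 0 = -∑ i ∈ Finset.range N, ∑ j ∈ Finset.range N,
      weilChar L N a b i j * zetaNorm L (i / N) (j / N) := by
    rw [← Finset.sum_product', ← Finset.add_sum_erase _ _ h00, hR]
    simp only [Nat.cast_zero, zero_div]
    rw [show zetaNorm L 0 0 = 0 by simp [zetaNorm], mul_zero, zero_add, ← Finset.sum_neg_distrib]
    refine Finset.sum_congr rfl fun p _ ↦ ?_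
    rw [kroneckerTerm, zetaNorm, zero_sub, zeta_neg]
    push_cast
    ring_nf
  have := hg0
  simp only [hg, mul_zero, zetaExcept_zero_zero, zero_add, hR0] at this
  rw [hZ]
  linear_combination this

end Fourier

end TorsionForms

namespace TorsionForms

open Filter Topology

/-! ### The sign in the Legendre relation. -/

section LegendreSign

variable (L : PeriodPair)

theorem sigma_neg (z : ℂ) : sigma L (-z) = -sigma L z := by
  rw [sigma, sigma, sigmaQuot_neg]
  ring

theorem sigma_add_coe {l : L.lattice} (hl : (l : ℂ) / 2 ∉ L.lattice) (z : ℂ) :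
    sigma L (z + l) = -Complex.exp (quasiPeriod L l * (z + l / 2)) * sigma L z := by
  obtain ⟨c, -, h⟩ := exists_sigma_add_coe L l
  have h1 := h (-(l / 2))
  rw [sigma_neg, show -((l : ℂ) / 2) + l = l / 2 by ring] at h1
  have h2 : c * Complex.exp (quasiPeriod L l * -(l / 2)) = -1 := by
    apply mul_right_cancel₀ (sigma_ne_zero L hl)
    linear_combination h1
  have h3 : c = -Complex.exp (quasiPeriod L l * (l / 2)) := by
    rw [mul_neg, Complex.exp_neg] at h2
    have := Complex.exp_ne_zero (quasiPeriod L l * (l / 2))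
    rw [← div_eq_mul_inv, div_eq_iff this] at h2
    linear_combination h2
  rw [h, h3, mul_add, Complex.exp_add]
  ring

/-- The absolute value of the sigma function, multiplied by a Gaussian factor. -/
def sigmaNorm (α : ℂ) (β : ℝ) (z : ℂ) : ℝ :=
  ‖sigma L z * Complex.exp (-(α * z ^ 2 / 2))‖ * Real.exp (-(β * ‖z‖ ^ 2 / 2))

/-- The multiplier of σ has absolute value $|e^{\eta(l)(z+l/2)}|$. The part $\alpha l$ of $\eta(l)$
is compensated by the holomorphic Gaussian and the part $\beta\bar l$ by the real one. -/
theorem sigmaNorm_add_coe {α : ℂ} {β : ℝ} {l : L.lattice} (hl : (l : ℂ) / 2 ∉ L.lattice)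
    (h : quasiPeriod L l = α * l + β * (starRingEnd ℂ) l) (z : ℂ) :
    sigmaNorm L α β (z + l) = sigmaNorm L α β z := by
  simp only [sigmaNorm, norm_mul]
  rw [sigma_add_coe L hl, norm_mul, norm_neg]
  simp only [Complex.norm_exp, ← Complex.normSq_eq_norm_sq]
  have : (quasiPeriod L l * (z + l / 2)).re + (-(α * (z + l) ^ 2 / 2)).re +
      -(β * Complex.normSq (z + l) / 2) = (-(α * z ^ 2 / 2)).re + -(β * Complex.normSq z / 2) := by
    rw [h]
    simp only [Complex.normSq_apply, Complex.add_re, Complex.mul_re, Complex.div_ofNat_re,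
      Complex.add_im, Complex.mul_im, Complex.conj_re, Complex.conj_im, Complex.ofReal_re,
      Complex.ofReal_im, Complex.neg_re, pow_two, Complex.div_ofNat_im]
    ring
  calc _ = ‖sigma L z‖ * (Real.exp (quasiPeriod L l * (z + l / 2)).re *
        Real.exp (-(α * (z + l) ^ 2 / 2)).re * Real.exp (-(β * Complex.normSq (z + l) / 2))) := by ring
    _ = _ := by
      rw [← Real.exp_add, ← Real.exp_add, this, Real.exp_add]
      ring

theorem continuous_sigmaNorm (α : ℂ) (β : ℝ) : Continuous (sigmaNorm L α β) := by
  have := (differentiable_sigma L).continuous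
  unfold sigmaNorm
  fun_prop

/-- A periodic continuous function has a maximum, at $z_0$ say. Recentring the real Gaussian at
$z_0$ changes it by the modulus of a holomorphic factor, so there is an entire $f$ with $|f(z)|$
equal to `sigmaNorm` times $e^{\beta|z-z_0|^2/2}$. For $\beta<0$ it would be smaller on the unit
circle around $z_0$ than at $z_0$, against the maximum principle. -/
theorem nonneg_of_sigmaNorm_periodic {α : ℂ} {β : ℝ}
    (h : ∀ z w, w ∈ L.lattice → sigmaNorm L α β (z + w) = sigmaNorm L α β z) : 0 ≤ β := by
  by_contra! hβ
  obtain ⟨_, ⟨z₀, rfl⟩, hmax⟩ := (IsZLattice.isCompact_range_of_periodic L.lattice _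
    (continuous_sigmaNorm L α β) h).exists_isGreatest (Set.range_nonempty _)
  have hle : ∀ z, sigmaNorm L α β z ≤ sigmaNorm L α β z₀ := fun z ↦ hmax ⟨z, rfl⟩
  have hpos : 0 < sigmaNorm L α β z₀ := by
    refine lt_of_lt_of_le ?_ (hle (L.ω₁ / 2))
    have := sigma_ne_zero L L.ω₁_div_two_notMem_lattice
    exact mul_pos (norm_pos_iff.mpr (mul_ne_zero this (Complex.exp_ne_zero _))) (Real.exp_pos _)
  -- recentre the Gaussian factor at `z₀`
  set f : ℂ → ℂ := fun z ↦ sigma L z * Complex.exp (-(α * z ^ 2 / 2)) *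
    Complex.exp (-(β * (starRingEnd ℂ z₀ * z - ‖z₀‖ ^ 2 / 2))) with hf
  have hfd : Differentiable ℂ f := by
    have := differentiable_sigma L
    fun_prop
  have hfn : ∀ z, ‖f z‖ = sigmaNorm L α β z * Real.exp (β * ‖z - z₀‖ ^ 2 / 2) := by
    intro z
    rw [hf, sigmaNorm, norm_mul _ (Complex.exp (-(β * (starRingEnd ℂ z₀ * z - ‖z₀‖ ^ 2 / 2)))),
      mul_assoc, ← Real.exp_add, Complex.norm_exp]
    congr 2
    simp only [← Complex.normSq_eq_norm_sq, Complex.normSq_apply, Complex.neg_re, Complex.mul_re,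
      Complex.sub_re, Complex.ofReal_re, Complex.ofReal_im, Complex.conj_re, Complex.conj_im,
      Complex.sub_im, ← Complex.ofReal_pow, Complex.div_ofNat_re]
    ring
  have hb := Complex.norm_le_of_forall_mem_frontier_norm_le (f := f) (U := Metric.ball z₀ 1)
    (C := sigmaNorm L α β z₀ * Real.exp (β / 2)) Metric.isBounded_ball hfd.diffContOnCl (by
      intro z hz
      rw [frontier_ball _ one_ne_zero, mem_sphere_iff_norm] at hz
      rw [hfn, hz, one_pow, mul_one]
      gcongr
      exact hle z) (z := z₀) (subset_closure (by simp))
  rw [hfn, sub_self, norm_zero] at hb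
  have h1 : Real.exp (β / 2) < 1 := by
    rw [← Real.exp_zero]
    exact Real.exp_lt_exp.mpr (by linarith)
  norm_num at hb
  nlinarith

/-- The Legendre relation for an oriented pair of periods. -/
theorem legendre_eq (h : 0 < (starRingEnd ℂ L.ω₁ * L.ω₂).im) :
    legendre L = 2 * Real.pi * Complex.I := by
  obtain ⟨d, hd, hD⟩ := legendre_relation L
  set A : ℝ := (starRingEnd ℂ L.ω₁ * L.ω₂).im with hA
  have hA' : starRingEnd ℂ L.ω₁ * L.ω₂ - L.ω₁ * starRingEnd ℂ L.ω₂ = 2 * Complex.I * A := by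
    apply Complex.ext <;> simp [hA]; ring
  -- Writing $\eta_i=\alpha\omega_i+\beta\bar\omega_i$ for both periods makes the Legendre
  -- determinant equal to $2iA\beta$, which forces this value of $\beta$. Its sign is the sign of
  -- $d$.
  set β : ℝ := Real.pi * d / A with hβ
  have hω : L.ω₁ ≠ 0 := by
    intro h0
    simp [hA, h0] at h
  set α : ℂ := (quasiPeriod L (period₁ L) - β * starRingEnd ℂ L.ω₁) / L.ω₁ with hα
  have h1 : quasiPeriod L (period₁ L) = α * L.ω₁ + β * starRingEnd ℂ L.ω₁ := by
    rw [hα]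
    field_simp
    ring
  have hAC : (A : ℂ) ≠ 0 := by exact_mod_cast h.ne'
  have hβA : (β : ℂ) * A = Real.pi * d := by
    rw [hβ]
    push_cast
    field_simp
  have h2 : quasiPeriod L (period₂ L) = α * L.ω₂ + β * starRingEnd ℂ L.ω₂ := by
    rw [legendre] at hD
    apply mul_right_cancel₀ hω
    linear_combination L.ω₂ * h1 + β * hA' - hD + 2 * Complex.I * hβA
  have hper : ∀ z w, w ∈ L.lattice → sigmaNorm L α β (z + w) = sigmaNorm L α β z := by
    intro z w hw
    let G : AddSubgroup ℂ :=
      { carrier := { w | ∀ z, sigmaNorm L α β (z + w) = sigmaNorm L α β z }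
        add_mem' := fun {a b} ha hb z ↦ by rw [← add_assoc, hb, ha]
        zero_mem' := fun z ↦ by rw [add_zero]
        neg_mem' := fun {a} ha z ↦ by rw [← ha, neg_add_cancel_right] }
    have : L.lattice ≤ G.toIntSubmodule := by
      rw [PeriodPair.lattice, Submodule.span_le]
      rintro _ (rfl | rfl)
      · exact sigmaNorm_add_coe L (l := period₁ L) L.ω₁_div_two_notMem_lattice h1
      · exact sigmaNorm_add_coe L (l := period₂ L) L.ω₂_div_two_notMem_lattice h2
    exact this hw z
  have h3 := nonneg_of_sigmaNorm_periodic L hper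
  rcases hd with rfl | rfl
  · simpa using hD
  · exfalso
    have : β < 0 := by
      rw [hβ]
      push_cast
      rw [mul_neg_one, neg_div]
      have := Real.pi_pos
      simp only [Left.neg_neg_iff]
      positivity
    linarith

end LegendreSign

/-! ### Distribution relations for ζ, ℘ and ℘'. -/

section Distribution

variable (L : PeriodPair)

theorem sum_range_neg_of_periodic {M : Type*} [AddCommGroup M] {N : ℕ} {f : ℤ → M}
    (hf : ∀ i, f (i + N) = f i) :
    ∑ i ∈ Finset.range N, f (-i) = ∑ i ∈ Finset.range N, f i := by
  rw [← Finset.sum_range_reflect, ← sum_range_add_of_periodic hf 1]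
  refine Finset.sum_congr rfl fun i hi ↦ ?_
  have : i < N := Finset.mem_range.mp hi
  rw [← hf, Nat.cast_sub (by omega), Nat.cast_sub (by omega)]
  congr 1
  push_cast
  ring

theorem sum_range_range_neg_of_periodic {M : Type*} [AddCommGroup M] {N : ℕ}
    {f : ℤ → ℤ → M} (h1 : ∀ i j, f (i + N) j = f i j) (h2 : ∀ i j, f i (j + N) = f i j) :
    ∑ i ∈ Finset.range N, ∑ j ∈ Finset.range N, f (-i) (-j) =
      ∑ i ∈ Finset.range N, ∑ j ∈ Finset.range N, f i j := by
  rw [← sum_range_neg_of_periodic (f := fun i ↦ ∑ j ∈ Finset.range N, f i j)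
    (fun i ↦ Finset.sum_congr rfl fun j _ ↦ h1 i j)]
  exact Finset.sum_congr rfl fun i _ ↦ sum_range_neg_of_periodic (h2 _)

/-- The defect of the distribution relation of the zeta function. -/
def zetaDistribution (N : ℕ) (w : ℂ) : ℂ :=
  ∑ i ∈ Finset.range N, ∑ j ∈ Finset.range N, kroneckerTerm L N w i j -
    N * weierstrassZeta L (N * w)

theorem zetaDistribution_shift {N : ℕ} (hN : N ≠ 0) (w : ℂ) (k m : ℤ) :
    zetaDistribution L N (w + (k * L.ω₂ + m * L.ω₁) / N) = zetaDistribution L N w := by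
  have hN' : (N : ℂ) ≠ 0 := by exact_mod_cast hN
  rw [zetaDistribution, ← sum_range_range_add_of_periodic (f := fun i j ↦
    kroneckerTerm L N (w + (k * L.ω₂ + m * L.ω₁) / N) i j)
    (fun i j ↦ kroneckerTerm_add_left L hN _ i j) (fun i j ↦ kroneckerTerm_add_right L hN _ i j) k m]
  simp only [kroneckerTerm_shift, Finset.sum_add_distrib, Finset.sum_const, Finset.card_range,
    nsmul_eq_mul]
  rw [show N * (w + (k * L.ω₂ + m * L.ω₁) / N) = N * w + (k * L.ω₂ + m * L.ω₁) by field_simp,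
    zeta_add_periods, zetaDistribution]
  field_simp
  ring

theorem zetaDistribution_neg {N : ℕ} (hN : N ≠ 0) (w : ℂ) :
    zetaDistribution L N (-w) = -zetaDistribution L N w := by
  rw [zetaDistribution, zetaDistribution, ← sum_range_range_neg_of_periodic
    (f := fun i j ↦ kroneckerTerm L N (-w) i j)
    (fun i j ↦ kroneckerTerm_add_left L hN _ i j) (fun i j ↦ kroneckerTerm_add_right L hN _ i j),
    mul_neg, zeta_neg]
  have e : ∀ i j : ℕ, kroneckerTerm L N (-w) (-i) (-j) = -kroneckerTerm L N w i j := by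
    intro i j
    rw [kroneckerTerm, kroneckerTerm, neg_add, ← zeta_neg]
    push_cast
    ring_nf
  simp only [e, Finset.sum_neg_distrib]
  ring

theorem exists_of_mul_mem_lattice {N : ℕ} (hN : N ≠ 0) {x : ℂ} (hx : N * x ∈ L.lattice) :
    ∃ k m : ℤ, x = (k * L.ω₂ + m * L.ω₁) / N := by
  have hN' : (N : ℂ) ≠ 0 := by exact_mod_cast hN
  obtain ⟨k, m, hkm⟩ := exists_eq_periods L ⟨_, hx⟩
  have h1 := congrArg (Subtype.val) hkm
  rw [coe_periods] at h1
  refine ⟨k, m, ?_⟩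
  rw [← h1]
  field_simp

theorem sub_div_notMem_lattice {N : ℕ} (hN : N ≠ 0) {x : ℂ} (hx : N * x ∉ L.lattice) (i j : ℤ) :
    x - (i * L.ω₂ + j * L.ω₁) / N ∉ L.lattice := by
  have hN' : (N : ℂ) ≠ 0 := by exact_mod_cast hN
  intro h
  apply hx
  have h1 : (i : ℂ) * L.ω₂ + (j : ℂ) * L.ω₁ ∈ L.lattice := by
    rw [← coe_periods]
    exact Subtype.prop _
  have h2 := add_mem (L.lattice.smul_mem (N : ℤ) h) h1
  convert! h2 using 1
  simp
  field_simp
  ring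

theorem neg_div_notMem_lattice {N : ℕ} (hN : N ≠ 0) {p : ℕ × ℕ}
    (hp : p ∈ (Finset.range N ×ˢ Finset.range N).erase (0, 0)) :
    0 - ((p.1 : ℤ) * L.ω₂ + (p.2 : ℤ) * L.ω₁) / N ∉ L.lattice := by
  have h1 : ¬((N : ℤ) ∣ p.1 ∧ (N : ℤ) ∣ p.2) := by
    rintro ⟨h1, h2⟩
    have hp' := Finset.mem_erase.mp hp
    obtain ⟨h3, h4⟩ := Finset.mem_product.mp hp'.2
    apply hp'.1
    exact Prod.ext (Nat.eq_zero_of_dvd_of_lt (by exact_mod_cast h1) (Finset.mem_range.mp h3))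
      (Nat.eq_zero_of_dvd_of_lt (by exact_mod_cast h2) (Finset.mem_range.mp h4))
  have h2 := div_notMem_lattice L hN h1
  intro h3
  apply h2
  have h4 := neg_mem h3
  convert! h4 using 1
  ring

theorem analyticAt_kroneckerTerm {N : ℕ} {w : ℂ} {i j : ℤ}
    (h : w - (i * L.ω₂ + j * L.ω₁) / N ∉ L.lattice) :
    AnalyticAt ℂ (fun w ↦ kroneckerTerm L N w i j) w := by
  unfold kroneckerTerm
  exact AnalyticAt.add ((analyticAt_zeta L h).comp_of_eq (by fun_prop) rfl) analyticAt_const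

/-- The defect is periodic under $\frac1N L$ and its pole at the origin cancels, $1/w$ against
$N\cdot 1/(Nw)$. So it is constant off $\frac1N L$, and oddness makes the constant zero. On $\frac1N
L$ a translation reduces to $w=0$, where oddness applies directly. -/
theorem zetaDistribution_eq_zero {N : ℕ} (hN : N ≠ 0) (w : ℂ) : zetaDistribution L N w = 0 := by
  have hN' : (N : ℂ) ≠ 0 := by exact_mod_cast hN
  have h00 : ((0, 0) : ℕ × ℕ) ∈ Finset.range N ×ˢ Finset.range N := by
    simp [Nat.pos_of_ne_zero hN]
  set R : ℂ → ℂ := fun w ↦ ∑ p ∈ (Finset.range N ×ˢ Finset.range N).erase (0, 0),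
    kroneckerTerm L N w p.1 p.2 with hR
  have hRa : AnalyticAt ℂ R 0 := Finset.analyticAt_fun_sum _ fun p hp ↦
    analyticAt_kroneckerTerm L (neg_div_notMem_lattice L hN hp)
  have hz : AnalyticAt ℂ (fun w ↦ zetaExcept L 0 (N * w)) 0 :=
    (analyticAt_zetaExcept L 0).comp_of_eq (by fun_prop) (by simp)
  have hz' := analyticAt_zetaExcept L 0
  set g : ℂ → ℂ := fun w ↦ zetaExcept L 0 w + R w - N * zetaExcept L 0 (N * w) with hg
  have hga : AnalyticAt ℂ g 0 := by fun_prop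
  have hge : zetaDistribution L N =ᶠ[𝓝[≠] 0] g := by
    filter_upwards [self_mem_nhdsWithin] with w hw0
    have hw0 : w ≠ 0 := hw0
    rw [zetaDistribution, ← Finset.sum_product', ← Finset.add_sum_erase _ _ h00]
    simp only [hg, hR]
    rw [zeta_eq_except_zero, kroneckerTerm, Nat.cast_zero, Int.cast_zero, zero_mul, zero_mul,
      zero_mul, zero_mul, add_zero, zero_div, sub_zero, add_zero, zeta_eq_except_zero]
    field_simp
    ring
  have hr : ∀ x, RemovableAt (zetaDistribution L N) x := by
    intro x
    by_cases hx : N * x ∈ L.lattice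
    · obtain ⟨k, m, hkm⟩ := exists_of_mul_mem_lattice L hN hx
      refine RemovableAt.of_periodic (l := (((-k : ℤ) * L.ω₂ + (-m : ℤ) * L.ω₁) / N)) ?_
        (.of_forall fun z ↦ zetaDistribution_shift L hN z _ _)
      rw [hkm]
      refine ⟨g, ?_, ?_⟩ <;>
      · rw [show (k * L.ω₂ + m * L.ω₁) / N + (((-k : ℤ) * L.ω₂ + (-m : ℤ) * L.ω₁) / N) = 0 by
          push_cast; ring]
        assumption
    · refine .of_analyticAt ?_
      unfold zetaDistribution
      refine AnalyticAt.sub (Finset.analyticAt_fun_sum _ fun i _ ↦ Finset.analyticAt_fun_sum _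
        fun j _ ↦ analyticAt_kroneckerTerm L (sub_div_notMem_lattice L hN hx i j)) ?_
      exact analyticAt_const.mul ((analyticAt_zeta L hx).comp_of_eq (by fun_prop) rfl)
  have hp : ∀ l ∈ L.lattice, ∀ z, zetaDistribution L N (z + l) = zetaDistribution L N z := by
    intro l hl z
    obtain ⟨k, m, hkm⟩ := exists_eq_periods L ⟨_, hl⟩
    have h1 := congrArg (Subtype.val) hkm
    rw [coe_periods] at h1
    rw [← zetaDistribution_shift L hN z (N * k) (N * m), show l = _ from h1]
    congr 2
    push_cast
    field_simp
  obtain ⟨C, hC⟩ := elliptic_const L hr (fun l hl x ↦ .of_forall fun z ↦ hp l hl z)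
  have hcont : ∀ x : ℂ, N * x ∉ L.lattice → zetaDistribution L N x = C := by
    intro x hx
    refine hC x (AnalyticAt.continuousAt (𝕜 := ℂ) ?_)
    unfold zetaDistribution
    refine AnalyticAt.sub (Finset.analyticAt_fun_sum _ fun i _ ↦ Finset.analyticAt_fun_sum _
      fun j _ ↦ analyticAt_kroneckerTerm L (sub_div_notMem_lattice L hN hx i j)) ?_
    exact analyticAt_const.mul ((analyticAt_zeta L hx).comp_of_eq (by fun_prop) rfl)
  by_cases hw : N * w ∈ L.lattice
  · obtain ⟨k, m, hkm⟩ := exists_of_mul_mem_lattice L hN hw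
    have h1 := zetaDistribution_shift L hN 0 k m
    rw [zero_add, ← hkm] at h1
    have h2 := zetaDistribution_neg L hN 0
    rw [neg_zero, CharZero.eq_neg_self_iff] at h2
    rw [h1, h2]
  · have h1 := hcont w hw
    have h2 := hcont (-w) (by simpa using hw)
    rw [zetaDistribution_neg L hN, h1, CharZero.neg_eq_self_iff] at h2
    rw [h1, h2]

/-- The distribution relation of the normalized zeta function. -/
theorem sum_zetaNorm {N : ℕ} (hN : N ≠ 0) (r s : ℂ) :
    ∑ i ∈ Finset.range N, ∑ j ∈ Finset.range N, zetaNorm L (r - i / N) (s - j / N) =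
      N * zetaNorm L (N * r) (N * s) := by
  have hN' : (N : ℂ) ≠ 0 := by exact_mod_cast hN
  have h := zetaDistribution_eq_zero L hN (r * L.ω₂ + s * L.ω₁)
  rw [zetaDistribution, sub_eq_zero] at h
  have h1 : ∀ i j : ℕ, zetaNorm L (r - i / N) (s - j / N) =
      kroneckerTerm L N (r * L.ω₂ + s * L.ω₁) i j -
        (r * quasiPeriod L (period₂ L) + s * quasiPeriod L (period₁ L)) := by
    intro i j
    rw [zetaNorm, kroneckerTerm, show (r - i / N) * L.ω₂ + (s - j / N) * L.ω₁ =
      r * L.ω₂ + s * L.ω₁ - ((i : ℤ) * L.ω₂ + (j : ℤ) * L.ω₁) / N by push_cast; ring]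
    push_cast
    ring
  simp only [h1, Finset.sum_sub_distrib, Finset.sum_const, Finset.card_range, nsmul_eq_mul, h]
  rw [zetaNorm]
  ring_nf

theorem sum_P_of_notMem {N : ℕ} (hN : N ≠ 0) {w : ℂ} (hw : N * w ∉ L.lattice) :
    ∑ i ∈ Finset.range N, ∑ j ∈ Finset.range N,
      L.weierstrassP (w - ((i : ℤ) * L.ω₂ + (j : ℤ) * L.ω₁) / N) = N ^ 2 * L.weierstrassP (N * w) := by
  have h1 : HasDerivAt (zetaDistribution L N) (∑ i ∈ Finset.range N, ∑ j ∈ Finset.range N,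
      -L.weierstrassP (w - ((i : ℤ) * L.ω₂ + (j : ℤ) * L.ω₁) / N) -
        N * (-L.weierstrassP (N * w) * N)) w := by
    refine HasDerivAt.sub (HasDerivAt.fun_sum fun i _ ↦ HasDerivAt.fun_sum fun j _ ↦ ?_) ?_
    · exact ((hasDerivAt_zeta L (sub_div_notMem_lattice L hN hw i j)).comp_sub_const w
        (((i : ℤ) * L.ω₂ + (j : ℤ) * L.ω₁) / N)).add_const _
    · have := (hasDerivAt_zeta L hw).comp w ((hasDerivAt_id w).const_mul (N : ℂ))
      rw [mul_one] at this
      exact this.const_mul _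
  have h2 : zetaDistribution L N = fun _ ↦ 0 := funext (zetaDistribution_eq_zero L hN)
  rw [h2] at h1
  have h3 := h1.unique (hasDerivAt_const w 0)
  simp only [Finset.sum_neg_distrib] at h3
  linear_combination -h3

/-- Away from $\frac1N L$ the relation for ℘ is differentiated. On $\frac1N L$ both sides vanish:
the right one by the default value at poles, the left one because ℘' is odd. -/
theorem sum_P' {N : ℕ} (hN : N ≠ 0) (w : ℂ) : ∑ i ∈ Finset.range N, ∑ j ∈ Finset.range N,
      L.derivWeierstrassP (w - ((i : ℤ) * L.ω₂ + (j : ℤ) * L.ω₁) / N) =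
        N ^ 3 * L.derivWeierstrassP (N * w) := by
  have hN' : (N : ℂ) ≠ 0 := by exact_mod_cast hN
  have hdP : ∀ z ∉ L.lattice, HasDerivAt L.weierstrassP (L.derivWeierstrassP z) z := fun z hz ↦ by
    have := (analyticAt_P L hz).differentiableAt.hasDerivAt
    rwa [L.deriv_weierstrassP] at this
  have hper : ∀ w : ℂ, ∀ i j : ℤ, L.derivWeierstrassP (w + (i * L.ω₂ + j * L.ω₁)) =
      L.derivWeierstrassP w := by
    intro w i j
    rw [← coe_periods, L.derivWeierstrassP_add_coe]
  have p1 : ∀ (w : ℂ) (i j : ℤ), L.derivWeierstrassP (w - (((i + N : ℤ) : ℂ) * L.ω₂ + j * L.ω₁) / N) =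
      L.derivWeierstrassP (w - (i * L.ω₂ + j * L.ω₁) / N) := by
    intro w i j
    rw [← hper _ 1 0]
    congr 1
    push_cast
    field_simp
    ring
  have p2 : ∀ (w : ℂ) (i j : ℤ), L.derivWeierstrassP (w - (i * L.ω₂ + ((j + N : ℤ) : ℂ) * L.ω₁) / N) =
      L.derivWeierstrassP (w - (i * L.ω₂ + j * L.ω₁) / N) := by
    intro w i j
    rw [← hper _ 0 1]
    congr 1
    push_cast
    field_simp
    ring
  by_cases hw : N * w ∈ L.lattice
  · have h0 := L.derivWeierstrassP_coe ⟨_, hw⟩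
    simp only at h0
    rw [h0, mul_zero]
    obtain ⟨k, m, rfl⟩ := exists_of_mul_mem_lattice L hN hw
    refine (sum_range_range_add_of_periodic (f := fun i j ↦ L.derivWeierstrassP
      ((k * L.ω₂ + m * L.ω₁) / N - (i * L.ω₂ + j * L.ω₁) / N)) (p1 _) (p2 _) k m).symm.trans ?_
    have h1 := sum_range_range_neg_of_periodic (f := fun i j ↦ L.derivWeierstrassP
      (0 - (i * L.ω₂ + j * L.ω₁) / N)) (p1 0) (p2 0)
    have e1 : ∀ i j : ℕ, L.derivWeierstrassP ((k * L.ω₂ + m * L.ω₁) / N -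
        (((i + k : ℤ) : ℂ) * L.ω₂ + ((j + m : ℤ) : ℂ) * L.ω₁) / N) =
        L.derivWeierstrassP (0 - ((i : ℤ) * L.ω₂ + (j : ℤ) * L.ω₁) / N) := by
      intro i j
      push_cast
      ring_nf
    have e2 : ∀ i j : ℕ, L.derivWeierstrassP (0 - (((-i : ℤ) : ℂ) * L.ω₂ + ((-j : ℤ) : ℂ) * L.ω₁) / N) =
        -L.derivWeierstrassP (0 - ((i : ℤ) * L.ω₂ + (j : ℤ) * L.ω₁) / N) := by
      intro i j
      rw [← L.derivWeierstrassP_neg]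
      push_cast
      ring_nf
    simp only [e1]
    simp only [e2, Finset.sum_neg_distrib] at h1
    rwa [CharZero.neg_eq_self_iff] at h1
  · have h1 : HasDerivAt (fun w ↦ ∑ i ∈ Finset.range N, ∑ j ∈ Finset.range N,
        L.weierstrassP (w - ((i : ℤ) * L.ω₂ + (j : ℤ) * L.ω₁) / N) - N ^ 2 * L.weierstrassP (N * w))
        (∑ i ∈ Finset.range N, ∑ j ∈ Finset.range N,
        L.derivWeierstrassP (w - ((i : ℤ) * L.ω₂ + (j : ℤ) * L.ω₁) / N) -
          N ^ 2 * (L.derivWeierstrassP (N * w) * N)) w := by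
      refine HasDerivAt.sub (HasDerivAt.fun_sum fun i _ ↦ HasDerivAt.fun_sum fun j _ ↦ ?_) ?_
      · exact (hdP _ (sub_div_notMem_lattice L hN hw i j)).comp_sub_const w
          (((i : ℤ) * L.ω₂ + (j : ℤ) * L.ω₁) / N)
      · have := (hdP _ hw).comp w ((hasDerivAt_id w).const_mul (N : ℂ))
        rw [mul_one] at this
        exact this.const_mul _
    have h2 : (fun w ↦ ∑ i ∈ Finset.range N, ∑ j ∈ Finset.range N,
        L.weierstrassP (w - ((i : ℤ) * L.ω₂ + (j : ℤ) * L.ω₁) / N) - N ^ 2 * L.weierstrassP (N * w))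
        =ᶠ[𝓝 w] fun _ ↦ 0 := by
      have : ∀ᶠ z : ℂ in 𝓝 w, N * z ∉ L.lattice :=
        (by fun_prop : Continuous fun z : ℂ ↦ N * z).continuousAt.eventually
          (L.isClosed_lattice.isOpen_compl.mem_nhds hw)
      filter_upwards [this] with z hz
      rw [sum_P_of_notMem L hN hz, sub_self]
    have h3 := h1.unique ((hasDerivAt_const w 0).congr_of_eventuallyEq h2)
    linear_combination h3

/-- The poles need care, since the sums over $E[n]$ may contain $x_O=0$. The polar parts $1/w^2$ and
$N^2/(Nw)^2$ agree, so they can be removed before letting $w\to0$; the default value $0$ at the pole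
is the constant term of ℘. -/
theorem sum_P {N : ℕ} (hN : N ≠ 0) (w : ℂ) : ∑ i ∈ Finset.range N, ∑ j ∈ Finset.range N,
      L.weierstrassP (w - ((i : ℤ) * L.ω₂ + (j : ℤ) * L.ω₁) / N) = N ^ 2 * L.weierstrassP (N * w) := by
  by_cases hw : N * w ∈ L.lattice
  swap
  · exact sum_P_of_notMem L hN hw
  have hN' : (N : ℂ) ≠ 0 := by exact_mod_cast hN
  have hper : ∀ w : ℂ, ∀ i j : ℤ, L.weierstrassP (w + (i * L.ω₂ + j * L.ω₁)) =
      L.weierstrassP w := by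
    intro w i j
    rw [← coe_periods, L.weierstrassP_add_coe]
  have p1 : ∀ (w : ℂ) (i j : ℤ), L.weierstrassP (w - (((i + N : ℤ) : ℂ) * L.ω₂ + j * L.ω₁) / N) =
      L.weierstrassP (w - (i * L.ω₂ + j * L.ω₁) / N) := by
    intro w i j
    rw [← hper _ 1 0]
    congr 1
    push_cast
    field_simp
    ring
  have p2 : ∀ (w : ℂ) (i j : ℤ), L.weierstrassP (w - (i * L.ω₂ + ((j + N : ℤ) : ℂ) * L.ω₁) / N) =
      L.weierstrassP (w - (i * L.ω₂ + j * L.ω₁) / N) := by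
    intro w i j
    rw [← hper _ 0 1]
    congr 1
    push_cast
    field_simp
    ring
  have h0 := L.weierstrassP_coe ⟨_, hw⟩
  simp only at h0
  rw [h0, mul_zero]
  obtain ⟨k, m, rfl⟩ := exists_of_mul_mem_lattice L hN hw
  refine (sum_range_range_add_of_periodic (f := fun i j ↦ L.weierstrassP
    ((k * L.ω₂ + m * L.ω₁) / N - (i * L.ω₂ + j * L.ω₁) / N)) (p1 _) (p2 _) k m).symm.trans ?_
  have e1 : ∀ i j : ℕ, L.weierstrassP ((k * L.ω₂ + m * L.ω₁) / N -
      (((i + k : ℤ) : ℂ) * L.ω₂ + ((j + m : ℤ) : ℂ) * L.ω₁) / N) =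
      L.weierstrassP (0 - ((i : ℤ) * L.ω₂ + (j : ℤ) * L.ω₁) / N) := by
    intro i j
    push_cast
    ring_nf
  simp only [e1]
  have h00 : ((0, 0) : ℕ × ℕ) ∈ Finset.range N ×ˢ Finset.range N := by
    simp [Nat.pos_of_ne_zero hN]
  set R : ℂ → ℂ := fun w ↦ ∑ p ∈ (Finset.range N ×ˢ Finset.range N).erase (0, 0),
    L.weierstrassP (w - ((p.1 : ℤ) * L.ω₂ + (p.2 : ℤ) * L.ω₁) / N) with hR
  have hRa : ContinuousAt R 0 := (Finset.analyticAt_fun_sum _ fun p hp ↦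
    (analyticAt_P L (neg_div_notMem_lattice L hN hp)).comp_of_eq (by fun_prop) rfl :
      AnalyticAt ℂ R 0).continuousAt
  have hz' := (L.analyticAt_weierstrassPExcept 0).continuousAt
  have hz : ContinuousAt (fun w ↦ L.weierstrassPExcept 0 (N * w)) 0 :=
    ContinuousAt.comp_of_eq hz' (by fun_prop) (by simp)
  have hg : ContinuousAt (fun w ↦ L.weierstrassPExcept 0 w + R w -
      N ^ 2 * L.weierstrassPExcept 0 (N * w)) 0 := by fun_prop
  have hlim := tendsto_nhds_unique (l := 𝓝[≠] (0 : ℂ))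
    (hg.tendsto.mono_left nhdsWithin_le_nhds) (Tendsto.congr' (f₁ := fun _ ↦ 0) (by
      have ht : Tendsto (fun w : ℂ ↦ N * w) (𝓝[≠] 0) (𝓝[≠] 0) := by
        refine tendsto_nhdsWithin_iff.mpr ⟨?_, ?_⟩
        · have : Continuous fun w : ℂ ↦ N * w := by fun_prop
          exact (by simpa using this.tendsto 0 :
            Tendsto (fun w : ℂ ↦ N * w) (𝓝 0) (𝓝 0)).mono_left nhdsWithin_le_nhds
        · filter_upwards [self_mem_nhdsWithin] with w hw
          simpa [hN] using hw
      filter_upwards [ht.eventually (eventually_notMem_lattice L 0), self_mem_nhdsWithin]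
        with z hz hz0
      have hz0 : z ≠ 0 := hz0
      have h1 := sum_P_of_notMem L hN hz
      rw [← Finset.sum_product', ← Finset.add_sum_erase _ _ h00] at h1
      simp only [Nat.cast_zero, Int.cast_zero, zero_mul, add_zero, zero_div, sub_zero] at h1
      rw [P_eq_except_zero, P_eq_except_zero] at h1
      simp only [hR]
      have e : (N : ℂ) ^ 2 * (1 / (N * z) ^ 2) = 1 / z ^ 2 := by field_simp
      linear_combination -h1 - e) tendsto_const_nhds)
  rw [← Finset.sum_product', ← Finset.add_sum_erase _ _ h00]
  simp only [Nat.cast_zero, Int.cast_zero, zero_mul, add_zero, zero_div, sub_zero,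
    L.weierstrassP_zero, zero_add]
  simpa [hR] using hlim

end Distribution

end TorsionForms

namespace TorsionForms

/-! ### The forms attached to torsion points and their relations. -/

section Forms

/-- The torsion point `r τ + s`. -/
def pt (r s : ℚ) : TorsionPoint := ![(r : AddCircle (1 : ℚ)), (s : AddCircle (1 : ℚ))]

theorem pt_coord (P : TorsionPoint) : pt (coord (P 0)) (coord (P 1)) = P := by
  ext i
  fin_cases i
  · exact coe_coord _
  · exact coe_coord _

theorem exists_pt (P : TorsionPoint) : ∃ r s, P = pt r s := ⟨_, _, (pt_coord P).symm⟩

theorem pt_add (r s r' s' : ℚ) : pt r s + pt r' s' = pt (r + r') (s + s') := by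
  ext i
  fin_cases i <;> rfl

theorem pt_neg (r s : ℚ) : -pt r s = pt (-r) (-s) := by
  ext i
  fin_cases i <;> rfl

theorem pt_sub (r s r' s' : ℚ) : pt r s - pt r' s' = pt (r - r') (s - s') := by
  rw [sub_eq_add_neg, pt_neg, pt_add, ← sub_eq_add_neg, ← sub_eq_add_neg]

theorem pt_zsmul (n : ℤ) (r s : ℚ) : n • pt r s = pt (n * r) (n * s) := by
  ext i
  fin_cases i
  · change n • (r : AddCircle (1 : ℚ)) = ((n * r : ℚ) : AddCircle (1 : ℚ))
    rw [← zsmul_eq_mul, AddCircle.coe_zsmul]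
  · change n • (s : AddCircle (1 : ℚ)) = ((n * s : ℚ) : AddCircle (1 : ℚ))
    rw [← zsmul_eq_mul, AddCircle.coe_zsmul]

theorem coe_rat_eq_zero_iff {r : ℚ} : (r : AddCircle (1 : ℚ)) = 0 ↔ ∃ n : ℤ, r = n := by
  rw [AddCircle.coe_eq_zero_iff]
  simp [eq_comm]

theorem pt_eq_zero_iff {r s : ℚ} : pt r s = 0 ↔ ∃ m n : ℤ, r = m ∧ s = n := by
  rw [show pt r s = 0 ↔ (r : AddCircle (1 : ℚ)) = 0 ∧ (s : AddCircle (1 : ℚ)) = 0 by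
    rw [funext_iff, Fin.forall_fin_two]; rfl, coe_rat_eq_zero_iff, coe_rat_eq_zero_iff]
  simp

theorem pt_eq_pt_iff {r s r' s' : ℚ} :
    pt r s = pt r' s' ↔ ∃ m n : ℤ, r = r' + m ∧ s = s' + n := by
  rw [← sub_eq_zero, pt_sub, pt_eq_zero_iff]
  simp only [sub_eq_iff_eq_add']

variable (τ : UpperHalfPlane)

theorem latticeOf_ω₁ : (latticeOf τ).ω₁ = 1 := rfl
theorem latticeOf_ω₂ : (latticeOf τ).ω₂ = τ := rfl

theorem int_mul_add_mem (m n : ℤ) : (m : ℂ) * τ + n ∈ (latticeOf τ).lattice :=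
  PeriodPair.mem_lattice.mpr ⟨n, m, by rw [latticeOf_ω₁, latticeOf_ω₂]; ring⟩

theorem mem_lattice_iff {r s : ℚ} : (r : ℂ) * τ + s ∈ (latticeOf τ).lattice ↔ pt r s = 0 := by
  rw [pt_eq_zero_iff]
  constructor
  · intro h
    have := ((latticeOf τ).mul_ω₁_add_mul_ω₂_mem_lattice (α := s) (β := r)).mp (by
      rw [latticeOf_ω₁, latticeOf_ω₂, mul_one, add_comm]
      exact h)
    exact ⟨r.num, s.num, (Rat.coe_int_num_of_den_eq_one this.2).symm,
      (Rat.coe_int_num_of_den_eq_one this.1).symm⟩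
  · rintro ⟨m, n, rfl, rfl⟩
    simpa using int_mul_add_mem τ m n

theorem exists_lift (r s : ℚ) : ∃ m n : ℤ, coord (pt r s 0) = r + m ∧ coord (pt r s 1) = s + n :=
  pt_eq_pt_iff.mp (pt_coord (pt r s))

/-- The default value $0$ of ℘ at lattice points matches the convention $x_O=0$, so this holds for
every representative $(r,s)$ and no case distinction is left. The same happens for $y$ and
$\lambda$. -/
theorem xForm_pt (r s : ℚ) : xForm (pt r s) τ = (latticeOf τ).weierstrassP (r * τ + s) := by
  unfold xForm
  split_ifs with h
  · exact ((latticeOf τ).weierstrassP_coe ⟨_, (mem_lattice_iff τ).mpr h⟩).symm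
  · obtain ⟨m, n, h1, h2⟩ := exists_lift r s
    rw [lift, h1, h2]
    have := (latticeOf τ).weierstrassP_add_coe (r * τ + s) ⟨_, int_mul_add_mem τ m n⟩
    rw [← this]
    push_cast
    ring_nf

theorem yForm_pt (r s : ℚ) :
    yForm (pt r s) τ = (latticeOf τ).derivWeierstrassP (r * τ + s) / 2 := by
  unfold yForm
  split_ifs with h
  · have := (latticeOf τ).derivWeierstrassP_coe ⟨_, (mem_lattice_iff τ).mpr h⟩
    simp only at this
    rw [this, zero_div]
  · obtain ⟨m, n, h1, h2⟩ := exists_lift r s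
    rw [lift, h1, h2]
    have := (latticeOf τ).derivWeierstrassP_add_coe (r * τ + s) ⟨_, int_mul_add_mem τ m n⟩
    rw [← this]
    push_cast
    ring_nf

theorem zetaNorm_latticeOf (r s : ℂ) : zetaNorm (latticeOf τ) r s =
    weierstrassZeta (latticeOf τ) (r * τ + s)
      - r * (2 * weierstrassZeta (latticeOf τ) (τ / 2))
      - s * (2 * weierstrassZeta (latticeOf τ) (1 / 2)) := by
  rw [zetaNorm, ← two_mul_zeta_half, ← two_mul_zeta_half]
  simp [period₁, period₂, latticeOf_ω₁, latticeOf_ω₂]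

theorem lambdaForm_pt (r s : ℚ) : lambdaForm (pt r s) τ = -zetaNorm (latticeOf τ) r s := by
  rw [lambdaForm, neg_inj]
  unfold eisensteinOne
  split_ifs with h
  · obtain ⟨m, n, rfl, rfl⟩ := pt_eq_zero_iff.mp h
    have := zetaNorm_add_int (latticeOf τ) 0 0 m n
    rw [zero_add, zero_add] at this
    push_cast
    rw [this]
    simp [zetaNorm]
  · obtain ⟨m, n, h1, h2⟩ := exists_lift r s
    rw [lift, h1, h2, ← zetaNorm_add_int (latticeOf τ) r s m n, zetaNorm_latticeOf]
    push_cast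
    rfl

theorem yForm_zero : yForm 0 = 0 := by
  ext τ; simp [yForm]

theorem lambdaForm_zero : lambdaForm 0 = 0 := by
  ext τ; simp [lambdaForm, eisensteinOne]

theorem xForm_neg (P : TorsionPoint) : xForm (-P) = xForm P := by
  ext τ
  obtain ⟨r, s, rfl⟩ := exists_pt P
  rw [pt_neg, xForm_pt, xForm_pt, ← (latticeOf τ).weierstrassP_neg]
  push_cast
  ring_nf

theorem yForm_neg (P : TorsionPoint) : yForm (-P) = -yForm P := by
  ext τ
  obtain ⟨r, s, rfl⟩ := exists_pt P
  rw [Pi.neg_apply, pt_neg, yForm_pt, yForm_pt, ← neg_div, ← (latticeOf τ).derivWeierstrassP_neg]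
  push_cast
  ring_nf

theorem lambdaForm_neg (P : TorsionPoint) : lambdaForm (-P) = -lambdaForm P := by
  ext τ
  obtain ⟨r, s, rfl⟩ := exists_pt P
  rw [Pi.neg_apply, pt_neg, lambdaForm_pt, lambdaForm_pt]
  push_cast
  rw [zetaNorm_neg]

/-- The addition formula for the forms attached to torsion points. -/
theorem form_relation {P Q : TorsionPoint} (hP : P ≠ 0) (hQ : Q ≠ 0) (hPQ : P + Q ≠ 0) :
    (xForm P - xForm Q) * (lambdaForm P + lambdaForm Q - lambdaForm (P + Q)) =
      yForm P - yForm Q := by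
  ext τ
  obtain ⟨r, s, rfl⟩ := exists_pt P
  obtain ⟨r', s', rfl⟩ := exists_pt Q
  rw [pt_add] at hPQ ⊢
  have h := addition_formula (latticeOf τ) (u := r * τ + s) (v := r' * τ + s')
    (fun h ↦ hP ((mem_lattice_iff τ).mp h)) (fun h ↦ hQ ((mem_lattice_iff τ).mp h))
    (fun h ↦ hPQ ((mem_lattice_iff τ).mp (by push_cast; convert! h using 1; ring)))
  simp only [Pi.mul_apply, Pi.sub_apply, Pi.add_apply, xForm_pt, yForm_pt, lambdaForm_pt,
    zetaNorm]
  rw [latticeOf_ω₁, latticeOf_ω₂]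
  push_cast
  rw [show ((r : ℂ) + r') * τ + (s + s') * 1 = r * τ + s + (r' * τ + s') by ring, mul_one, mul_one]
  linear_combination -h

/-- One of the factors vanishes: the second because $\lambda_O=0$, or the first because $x$ is even.
-/
theorem form_relation_degenerate {P Q : TorsionPoint} (h : P = 0 ∨ Q = 0 ∨ P + Q = 0) :
    (xForm P - xForm Q) * (lambdaForm P + lambdaForm Q - lambdaForm (P + Q)) = 0 := by
  rcases h with rfl | rfl | h
  · simp [lambdaForm_zero]
  · simp [lambdaForm_zero]
  · rw [eq_neg_of_add_eq_zero_right h, xForm_neg, sub_self, zero_mul]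

open scoped Classical in
theorem form_relation' (P Q : TorsionPoint) :
    (xForm P - xForm Q) * (lambdaForm P + lambdaForm Q - lambdaForm (P + Q)) =
      if P ≠ 0 ∧ Q ≠ 0 ∧ P + Q ≠ 0 then yForm P - yForm Q else 0 := by
  split_ifs with h
  · exact form_relation h.1 h.2.1 h.2.2
  · exact form_relation_degenerate (by tauto)

theorem mem_torsion_iff {n : ℕ} {P : TorsionPoint} : P ∈ torsion n ↔ (n : ℤ) • P = 0 := Iff.rfl

theorem pt_div_mem_torsion {n : ℕ} (hn : n ≠ 0) (i j : ℤ) : pt (i / n) (j / n) ∈ torsion n := by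
  have hn' : (n : ℚ) ≠ 0 := by exact_mod_cast hn
  rw [mem_torsion_iff, pt_zsmul, pt_eq_zero_iff]
  refine ⟨i, j, ?_, ?_⟩ <;> push_cast <;> field_simp

theorem exists_pt_div {n : ℕ} (hn : n ≠ 0) {P : TorsionPoint} (hP : P ∈ torsion n) :
    ∃ i j : ℤ, P = pt (i / n) (j / n) := by
  have hn' : (n : ℚ) ≠ 0 := by exact_mod_cast hn
  obtain ⟨r, s, rfl⟩ := exists_pt P
  rw [mem_torsion_iff, pt_zsmul, pt_eq_zero_iff] at hP
  obtain ⟨i, j, hi, hj⟩ := hP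
  push_cast at hi hj
  refine ⟨i, j, ?_⟩
  rw [← hi, ← hj]
  field_simp

theorem pt_div_eq_zero_iff {n : ℕ} (hn : n ≠ 0) {i j : ℤ} :
    pt (i / n) (j / n) = 0 ↔ (n : ℤ) ∣ i ∧ (n : ℤ) ∣ j := by
  have hn' : (n : ℚ) ≠ 0 := by exact_mod_cast hn
  rw [pt_eq_zero_iff]
  constructor
  · rintro ⟨a, b, h1, h2⟩
    field_simp at h1 h2
    exact ⟨⟨a, by exact_mod_cast h1⟩, ⟨b, by exact_mod_cast h2⟩⟩
  · rintro ⟨⟨a, rfl⟩, ⟨b, rfl⟩⟩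
    refine ⟨a, b, ?_, ?_⟩ <;> push_cast <;> field_simp

theorem pt_div_emod {n : ℕ} (hn : n ≠ 0) (i j : ℤ) :
    pt (i / n) (j / n) = pt ((i % n : ℤ) / n) ((j % n : ℤ) / n) := by
  have hn' : (n : ℚ) ≠ 0 := by exact_mod_cast hn
  rw [pt_eq_pt_iff]
  refine ⟨i / (n : ℤ), j / (n : ℤ), ?_, ?_⟩
  · have := Int.emod_add_mul_ediv i n
    field_simp
    exact_mod_cast this.symm
  · have := Int.emod_add_mul_ediv j n
    field_simp
    exact_mod_cast this.symm

theorem sum_torsion {M : Type*} [AddCommMonoid M] (n : ℕ) [NeZero n] (f : TorsionPoint → M) :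
    ∑ T : torsion n, f T =
      ∑ i ∈ Finset.range n, ∑ j ∈ Finset.range n, f (pt (i / n) (j / n)) := by
  have hn := NeZero.ne n
  rw [← Finset.sum_product']
  symm
  refine Finset.sum_bij (fun p _ ↦ ⟨pt (p.1 / n) (p.2 / n), by
    simpa using pt_div_mem_torsion hn p.1 p.2⟩) (fun _ _ ↦ Finset.mem_univ _) ?_ ?_ ?_
  · rintro ⟨i, j⟩ h1 ⟨i', j'⟩ h2 h
    simp only [Finset.mem_product, Finset.mem_range] at h1 h2
    have h3 := congrArg Subtype.val h
    simp only at h3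
    rw [← sub_eq_zero, pt_sub, ← sub_div, ← sub_div] at h3
    have h4 := (pt_div_eq_zero_iff hn (i := (i : ℤ) - i') (j := (j : ℤ) - j')).mp
      (by push_cast; exact h3)
    have e1 := Int.eq_zero_of_abs_lt_dvd h4.1 (by rw [abs_lt]; omega)
    have e2 := Int.eq_zero_of_abs_lt_dvd h4.2 (by rw [abs_lt]; omega)
    ext <;> simp <;> omega
  · rintro ⟨T, hT⟩ -
    obtain ⟨i, j, rfl⟩ := exists_pt_div hn hT
    have hn' : (n : ℤ) ≠ 0 := by exact_mod_cast hn
    have hn'' : (0 : ℤ) < n := by positivity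
    refine ⟨((i % n).toNat, (j % n).toNat), ?_, ?_⟩
    · simp only [Finset.mem_product, Finset.mem_range]
      have h1 := Int.emod_nonneg i hn'
      have h2 := Int.emod_nonneg j hn'
      have h3 := Int.emod_lt_of_pos i hn''
      have h4 := Int.emod_lt_of_pos j hn''
      omega
    · apply Subtype.ext
      simp only
      have h1 : (((i % n).toNat : ℤ) : ℚ) = ((i % n : ℤ) : ℚ) := by
        rw [Int.toNat_of_nonneg (Int.emod_nonneg i hn')]
      have h2 : (((j % n).toNat : ℤ) : ℚ) = ((j % n : ℤ) : ℚ) := by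
        rw [Int.toNat_of_nonneg (Int.emod_nonneg j hn')]
      rw [Int.cast_natCast] at h1 h2
      rw [pt_div_emod hn i j, h1, h2]
  · intro p _
    rfl

theorem sum_torsion_sub {M : Type*} [AddCommMonoid M] (n : ℕ) [NeZero n] (f : TorsionPoint → M)
    (X : TorsionPoint) : ∑ T : torsion n, f (X + T) =
      ∑ i ∈ Finset.range n, ∑ j ∈ Finset.range n, f (X - pt (i / n) (j / n)) := by
  rw [← sum_torsion n fun T ↦ f (X - T)]
  refine Fintype.sum_equiv (Equiv.neg _) _ _ fun T ↦ ?_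
  simp

theorem sum_xForm_add_torsion (n : ℕ) [NeZero n] (X : TorsionPoint) :
    ∑ T : torsion n, xForm (X + T) = (n : ℂ) ^ 2 • xForm ((n : ℤ) • X) := by
  rw [sum_torsion_sub]
  obtain ⟨r, s, rfl⟩ := exists_pt X
  ext τ
  simp only [Finset.sum_apply, pt_sub, xForm_pt, Pi.smul_apply, pt_zsmul, smul_eq_mul]
  have h := sum_P (latticeOf τ) (NeZero.ne n) (r * τ + s)
  rw [latticeOf_ω₁, latticeOf_ω₂] at h
  have e : ∀ i j : ℕ, (((r - i / n : ℚ) : ℂ) * τ + ((s - j / n : ℚ) : ℂ)) =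
      r * τ + s - (((i : ℤ) : ℂ) * τ + ((j : ℤ) : ℂ) * 1) / n := by
    intro i j
    push_cast
    ring
  have e' : (((n : ℤ) * r : ℚ) : ℂ) * τ + (((n : ℤ) * s : ℚ) : ℂ) = n * (r * τ + s) := by
    push_cast
    ring
  simp only [e]
  rw [h, e']

theorem sum_yForm_add_torsion (n : ℕ) [NeZero n] (X : TorsionPoint) :
    ∑ T : torsion n, yForm (X + T) = (n : ℂ) ^ 3 • yForm ((n : ℤ) • X) := by
  rw [sum_torsion_sub]
  obtain ⟨r, s, rfl⟩ := exists_pt X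
  ext τ
  simp only [Finset.sum_apply, pt_sub, yForm_pt, Pi.smul_apply, pt_zsmul, smul_eq_mul]
  have h := sum_P' (latticeOf τ) (NeZero.ne n) (r * τ + s)
  rw [latticeOf_ω₁, latticeOf_ω₂] at h
  have e : ∀ i j : ℕ, (((r - i / n : ℚ) : ℂ) * τ + ((s - j / n : ℚ) : ℂ)) =
      r * τ + s - (((i : ℤ) : ℂ) * τ + ((j : ℤ) : ℂ) * 1) / n := by
    intro i j
    push_cast
    ring
  have e' : (((n : ℤ) * r : ℚ) : ℂ) * τ + (((n : ℤ) * s : ℚ) : ℂ) = n * (r * τ + s) := by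
    push_cast
    ring
  simp only [← Finset.sum_div, e]
  rw [h, e', mul_div_assoc]

theorem sum_lambdaForm_add_torsion (n : ℕ) [NeZero n] (X : TorsionPoint) :
    ∑ T : torsion n, lambdaForm (X + T) = (n : ℂ) • lambdaForm ((n : ℤ) • X) := by
  rw [sum_torsion_sub]
  obtain ⟨r, s, rfl⟩ := exists_pt X
  ext τ
  simp only [Finset.sum_apply, pt_sub, lambdaForm_pt, Pi.smul_apply, pt_zsmul, smul_eq_mul,
    Finset.sum_neg_distrib, mul_neg]
  have h := sum_zetaNorm (latticeOf τ) (NeZero.ne n) r s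
  push_cast
  rw [h]

/-- The additive character of `E[n]` attached to a torsion point by the Weil pairing. -/
def weilPairing (n : ℕ) (a b i j : ℤ) : ℂ :=
  Complex.exp ((j * a - i * b : ℤ) / n * (2 * Real.pi * Complex.I))

/-- The exact value $2\pi i$ of the Legendre determinant makes the character independent of $\tau$,
so that the self-duality becomes a linear relation with constant coefficients between functions on
the upper half plane. -/
theorem weilChar_latticeOf {n : ℕ} (a b i j : ℤ) :
    weilChar (latticeOf τ) n a b i j = weilPairing n a b i j := by
  have h : legendre (latticeOf τ) = 2 * Real.pi * Complex.I := by
    apply legendre_eq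
    rw [latticeOf_ω₁, latticeOf_ω₂, map_one, one_mul]
    exact τ.im_pos
  rw [weilChar, weilPairing, h]
  push_cast
  ring_nf

/-- The weight one forms are their own Fourier transform. -/
theorem lambdaForm_eq_sum (n : ℕ) [NeZero n] (a b : ℤ)
    (h : pt (a / n) (b / n) ≠ 0) : lambdaForm (pt (a / n) (b / n)) =
      (-(1 / n) : ℂ) • ∑ i ∈ Finset.range n, ∑ j ∈ Finset.range n,
        weilPairing n a b i j • lambdaForm (pt (i / n) (j / n)) := by
  ext τ
  have h1 := zetaNorm_eq_sum (latticeOf τ) (NeZero.ne n)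
    (fun h' ↦ h ((pt_div_eq_zero_iff (NeZero.ne n)).mpr h'))
  simp only [Pi.smul_apply, Finset.sum_apply, lambdaForm_pt, smul_eq_mul, ← weilChar_latticeOf τ,
    mul_neg, Finset.sum_neg_distrib]
  push_cast
  rw [h1]

end Forms

end TorsionForms

namespace TorsionForms

/-! ### Division points, the product space and diagonal sums. -/

section Algebra

open scoped Classical in
/-- A finite set as a `Finset`; the empty one if the set is infinite. -/
def finsetOf {α : Type*} (s : Set α) : Finset α := if h : s.Finite then h.toFinset else ∅

theorem mem_finsetOf {α : Type*} {s : Set α} (h : s.Finite) {a : α} : a ∈ finsetOf s ↔ a ∈ s := by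
  simp [finsetOf, h]

/-- The points `X` with `k X = C`. -/
def roots (k : ℤ) (C : TorsionPoint) : Finset TorsionPoint := finsetOf {X | k • X = C}

theorem finite_roots {k : ℤ} (hk : k ≠ 0) (C : TorsionPoint) :
    {X : TorsionPoint | k • X = C}.Finite := by
  rcases Set.eq_empty_or_nonempty {X : TorsionPoint | k • X = C} with h | ⟨X₀, h₀⟩
  · rw [h]; exact Set.finite_empty
  · have : NeZero k.natAbs := ⟨by simpa using hk⟩
    have hf : (torsion k.natAbs : Set TorsionPoint).Finite := finite_torsion _
    refine (hf.image (X₀ + ·)).subset fun X hX ↦ ⟨X - X₀, ?_, by simp⟩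
    have h0 : k • (X - X₀) = 0 := by rw [smul_sub, hX, h₀, sub_self]
    rw [SetLike.mem_coe, mem_torsion_iff]
    rcases Int.natAbs_eq k with h | h
    · rw [← h]; exact h0
    · rw [show ((k.natAbs : ℕ) : ℤ) = -k by omega, neg_smul, h0, neg_zero]

theorem mem_roots {k : ℤ} (hk : k ≠ 0) {C X : TorsionPoint} : X ∈ roots k C ↔ k • X = C :=
  mem_finsetOf (finite_roots hk C)

theorem exists_root {k : ℤ} (hk : k ≠ 0) (C : TorsionPoint) : ∃ X : TorsionPoint, k • X = C := by
  have hk' : (k : ℚ) ≠ 0 := by exact_mod_cast hk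
  obtain ⟨r, s, rfl⟩ := exists_pt C
  refine ⟨pt (r / k) (s / k), ?_⟩
  rw [pt_zsmul]
  congr 1 <;> field_simp

theorem sum_roots {N : Type*} [AddCommMonoid N] {k : ℤ} [NeZero k.natAbs]
    {C X₀ : TorsionPoint} (h₀ : k • X₀ = C) (f : TorsionPoint → N) :
    ∑ X ∈ roots k C, f X = ∑ T : torsion k.natAbs, f (X₀ + T) := by
  have hk : k ≠ 0 := by simpa using NeZero.ne k.natAbs
  symm
  have key : ∀ T : TorsionPoint, T ∈ torsion k.natAbs ↔ k • T = 0 := fun T ↦ by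
    rw [mem_torsion_iff]
    rcases Int.natAbs_eq k with h | h
    · rw [← h]
    · rw [show ((k.natAbs : ℕ) : ℤ) = -k by omega, neg_smul, neg_eq_zero]
  refine Finset.sum_bij (fun T _ ↦ X₀ + T) (fun T _ ↦ ?_) (fun T _ T' _ h ↦ ?_)
    (fun X hX ↦ ?_) (fun T _ ↦ rfl)
  · rw [mem_roots hk, smul_add, h₀, (key T).mp T.2, add_zero]
  · exact Subtype.ext (add_left_cancel h)
  · rw [mem_roots hk] at hX
    exact ⟨⟨X - X₀, (key _).mpr (by rw [smul_sub, hX, h₀, sub_self])⟩, Finset.mem_univ _, by simp⟩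

theorem card_roots {k : ℤ} (hk : k ≠ 0) (C : TorsionPoint) :
    (roots k C).card = Nat.card (torsion k.natAbs) := by
  have : NeZero k.natAbs := ⟨by simpa using hk⟩
  obtain ⟨X₀, h₀⟩ := exists_root hk C
  have := sum_roots h₀ (fun _ ↦ 1)
  rw [Nat.card_eq_fintype_card]
  simpa only [Finset.sum_const, smul_eq_mul, mul_one, Finset.card_univ] using this

/-- The distribution relation over a coset of $E[|k|]$. For negative $k$ the parity of the form is
the parity of the power of $k$, here and for $\lambda$ and $y$. -/
theorem sum_xForm_roots {k : ℤ} (hk : k ≠ 0) (C : TorsionPoint) :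
    ∑ X ∈ roots k C, xForm X = (k : ℂ) ^ 2 • xForm C := by
  have : NeZero k.natAbs := ⟨by simpa using hk⟩
  obtain ⟨X₀, h₀⟩ := exists_root hk C
  rw [sum_roots h₀, sum_xForm_add_torsion, ← h₀]
  rcases Int.natAbs_eq k with h | h
  · have : ((k.natAbs : ℕ) : ℂ) = k := by rw [← Int.cast_natCast, ← h]
    rw [← h, this]
  · have h' : ((k.natAbs : ℕ) : ℤ) = -k := by omega
    have : ((k.natAbs : ℕ) : ℂ) = -k := by
      rw [← Int.cast_natCast, h', Int.cast_neg]
    rw [h', this, neg_smul, xForm_neg, neg_sq]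

theorem sum_lambdaForm_roots {k : ℤ} (hk : k ≠ 0) (C : TorsionPoint) :
    ∑ X ∈ roots k C, lambdaForm X = (k : ℂ) • lambdaForm C := by
  have : NeZero k.natAbs := ⟨by simpa using hk⟩
  obtain ⟨X₀, h₀⟩ := exists_root hk C
  rw [sum_roots h₀, sum_lambdaForm_add_torsion, ← h₀]
  rcases Int.natAbs_eq k with h | h
  · have : ((k.natAbs : ℕ) : ℂ) = k := by rw [← Int.cast_natCast, ← h]
    rw [← h, this]
  · have h' : ((k.natAbs : ℕ) : ℤ) = -k := by omega
    have : ((k.natAbs : ℕ) : ℂ) = -k := by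
      rw [← Int.cast_natCast, h', Int.cast_neg]
    rw [h', this, neg_smul, neg_smul, lambdaForm_neg, smul_neg, neg_neg]

theorem sum_yForm_roots {k : ℤ} (hk : k ≠ 0) (C : TorsionPoint) :
    ∑ X ∈ roots k C, yForm X = (k : ℂ) ^ 3 • yForm C := by
  have : NeZero k.natAbs := ⟨by simpa using hk⟩
  obtain ⟨X₀, h₀⟩ := exists_root hk C
  rw [sum_roots h₀, sum_yForm_add_torsion, ← h₀]
  rcases Int.natAbs_eq k with h | h
  · have : ((k.natAbs : ℕ) : ℂ) = k := by rw [← Int.cast_natCast, ← h]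
    rw [← h, this]
  · have h' : ((k.natAbs : ℕ) : ℤ) = -k := by omega
    have : ((k.natAbs : ℕ) : ℂ) = -k := by
      rw [← Int.cast_natCast, h', Int.cast_neg]
    rw [h', this, neg_smul, yForm_neg, smul_neg, ← neg_smul]
    congr 1
    ring

/-- The span of the products `x_P λ_Q` and of the forms `y_P`, for points in a subgroup `H`. -/
def productSpace (H : AddSubgroup TorsionPoint) : Submodule ℂ (UpperHalfPlane → ℂ) :=
  Submodule.span ℂ ({f | ∃ P ∈ H, ∃ Q ∈ H, f = xForm P * lambdaForm Q} ∪
    {f | ∃ P ∈ H, f = yForm P})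

variable {H : AddSubgroup TorsionPoint}

theorem mul_mem_productSpace {P Q : TorsionPoint} (hP : P ∈ H) (hQ : Q ∈ H) :
    xForm P * lambdaForm Q ∈ productSpace H :=
  Submodule.subset_span (Or.inl ⟨P, hP, Q, hQ, rfl⟩)

theorem yForm_mem_productSpace {P : TorsionPoint} (hP : P ∈ H) : yForm P ∈ productSpace H :=
  Submodule.subset_span (Or.inr ⟨P, hP, rfl⟩)

theorem productSpace_mono {H' : AddSubgroup TorsionPoint} (h : H ≤ H') :
    productSpace H ≤ productSpace H' := by
  refine Submodule.span_mono (Set.union_subset_union ?_ ?_)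
  · rintro _ ⟨P, hP, Q, hQ, rfl⟩
    exact ⟨P, h hP, Q, h hQ, rfl⟩
  · rintro _ ⟨P, hP, rfl⟩
    exact ⟨P, h hP, rfl⟩

theorem sum_lambdaForm_sub_roots {k : ℤ} (hk : k ≠ 0) {C X : TorsionPoint} (hX : k • X = C) :
    ∑ Y ∈ roots k C, lambdaForm (X - Y) = 0 := by
  have h : ∑ Y ∈ roots k C, lambdaForm (X - Y) = ∑ T ∈ roots k 0, lambdaForm T := by
    refine Finset.sum_nbij' (X - ·) (X - ·) (fun Y hY ↦ ?_) (fun T hT ↦ ?_) (by simp) (by simp)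
      (fun _ _ ↦ rfl)
    · rw [mem_roots hk] at hY ⊢
      rw [smul_sub, hX, hY, sub_self]
    · rw [mem_roots hk] at hT ⊢
      rw [smul_sub, hX, hT, sub_zero]
  rw [h, sum_lambdaForm_roots hk, lambdaForm_zero, smul_zero]

open scoped Classical in
theorem form_relation_sub (X Y : TorsionPoint) :
    (xForm X - xForm Y) * (lambdaForm X - lambdaForm Y - lambdaForm (X - Y)) =
      if Y ≠ 0 ∧ X ≠ 0 ∧ X ≠ Y then yForm X + yForm Y else 0 := by
  have h := form_relation' X (-Y)
  rw [xForm_neg, lambdaForm_neg, yForm_neg, ← sub_eq_add_neg, ← sub_eq_add_neg] at h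
  rw [h, sub_neg_eq_add]
  refine if_congr ?_ rfl rfl
  rw [neg_ne_zero, sub_ne_zero]
  tauto

open scoped Classical in
-- Each $X\ne O$ admits the same number of $Y$, namely the nonzero roots other than $X$; the term
-- $X=O$ contributes nothing because $y_O=0$.
theorem sum_yForm_ite_roots {k : ℤ} (hk : k ≠ 0) (C : TorsionPoint) :
    ∑ X ∈ roots k C, ∑ Y ∈ roots k C, (if Y ≠ 0 ∧ X ≠ 0 ∧ X ≠ Y then yForm X else 0) =
      ((((roots k C).erase 0).card - 1 : ℂ) * (k : ℂ) ^ 3) • yForm C := by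
  rw [mul_smul, ← sum_yForm_roots hk, Finset.smul_sum]
  refine Finset.sum_congr rfl fun X hX ↦ ?_
  by_cases hX0 : X = 0
  · simp [hX0, yForm_zero]
  · rw [← Finset.sum_filter, Finset.sum_const, ← Nat.cast_smul_eq_nsmul ℂ]
    congr 1
    have h1 : (roots k C).filter (fun Y ↦ Y ≠ 0 ∧ X ≠ 0 ∧ X ≠ Y) =
        ((roots k C).erase 0).erase X := by
      ext Y
      simp only [Finset.mem_filter, Finset.mem_erase]
      tauto
    have h2 : X ∈ (roots k C).erase 0 := Finset.mem_erase.mpr ⟨hX0, hX⟩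
    rw [h1, Finset.card_erase_of_mem h2, Nat.cast_sub (Finset.card_pos.mpr ⟨X, h2⟩), Nat.cast_one]

open scoped Classical in
-- The addition relation for $X$ and $-Y$ is summed over all pairs of roots. The terms with
-- $\lambda_{X-Y}$ sum to zero by oddness, the mixed products factor into a multiple of
-- $x_C\lambda_C$, and the $y$-terms into a multiple of $y_C$. What remains is $2|R|$ times the
-- diagonal sum.
theorem sum_mul_roots_mem {k : ℤ} (hk : k ≠ 0) {C : TorsionPoint} (hC : C ∈ H) :
    ∑ X ∈ roots k C, xForm X * lambdaForm X ∈ productSpace H := by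
  set R := roots k C with hR
  set D := ∑ X ∈ R, xForm X * lambdaForm X with hD
  have hsum : ∑ X ∈ R, ∑ Y ∈ R,
      (xForm X - xForm Y) * (lambdaForm X - lambdaForm Y - lambdaForm (X - Y)) =
      (2 * R.card : ℂ) • D - (2 * k ^ 3 : ℂ) • (xForm C * lambdaForm C) := by
    have e : ∀ X Y : TorsionPoint,
        (xForm X - xForm Y) * (lambdaForm X - lambdaForm Y - lambdaForm (X - Y)) =
        xForm X * lambdaForm X - xForm X * lambdaForm Y - xForm X * lambdaForm (X - Y)
        - lambdaForm X * xForm Y + xForm Y * lambdaForm Y - xForm Y * lambdaForm (Y - X) := by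
      intro X Y
      rw [← neg_sub Y X, lambdaForm_neg]
      ring
    have e1 : ∀ X ∈ R, ∑ Y ∈ R, lambdaForm (X - Y) = 0 := fun X hX ↦
      sum_lambdaForm_sub_roots hk ((mem_roots hk).mp hX)
    have e2 : ∑ X ∈ R, ∑ Y ∈ R, xForm X * lambdaForm (X - Y) = 0 :=
      Finset.sum_eq_zero fun X hX ↦ by rw [← Finset.mul_sum, e1 X hX, mul_zero]
    have e3 : ∑ X ∈ R, ∑ Y ∈ R, xForm Y * lambdaForm (Y - X) = 0 := by
      rw [Finset.sum_comm]; exact e2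
    have e4 : ∑ X ∈ R, ∑ Y ∈ R, xForm X * lambdaForm Y =
        (k ^ 3 : ℂ) • (xForm C * lambdaForm C) := by
      rw [← Finset.sum_mul_sum, sum_xForm_roots hk, sum_lambdaForm_roots hk, smul_mul_smul_comm]
      congr 1
    have e5 : ∑ X ∈ R, ∑ Y ∈ R, lambdaForm X * xForm Y =
        (k ^ 3 : ℂ) • (xForm C * lambdaForm C) := by
      rw [Finset.sum_comm, ← e4]
      simp only [mul_comm]
    have e6 : ∑ X ∈ R, ∑ _Y ∈ R, xForm X * lambdaForm X = (R.card : ℂ) • D := by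
      simp only [Finset.sum_const, ← Finset.smul_sum, Nat.cast_smul_eq_nsmul, hD]
    have e7 : ∑ _X ∈ R, ∑ Y ∈ R, xForm Y * lambdaForm Y = (R.card : ℂ) • D := by
      simp only [Finset.sum_const, Nat.cast_smul_eq_nsmul, hD]
    simp only [e, Finset.sum_add_distrib, Finset.sum_sub_distrib, e2, e3, e4, e5, e6, e7]
    module
  have hy : ∑ X ∈ R, ∑ Y ∈ R,
      (xForm X - xForm Y) * (lambdaForm X - lambdaForm Y - lambdaForm (X - Y)) =
      (2 * (((R.erase 0).card - 1 : ℂ) * (k : ℂ) ^ 3)) • yForm C := by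
    have e : ∀ X Y : TorsionPoint,
        (if Y ≠ 0 ∧ X ≠ 0 ∧ X ≠ Y then yForm X + yForm Y else 0) =
        (if Y ≠ 0 ∧ X ≠ 0 ∧ X ≠ Y then yForm X else 0) +
        (if X ≠ 0 ∧ Y ≠ 0 ∧ Y ≠ X then yForm Y else 0) := by
      intro X Y
      by_cases h : Y ≠ 0 ∧ X ≠ 0 ∧ X ≠ Y
      · rw [if_pos h, if_pos h, if_pos ⟨h.2.1, h.1, h.2.2.symm⟩]
      · rw [if_neg h, if_neg h, if_neg (by tauto), add_zero]
    simp only [form_relation_sub, e, Finset.sum_add_distrib]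
    rw [Finset.sum_comm (s := R) (t := R)
      (f := fun X Y ↦ if X ≠ 0 ∧ Y ≠ 0 ∧ Y ≠ X then yForm Y else 0), sum_yForm_ite_roots hk,
      ← two_smul ℂ, smul_smul]
  rcases R.eq_empty_or_nonempty with h | h
  · rw [hD, h, Finset.sum_empty]
    exact zero_mem _
  · have hc : (2 * R.card : ℂ) ≠ 0 := by
      have := Finset.card_pos.mpr h
      simp
      exact Finset.nonempty_iff_ne_empty.mp h
    have : (2 * R.card : ℂ) • D ∈ productSpace H := by
      rw [← sub_add_cancel ((2 * R.card : ℂ) • D) ((2 * k ^ 3 : ℂ) • (xForm C * lambdaForm C)),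
        ← hsum, hy]
      exact add_mem (Submodule.smul_mem _ _ (yForm_mem_productSpace hC))
        (Submodule.smul_mem _ _ (mul_mem_productSpace hC hC))
    rwa [Submodule.smul_mem_iff _ hc] at this

/-- The determinant of a pair of integer vectors. -/
def cross (m₁ m₂ : ℤ × ℤ) : ℤ := m₁.1 * m₂.2 - m₁.2 * m₂.1

/-- The pairs of points `(X, Y)` with `X m₁ + Y m₂ = C`. -/
def fiber (m₁ m₂ : ℤ × ℤ) (C : TorsionPoint × TorsionPoint) :
    Finset (TorsionPoint × TorsionPoint) :=
  finsetOf {p | m₁.1 • p.1 + m₂.1 • p.2 = C.1 ∧ m₁.2 • p.1 + m₂.2 • p.2 = C.2}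

theorem cross_smul_fst {m₁ m₂ : ℤ × ℤ} {C p : TorsionPoint × TorsionPoint}
    (h : m₁.1 • p.1 + m₂.1 • p.2 = C.1 ∧ m₁.2 • p.1 + m₂.2 • p.2 = C.2) :
    cross m₁ m₂ • p.1 = m₂.2 • C.1 - m₂.1 • C.2 := by
  rw [← h.1, ← h.2, cross]
  module

theorem cross_smul_snd {m₁ m₂ : ℤ × ℤ} {C p : TorsionPoint × TorsionPoint}
    (h : m₁.1 • p.1 + m₂.1 • p.2 = C.1 ∧ m₁.2 • p.1 + m₂.2 • p.2 = C.2) :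
    cross m₁ m₂ • p.2 = m₁.1 • C.2 - m₁.2 • C.1 := by
  rw [← h.1, ← h.2, cross]
  module

theorem mem_fiber {m₁ m₂ : ℤ × ℤ} (h : cross m₁ m₂ ≠ 0) {C p : TorsionPoint × TorsionPoint} :
    p ∈ fiber m₁ m₂ C ↔ m₁.1 • p.1 + m₂.1 • p.2 = C.1 ∧ m₁.2 • p.1 + m₂.2 • p.2 = C.2 := by
  refine mem_finsetOf (((finite_roots h (m₂.2 • C.1 - m₂.1 • C.2)).prod
    (finite_roots h (m₁.1 • C.2 - m₁.2 • C.1))).subset fun q hq ↦ ⟨?_, ?_⟩)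
  · exact cross_smul_fst hq
  · exact cross_smul_snd hq

end Algebra

end TorsionForms

namespace TorsionForms

/-! ### Sums over solutions of linear systems and the descent on the determinant. -/

section Fibers

variable {H : AddSubgroup TorsionPoint}

theorem cross_swap (m₁ m₂ : ℤ × ℤ) : cross m₂ m₁ = -cross m₁ m₂ := by
  simp only [cross]; ring

theorem sum_fiber_swap {N : Type*} [AddCommMonoid N] {m₁ m₂ : ℤ × ℤ} (h : cross m₁ m₂ ≠ 0)
    (C : TorsionPoint × TorsionPoint) (f : TorsionPoint → TorsionPoint → N) :
    ∑ p ∈ fiber m₁ m₂ C, f p.1 p.2 = ∑ p ∈ fiber m₂ m₁ C, f p.2 p.1 := by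
  have h' : cross m₂ m₁ ≠ 0 := by rwa [cross_swap, neg_ne_zero]
  refine Finset.sum_nbij' Prod.swap Prod.swap (fun p hp ↦ ?_) (fun p hp ↦ ?_) (fun _ _ ↦ rfl)
    (fun _ _ ↦ rfl) (fun _ _ ↦ rfl)
  · rw [mem_fiber h] at hp
    rw [mem_fiber h', ← hp.1, ← hp.2]
    exact ⟨add_comm _ _, add_comm _ _⟩
  · rw [mem_fiber h'] at hp
    rw [mem_fiber h, ← hp.1, ← hp.2]
    exact ⟨add_comm _ _, add_comm _ _⟩

theorem cross_sub_left (m₁ m₂ : ℤ × ℤ) : cross (m₁ - m₂) m₂ = cross m₁ m₂ := by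
  simp only [cross, Prod.fst_sub, Prod.snd_sub]; ring

/-- The substitution $S=X+Y$, since $Xm_1+Ym_2=X(m_1-m_2)+Sm_2$. -/
theorem sum_fiber_shear {N : Type*} [AddCommMonoid N] {m₁ m₂ : ℤ × ℤ} (h : cross m₁ m₂ ≠ 0)
    (C : TorsionPoint × TorsionPoint) (f : TorsionPoint → TorsionPoint → N) :
    ∑ p ∈ fiber m₁ m₂ C, f p.1 p.2 = ∑ q ∈ fiber (m₁ - m₂) m₂ C, f q.1 (q.2 - q.1) := by
  have h' : cross (m₁ - m₂) m₂ ≠ 0 := by rwa [cross_sub_left]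
  refine Finset.sum_nbij' (fun p ↦ (p.1, p.1 + p.2)) (fun q ↦ (q.1, q.2 - q.1))
    (fun p hp ↦ ?_) (fun q hq ↦ ?_) (fun p _ ↦ ?_) (fun q _ ↦ ?_) (fun p _ ↦ ?_)
  · rw [mem_fiber h] at hp
    rw [mem_fiber h', ← hp.1, ← hp.2]
    simp only [Prod.fst_sub, Prod.snd_sub]
    constructor <;> module
  · rw [mem_fiber h'] at hq
    rw [mem_fiber h, ← hq.1, ← hq.2]
    simp only [Prod.fst_sub, Prod.snd_sub]
    constructor <;> module
  · simp
  · simp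
  · simp

theorem cross_sub_right (m₁ m₂ : ℤ × ℤ) : cross m₁ (m₂ - m₁) = cross m₁ m₂ := by
  simp only [cross, Prod.fst_sub, Prod.snd_sub]; ring

theorem sum_fiber_shear' {N : Type*} [AddCommMonoid N] {m₁ m₂ : ℤ × ℤ} (h : cross m₁ m₂ ≠ 0)
    (C : TorsionPoint × TorsionPoint) (f : TorsionPoint → TorsionPoint → N) :
    ∑ p ∈ fiber m₁ m₂ C, f p.1 p.2 = ∑ q ∈ fiber m₁ (m₂ - m₁) C, f (q.1 - q.2) q.2 := by
  have h' : cross m₂ m₁ ≠ 0 := by rwa [cross_swap, neg_ne_zero]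
  rw [sum_fiber_swap h, sum_fiber_shear h' C fun a b ↦ f b a]
  exact sum_fiber_swap (by rwa [cross_sub_left]) C fun a b ↦ f (b - a) a

theorem exists_primitive {m : ℤ × ℤ} (hm : m ≠ 0) : ∃ g a b u v : ℤ, g ≠ 0 ∧
    m = (g * a, g * b) ∧ u * a + v * b = 1 := by
  have hg : (Int.gcd m.1 m.2 : ℤ) ≠ 0 := by
    rw [Ne, Int.natCast_eq_zero, Int.gcd_eq_zero_iff]
    rintro ⟨h1, h2⟩
    exact hm (Prod.ext h1 h2)
  obtain ⟨a, ha⟩ := Int.gcd_dvd_left m.1 m.2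
  obtain ⟨b, hb⟩ := Int.gcd_dvd_right m.1 m.2
  refine ⟨Int.gcd m.1 m.2, a, b, Int.gcdA m.1 m.2, Int.gcdB m.1 m.2, hg, Prod.ext ha hb, ?_⟩
  have h := Int.gcd_eq_gcd_ab m.1 m.2
  apply mul_left_cancel₀ hg
  linear_combination -h - Int.gcdA m.1 m.2 * ha - Int.gcdB m.1 m.2 * hb

theorem smul_add_smul_mem {C : TorsionPoint × TorsionPoint} (h₁ : C.1 ∈ H) (h₂ : C.2 ∈ H)
    (a b : ℤ) : a • C.1 + b • C.2 ∈ H :=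
  add_mem (zsmul_mem h₁ _) (zsmul_mem h₂ _)

/-- With $m_2=g(a,b)$ and $(a,b)$ primitive, pairing the system with $(b,-a)$ eliminates $Y$ and
leaves one division equation for $X$ with right hand side in $H$. The Bézout combination gives $gY$
in terms of $X$, so every such $X$ occurs equally often. -/
theorem sum_fiber_fst_mem {φ : TorsionPoint → UpperHalfPlane → ℂ}
    (hφ : ∀ k : ℤ, k ≠ 0 → ∀ C ∈ H, ∑ X ∈ roots k C, φ X ∈ productSpace H)
    {m₁ m₂ : ℤ × ℤ} (h : cross m₁ m₂ ≠ 0) {C : TorsionPoint × TorsionPoint}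
    (h₁ : C.1 ∈ H) (h₂ : C.2 ∈ H) : ∑ p ∈ fiber m₁ m₂ C, φ p.1 ∈ productSpace H := by
  have hm : m₂ ≠ 0 := by
    rintro rfl
    simp [cross] at h
  obtain ⟨g, a, b, u, v, hg, rfl, huv⟩ := exists_primitive hm
  have hk : m₁.1 * b - m₁.2 * a ≠ 0 := by
    intro h0
    apply h
    simp only [cross]
    linear_combination g * h0
  rw [Finset.sum_finset_product' (f := fun X _ ↦ φ X) _
    (roots (m₁.1 * b - m₁.2 * a) (b • C.1 + (-a) • C.2))
    (fun X ↦ roots g (u • C.1 + v • C.2 - (u * m₁.1 + v * m₁.2) • X)) ?_]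
  · simp only [Finset.sum_const, card_roots hg, ← Finset.smul_sum, ← Nat.cast_smul_eq_nsmul ℂ]
    exact Submodule.smul_mem _ _ (hφ _ hk _ (smul_add_smul_mem h₁ h₂ _ _))
  · rintro ⟨X, Y⟩
    rw [mem_fiber h, mem_roots hk, mem_roots hg]
    simp only
    constructor
    · rintro ⟨e1, e2⟩
      rw [← e1, ← e2]
      refine ⟨by module, ?_⟩
      linear_combination (norm := module) (-huv) • (g • Y)
    · rintro ⟨e1, e2⟩
      constructor
      · linear_combination (norm := module) v • e1 + a • e2 + huv • C.1 - huv • (m₁.1 • X)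
      · linear_combination (norm := module) (-u) • e1 + b • e2 + huv • C.2 - huv • (m₁.2 • X)

open scoped Classical in
-- If $Xm_1=C$ has a solution and $m_1=g(a,b)$ with $ua+vb=1$, then it is equivalent to the single
-- equation $gX=uC_1+vC_2$, and the distribution relation for $y$ applies.
theorem sum_fiber_snd_eq_zero_mem {m₁ m₂ : ℤ × ℤ} (h : cross m₁ m₂ ≠ 0)
    {C : TorsionPoint × TorsionPoint} (h₁ : C.1 ∈ H) (h₂ : C.2 ∈ H) :
    ∑ p ∈ fiber m₁ m₂ C, (if p.2 = 0 then yForm p.1 else 0) ∈ productSpace H := by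
  have hm : m₁ ≠ 0 := by
    rintro rfl
    simp [cross] at h
  obtain ⟨g, a, b, u, v, hg, rfl, huv⟩ := exists_primitive hm
  rw [← Finset.sum_filter]
  rcases Finset.eq_empty_or_nonempty ((fiber (g * a, g * b) m₂ C).filter (·.2 = 0)) with
    h0 | ⟨⟨X₀, Y₀⟩, h0⟩
  · rw [h0, Finset.sum_empty]
    exact zero_mem _
  · rw [Finset.mem_filter, mem_fiber h] at h0
    simp only at h0
    obtain ⟨⟨e1, e2⟩, rfl⟩ := h0
    rw [smul_zero, add_zero] at e1 e2
    have hs : ∑ p ∈ (fiber (g * a, g * b) m₂ C).filter (·.2 = 0), yForm p.1 =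
        ∑ X ∈ roots g (u • C.1 + v • C.2), yForm X := by
      refine Finset.sum_nbij' Prod.fst (fun X ↦ (X, 0)) (fun p hp ↦ ?_) (fun X hX ↦ ?_)
        (fun p hp ↦ ?_) (fun _ _ ↦ rfl) (fun _ _ ↦ rfl)
      · rw [Finset.mem_filter, mem_fiber h] at hp
        obtain ⟨⟨e3, e4⟩, e5⟩ := hp
        rw [e5, smul_zero, add_zero] at e3 e4
        rw [mem_roots hg, ← e3, ← e4]
        linear_combination (norm := module) (-huv) • (g • p.1)
      · rw [mem_roots hg, ← e1, ← e2] at hX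
        rw [Finset.mem_filter, mem_fiber h]
        refine ⟨⟨?_, ?_⟩, rfl⟩
        · simp only [smul_zero, add_zero, ← e1]
          linear_combination (norm := module) a • hX + huv • (a • g • X₀)
        · simp only [smul_zero, add_zero, ← e2]
          linear_combination (norm := module) b • hX + huv • (b • g • X₀)
      · rw [Finset.mem_filter] at hp
        exact Prod.ext rfl hp.2.symm
    rw [hs, sum_yForm_roots hg]
    exact Submodule.smul_mem _ _ (yForm_mem_productSpace (smul_add_smul_mem h₁ h₂ _ _))

/-- The sum of `x_X λ_Y` over the solutions of `X m₁ + Y m₂ = C`. -/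
def fiberSum (m₁ m₂ : ℤ × ℤ) (C : TorsionPoint × TorsionPoint) : UpperHalfPlane → ℂ :=
  ∑ p ∈ fiber m₁ m₂ C, xForm p.1 * lambdaForm p.2

theorem cross_smul_left (b : ℤ) (m₁ m₂ : ℤ × ℤ) : cross (b • m₁) m₂ = b * cross m₁ m₂ := by
  simp only [cross, Prod.smul_fst, Prod.smul_snd, smul_eq_mul]; ring

theorem cross_smul_right (b : ℤ) (m₁ m₂ : ℤ × ℤ) : cross m₁ (b • m₂) = b * cross m₁ m₂ := by
  simp only [cross, Prod.smul_fst, Prod.smul_snd, smul_eq_mul]; ring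

/-- A factor $b$ of $m_1$ means that $X$ runs over all $b$-division points of a solution of the
reduced system, and the distribution relation for $x$ carries out that sum. A factor of $m_2$ is
removed in the same way with $\lambda$. -/
theorem fiberSum_smul_left {b : ℤ} (hb : b ≠ 0) {m₁ m₂ : ℤ × ℤ} (h : cross m₁ m₂ ≠ 0)
    (C : TorsionPoint × TorsionPoint) :
    fiberSum (b • m₁) m₂ C = (b ^ 2 : ℂ) • fiberSum m₁ m₂ C := by
  have h' : cross (b • m₁) m₂ ≠ 0 := by rw [cross_smul_left]; exact mul_ne_zero hb h
  rw [fiberSum, fiberSum, Finset.smul_sum]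
  have e : ∀ q ∈ fiber m₁ m₂ C, (b ^ 2 : ℂ) • (xForm q.1 * lambdaForm q.2) =
      ∑ X ∈ roots b q.1, xForm X * lambdaForm q.2 := fun q _ ↦ by
    rw [← Finset.sum_mul, sum_xForm_roots hb, smul_mul_assoc]
  rw [Finset.sum_congr rfl e, Finset.sum_sigma']
  refine Finset.sum_bij' (fun p _ ↦ ⟨(b • p.1, p.2), p.1⟩) (fun s _ ↦ (s.2, s.1.2))
    (fun p hp ↦ ?_) (fun s hs ↦ ?_) (fun p hp ↦ rfl) (fun s hs ↦ ?_) (fun p hp ↦ rfl)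
  · rw [mem_fiber h'] at hp
    rw [Finset.mem_sigma, mem_fiber h, mem_roots hb, ← hp.1, ← hp.2]
    refine ⟨⟨?_, ?_⟩, rfl⟩ <;> simp only [Prod.smul_fst, Prod.smul_snd, smul_eq_mul] <;> module
  · rw [Finset.mem_sigma, mem_fiber h, mem_roots hb] at hs
    rw [mem_fiber h', ← hs.1.1, ← hs.1.2, ← hs.2]
    constructor <;> simp only [Prod.smul_fst, Prod.smul_snd, smul_eq_mul] <;> module
  · obtain ⟨⟨X, Y⟩, Z⟩ := s
    rw [Finset.mem_sigma, mem_roots hb] at hs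
    obtain ⟨-, hs⟩ := hs
    simp only at hs
    subst hs
    rfl

theorem fiberSum_smul_right {b : ℤ} (hb : b ≠ 0) {m₁ m₂ : ℤ × ℤ} (h : cross m₁ m₂ ≠ 0)
    (C : TorsionPoint × TorsionPoint) :
    fiberSum m₁ (b • m₂) C = (b : ℂ) • fiberSum m₁ m₂ C := by
  have h' : cross m₁ (b • m₂) ≠ 0 := by rw [cross_smul_right]; exact mul_ne_zero hb h
  rw [fiberSum, fiberSum, Finset.smul_sum]
  have e : ∀ q ∈ fiber m₁ m₂ C, (b : ℂ) • (xForm q.1 * lambdaForm q.2) =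
      ∑ Y ∈ roots b q.2, xForm q.1 * lambdaForm Y := fun q _ ↦ by
    rw [← Finset.mul_sum, sum_lambdaForm_roots hb, mul_smul_comm]
  rw [Finset.sum_congr rfl e, Finset.sum_sigma']
  refine Finset.sum_bij' (fun p _ ↦ ⟨(p.1, b • p.2), p.2⟩) (fun s _ ↦ (s.1.1, s.2))
    (fun p hp ↦ ?_) (fun s hs ↦ ?_) (fun p hp ↦ rfl) (fun s hs ↦ ?_) (fun p hp ↦ rfl)
  · rw [mem_fiber h'] at hp
    rw [Finset.mem_sigma, mem_fiber h, mem_roots hb, ← hp.1, ← hp.2]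
    refine ⟨⟨?_, ?_⟩, rfl⟩ <;> simp only [Prod.smul_fst, Prod.smul_snd, smul_eq_mul] <;> module
  · rw [Finset.mem_sigma, mem_fiber h, mem_roots hb] at hs
    rw [mem_fiber h', ← hs.1.1, ← hs.1.2, ← hs.2]
    constructor <;> simp only [Prod.smul_fst, Prod.smul_snd, smul_eq_mul] <;> module
  · obtain ⟨⟨X, Y⟩, Z⟩ := s
    rw [Finset.mem_sigma, mem_roots hb] at hs
    obtain ⟨-, hs⟩ := hs
    simp only at hs
    subst hs
    rfl

/-- By Cramer's rule any solution of a unimodular system has coordinates in $H$; this is the base of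
the descent. -/
theorem fiberSum_mem_of_natAbs_eq_one {m₁ m₂ : ℤ × ℤ} (h : (cross m₁ m₂).natAbs = 1)
    {C : TorsionPoint × TorsionPoint} (h₁ : C.1 ∈ H) (h₂ : C.2 ∈ H) :
    fiberSum m₁ m₂ C ∈ productSpace H := by
  have h0 : cross m₁ m₂ ≠ 0 := by
    intro h0
    simp [h0] at h
  have hone : cross m₁ m₂ * cross m₁ m₂ = 1 := by
    rcases Int.natAbs_eq_iff.mp h with e | e <;> rw [e] <;> norm_num
  refine Submodule.sum_mem _ fun p hp ↦ mul_mem_productSpace ?_ ?_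
  · rw [mem_fiber h0] at hp
    have := cross_smul_fst hp
    rw [← one_smul ℤ p.1, ← hone, mul_smul, this]
    exact zsmul_mem (sub_mem (zsmul_mem h₁ _) (zsmul_mem h₂ _)) _
  · rw [mem_fiber h0] at hp
    have := cross_smul_snd hp
    rw [← one_smul ℤ p.2, ← hone, mul_smul, this]
    exact zsmul_mem (sub_mem (zsmul_mem h₂ _) (zsmul_mem h₁ _)) _

open scoped Classical in
-- Any two of the excluded conditions together force $X=S=O$, where $y$ vanishes, so they can be
-- subtracted one at a time.
theorem ite_yForm_add (X S : TorsionPoint) :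
    (if S ≠ 0 ∧ X ≠ 0 ∧ X ≠ S then yForm X + yForm S else 0) =
      yForm X + yForm S - (if S - X = 0 then yForm X else 0) - (if S = 0 then yForm X else 0)
        - (if X = 0 then yForm S else 0) - (if S - X = 0 then yForm S else 0) := by
  by_cases hX : X = 0
  · subst hX
    by_cases hS : S = 0 <;> simp [hS, yForm_zero]
  · by_cases hS : S = 0
    · simp [hX, hS, yForm_zero]
    · by_cases h : X = S
      · simp [h, hS]
      · have : S - X ≠ 0 := sub_ne_zero.mpr (Ne.symm h)
        simp [hX, hS, h, this]

/-- The three-term recursion for sums over fibers, modulo forms of smaller level. -/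
theorem fiberSum_recursion {m₁ m₂ : ℤ × ℤ} (h : cross m₁ m₂ ≠ 0)
    {C : TorsionPoint × TorsionPoint} (h₁ : C.1 ∈ H) (h₂ : C.2 ∈ H) :
    fiberSum m₁ m₂ C - (fiberSum (m₁ - m₂) m₂ C + fiberSum m₂ (m₁ - m₂) C +
      fiberSum m₁ (m₂ - m₁) C) ∈ productSpace H := by
  classical
  have hXS : cross (m₁ - m₂) m₂ ≠ 0 := by rwa [cross_sub_left]
  have hSX : cross m₂ (m₁ - m₂) ≠ 0 := by rwa [cross_swap, cross_sub_left, neg_ne_zero]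
  have hSY : cross m₁ (m₂ - m₁) ≠ 0 := by rwa [cross_sub_right]
  have e1 : fiberSum (m₁ - m₂) m₂ C =
      ∑ p ∈ fiber m₁ m₂ C, xForm p.1 * lambdaForm (p.1 + p.2) := by
    rw [sum_fiber_shear h C fun X Y ↦ xForm X * lambdaForm (X + Y)]
    simp only [add_sub_cancel, fiberSum]
  have e2 : fiberSum m₂ (m₁ - m₂) C =
      ∑ p ∈ fiber m₁ m₂ C, xForm (p.1 + p.2) * lambdaForm p.1 := by
    rw [sum_fiber_shear h C fun X Y ↦ xForm (X + Y) * lambdaForm X]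
    simp only [add_sub_cancel]
    rw [sum_fiber_swap hXS C fun X Y ↦ xForm Y * lambdaForm X, fiberSum]
  have e3 : fiberSum m₁ (m₂ - m₁) C =
      ∑ p ∈ fiber m₁ m₂ C, xForm (p.1 + p.2) * lambdaForm p.2 := by
    rw [sum_fiber_shear' h C fun X Y ↦ xForm (X + Y) * lambdaForm Y]
    simp only [sub_add_cancel, fiberSum]
  have hdiag : ∀ k : ℤ, k ≠ 0 → ∀ C ∈ H,
      ∑ X ∈ roots k C, xForm X * lambdaForm X ∈ productSpace H :=
    fun k hk C hC ↦ sum_mul_roots_mem hk hC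
  have hy : ∀ k : ℤ, k ≠ 0 → ∀ C ∈ H, ∑ X ∈ roots k C, yForm X ∈ productSpace H := by
    intro k hk C hC
    rw [sum_yForm_roots hk]
    exact Submodule.smul_mem _ _ (yForm_mem_productSpace hC)
  have toSX : ∀ f : TorsionPoint → TorsionPoint → UpperHalfPlane → ℂ,
      ∑ p ∈ fiber m₁ m₂ C, f (p.1 + p.2) p.1 = ∑ q ∈ fiber m₂ (m₁ - m₂) C, f q.1 q.2 := by
    intro f
    rw [sum_fiber_shear h C fun X Y ↦ f (X + Y) X]
    simp only [add_sub_cancel]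
    rw [sum_fiber_swap hXS C fun X Y ↦ f Y X]
  have toSY : ∀ f : TorsionPoint → TorsionPoint → UpperHalfPlane → ℂ,
      ∑ p ∈ fiber m₁ m₂ C, f (p.1 + p.2) p.2 = ∑ q ∈ fiber m₁ (m₂ - m₁) C, f q.1 q.2 := by
    intro f
    rw [sum_fiber_shear' h C fun X Y ↦ f (X + Y) Y]
    simp only [sub_add_cancel]
  have toXS : ∀ f : TorsionPoint → TorsionPoint → UpperHalfPlane → ℂ,
      ∑ p ∈ fiber m₁ m₂ C, f p.1 (p.1 + p.2) = ∑ q ∈ fiber (m₁ - m₂) m₂ C, f q.1 q.2 := by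
    intro f
    rw [sum_fiber_shear h C fun X Y ↦ f X (X + Y)]
    simp only [add_sub_cancel]
  -- The addition relation for $X$ and $-S$, where $S=X+Y$, expresses $x_X\lambda_Y$ through
  -- $x_X\lambda_S$, $x_S\lambda_X$ and $x_S\lambda_Y$. The errors are diagonal products and
  -- $y$-forms of one variable, or $y$-forms on a degenerate locus, whose sums were treated above.
  have key : ∀ p : TorsionPoint × TorsionPoint,
      xForm p.1 * lambdaForm p.2 - (xForm p.1 * lambdaForm (p.1 + p.2) +
        xForm (p.1 + p.2) * lambdaForm p.1 + xForm (p.1 + p.2) * lambdaForm p.2) =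
      -(xForm p.1 * lambdaForm p.1) - xForm (p.1 + p.2) * lambdaForm (p.1 + p.2) +
        (yForm p.1 + yForm (p.1 + p.2) - (if p.2 = 0 then yForm p.1 else 0)
          - (if p.1 + p.2 = 0 then yForm p.1 else 0) - (if p.1 = 0 then yForm (p.1 + p.2) else 0)
          - (if p.2 = 0 then yForm (p.1 + p.2) else 0)) := by
    intro p
    have h3 := form_relation_sub p.1 (p.1 + p.2)
    rw [ite_yForm_add, add_sub_cancel_left, sub_add_cancel_left, lambdaForm_neg] at h3
    rw [← h3]
    ring
  rw [e1, e2, e3, fiberSum, ← Finset.sum_add_distrib, ← Finset.sum_add_distrib,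
    ← Finset.sum_sub_distrib, Finset.sum_congr rfl fun p _ ↦ key p]
  simp only [Finset.sum_add_distrib, Finset.sum_sub_distrib, Finset.sum_neg_distrib]
  refine add_mem (sub_mem (neg_mem ?_) ?_)
    (sub_mem (sub_mem (sub_mem (sub_mem (add_mem ?_ ?_) ?_) ?_) ?_) ?_)
  · exact sum_fiber_fst_mem hdiag h h₁ h₂
  · rw [toSX fun S _ ↦ xForm S * lambdaForm S]
    exact sum_fiber_fst_mem hdiag hSX h₁ h₂
  · exact sum_fiber_fst_mem hy h h₁ h₂
  · rw [toSX fun S _ ↦ yForm S]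
    exact sum_fiber_fst_mem hy hSX h₁ h₂
  · exact sum_fiber_snd_eq_zero_mem h h₁ h₂
  · rw [toXS fun X S ↦ if S = 0 then yForm X else 0]
    exact sum_fiber_snd_eq_zero_mem hXS h₁ h₂
  · rw [toSX fun S X ↦ if X = 0 then yForm S else 0]
    exact sum_fiber_snd_eq_zero_mem hSX h₁ h₂
  · rw [toSY fun S Y ↦ if Y = 0 then yForm S else 0]
    exact sum_fiber_snd_eq_zero_mem hSY h₁ h₂

/-- A sum of products `x_X λ_Y` over all solutions of a nondegenerate system of two linear
equations with right hand sides in `H` is a combination of products for points in `H`, up to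
Eisenstein series of weight three. -/
theorem fiberSum_mem {m₁ m₂ : ℤ × ℤ} (h : cross m₁ m₂ ≠ 0)
    {C : TorsionPoint × TorsionPoint} (h₁ : C.1 ∈ H) (h₂ : C.2 ∈ H) :
    fiberSum m₁ m₂ C ∈ productSpace H := by
  induction hd : (cross m₁ m₂).natAbs using Nat.strong_induction_on generalizing m₁ m₂ with
  | _ d ih =>
  have ih' : ∀ {r₁ r₂ : ℤ × ℤ}, cross r₁ r₂ ≠ 0 → (cross r₁ r₂).natAbs < d →
      fiberSum r₁ r₂ C ∈ productSpace H := fun h0 hlt ↦ ih _ hlt h0 rfl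
  by_cases hd1 : d = 1
  · exact fiberSum_mem_of_natAbs_eq_one (hd.trans hd1) h₁ h₂
  have hm : m₁ ≠ 0 := by
    rintro rfl
    simp [cross] at h
  obtain ⟨g, a, b, u, v, hg, hm₁, huv⟩ := exists_primitive hm
  have hd2 : 2 ≤ d := by
    have := Int.natAbs_ne_zero.mpr h
    omega
  have hm₁' : m₁ = g • (a, b) := by rw [hm₁]; simp
  have hc : cross m₁ m₂ = g * cross (a, b) m₂ := by rw [hm₁', cross_smul_left]
  have h' : cross (a, b) m₂ ≠ 0 := fun h0 ↦ h (by rw [hc, h0, mul_zero])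
  -- If $m_1$ is not primitive, dividing out its content lowers the determinant.
  by_cases hg1 : g.natAbs = 1
  swap
  · rw [hm₁', fiberSum_smul_left hg h']
    refine Submodule.smul_mem _ _ (ih' h' ?_)
    rw [← hd, hc, Int.natAbs_mul]
    have := Int.natAbs_ne_zero.mpr h'
    have := Int.natAbs_ne_zero.mpr hg
    exact lt_mul_left (by omega) (by omega)
  set δ := cross m₁ m₂ with hδ
  -- As $m_1$ is primitive, $m_2$ is a multiple of $m_1$ modulo $\delta$. The multiplier is read off
  -- by the Bézout functional $(u,v)$, with $g=\pm1$ its own inverse, and is reduced so that $0\le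
  -- t<|\delta|$.
  set t := (u * m₂.1 + v * m₂.2) * g % δ with ht
  have hgg : g * g = 1 := by
    rcases Int.natAbs_eq_iff.mp hg1 with e | e <;> rw [e] <;> norm_num
  obtain ⟨r, hr⟩ : ∃ r : ℤ × ℤ, t • m₁ - m₂ = δ • r := by
    have e := Int.emod_add_mul_ediv ((u * m₂.1 + v * m₂.2) * g) δ
    rw [← ht] at e
    set q := (u * m₂.1 + v * m₂.2) * g / δ
    refine ⟨(v * g, -u * g) - q • m₁, ?_⟩
    have hδ' : δ = g * (a * m₂.2 - b * m₂.1) := hc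
    have e' : t = (u * m₂.1 + v * m₂.2) * g - g * (a * m₂.2 - b * m₂.1) * q := by
      rw [← hδ']; linear_combination e
    rw [hδ', e', hm₁]
    ext
    · simp only [Prod.fst_sub, Prod.smul_fst, smul_eq_mul]
      linear_combination m₂.1 * g * g * huv + m₂.1 * hgg
    · simp only [Prod.snd_sub, Prod.smul_snd, smul_eq_mul]
      linear_combination m₂.2 * g * g * huv + m₂.2 * hgg
  have ht0 : 0 ≤ t := Int.emod_nonneg _ h
  have htlt : t.natAbs < d := by
    have := Int.emod_lt_abs ((u * m₂.1 + v * m₂.2) * g) h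
    rw [← ht, Int.abs_eq_natAbs, hd] at this
    omega
  have hc1 : cross m₁ r = -1 := by
    apply mul_left_cancel₀ h
    have : cross m₁ (δ • r) = -δ := by
      rw [← hr, hδ]
      simp only [cross, Prod.fst_sub, Prod.snd_sub, Prod.smul_fst, Prod.smul_snd, smul_eq_mul]
      ring
    rw [cross_smul_right] at this
    rw [this]
    ring
  have hc2 : cross r m₂ = t := by
    apply mul_left_cancel₀ h
    have : cross (δ • r) m₂ = t * δ := by
      rw [← hr, hδ]
      simp only [cross, Prod.fst_sub, Prod.snd_sub, Prod.smul_fst, Prod.smul_snd, smul_eq_mul]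
      ring
    rw [cross_smul_left] at this
    rw [this]
    ring
  have hJ1 : fiberSum m₁ r C ∈ productSpace H :=
    fiberSum_mem_of_natAbs_eq_one (by rw [hc1]; rfl) h₁ h₂
  by_cases ht1 : t = 0
  · have hm₂ : m₂ = (-δ) • r := by
      rw [neg_smul, ← hr, ht1]
      simp
    rw [hm₂, fiberSum_smul_right (neg_ne_zero.mpr h) (by rw [hc1]; norm_num)]
    exact Submodule.smul_mem _ _ hJ1
  · have hb : cross (t • m₁) m₂ ≠ 0 := by
      rw [cross_smul_left]
      exact mul_ne_zero ht1 h
    -- The recursion is applied to $(tm_1,m_2)$, whose difference is $\delta r$. Once the factors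
    -- $t$ and $\delta$ are stripped off, the other three sums belong to $(r,m_2)$, $(m_2,r)$ and
    -- $(m_1,r)$, of determinants $\pm t$ and $-1$, all covered by induction or the base case.
    have hrec := fiberSum_recursion hb h₁ h₂ (H := H)
    have hrm : m₂ - t • m₁ = (-δ) • r := by rw [neg_smul, ← hr, neg_sub]
    have hc2' : cross r m₂ ≠ 0 := by rwa [hc2]
    have hc3 : cross m₂ r ≠ 0 := by rwa [cross_swap, neg_ne_zero]
    have hc1' : cross m₁ r ≠ 0 := by rw [hc1]; norm_num
    rw [hr, hrm, fiberSum_smul_left ht1 h, fiberSum_smul_left h hc2', fiberSum_smul_right h hc3,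
      fiberSum_smul_left ht1 (by
        rw [cross_smul_right]; exact mul_ne_zero (neg_ne_zero.mpr h) hc1'),
      fiberSum_smul_right (neg_ne_zero.mpr h) hc1'] at hrec
    have hV : ∀ c : ℂ, c • fiberSum r m₂ C ∈ productSpace H := fun c ↦
      Submodule.smul_mem _ _ (ih' hc2' (by rwa [hc2]))
    have hV' : ∀ c : ℂ, c • fiberSum m₂ r C ∈ productSpace H := fun c ↦
      Submodule.smul_mem _ _ (ih' hc3 (by rwa [cross_swap, Int.natAbs_neg, hc2]))
    have hrest := add_mem hrec (add_mem (add_mem (hV (δ ^ 2 : ℂ)) (hV' (δ : ℂ)))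
      (Submodule.smul_mem _ (t ^ 2 : ℂ) (Submodule.smul_mem _ (((-δ : ℤ)) : ℂ) hJ1)))
    rw [sub_add_cancel] at hrest
    exact (Submodule.smul_mem_iff _ (by simpa using ht1)).mp hrest

end Fibers

end TorsionForms

namespace TorsionForms

/-! ### The torsion sums of (1) and (2) as fibre sums. -/

section TorsionSums

variable {H : AddSubgroup TorsionPoint}

/-- The pairs $X=A+T$, $Y=B-sT$ are exactly the solutions of $nX=nA$, $sX+Y=sA+B$, a system of
determinant $n$. -/
theorem sum_torsion_eq_fiberSum (n : ℕ) [NeZero n] (A B : TorsionPoint) (s : ℤ) :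
    ∑ T : torsion n, xForm (A + T) * lambdaForm (B - s • (T : TorsionPoint)) =
      fiberSum (n, s) (0, 1) ((n : ℤ) • A, s • A + B) := by
  have hn : (n : ℤ) ≠ 0 := by exact_mod_cast NeZero.ne n
  have hc : cross (n, s) (0, 1) ≠ 0 := by simpa [cross] using hn
  refine Finset.sum_bij (fun T _ ↦ (A + T, B - s • (T : TorsionPoint))) (fun T _ ↦ ?_)
    (fun T _ T' _ h ↦ ?_) (fun p hp ↦ ?_) (fun _ _ ↦ rfl)
  · have hT : (n : ℤ) • (T : TorsionPoint) = 0 := T.2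
    rw [mem_fiber hc]
    refine ⟨?_, ?_⟩
    · simp only [zero_smul, add_zero, smul_add, hT]
    · simp only
      module
  · exact Subtype.ext (add_left_cancel (congrArg Prod.fst h))
  · rw [mem_fiber hc] at hp
    obtain ⟨h1, h2⟩ := hp
    simp only [zero_smul, add_zero, one_smul] at h1 h2
    refine ⟨⟨p.1 - A, ?_⟩, Finset.mem_univ _, Prod.ext ?_ ?_⟩
    · rw [mem_torsion_iff, smul_sub, h1, sub_self]
    · simp
    · simp only
      rw [eq_sub_of_add_eq' h2]
      module

theorem sum_torsion_mem (n : ℕ) [NeZero n] {A B : TorsionPoint} {s : ℤ}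
    (h₁ : (n : ℤ) • A ∈ H) (h₂ : s • A + B ∈ H) :
    ∑ T : torsion n, xForm (A + T) * lambdaForm (B - s • (T : TorsionPoint)) ∈
      productSpace H := by
  have hn : (n : ℤ) ≠ 0 := by exact_mod_cast NeZero.ne n
  rw [sum_torsion_eq_fiberSum]
  exact fiberSum_mem (by simpa [cross] using hn) h₁ h₂

theorem sum_torsion_mem' (n : ℕ) [NeZero n] {A B : TorsionPoint} {s : ℤ}
    (h₁ : (n : ℤ) • B ∈ H) (h₂ : A + s • B ∈ H) :
    ∑ T : torsion n, xForm (A - s • (T : TorsionPoint)) * lambdaForm (B + T) ∈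
      productSpace H := by
  have hn : (n : ℤ) ≠ 0 := by exact_mod_cast NeZero.ne n
  have hc : cross (0, 1) (n, s) ≠ 0 := by simpa [cross] using hn
  have e : ∑ T : torsion n, xForm (A - s • (T : TorsionPoint)) * lambdaForm (B + T) =
      fiberSum (0, 1) (n, s) ((n : ℤ) • B, A + s • B) := by
    refine Finset.sum_bij (fun T _ ↦ (A - s • (T : TorsionPoint), B + T)) (fun T _ ↦ ?_)
      (fun T _ T' _ h ↦ ?_) (fun p hp ↦ ?_) (fun _ _ ↦ rfl)
    · have hT : (n : ℤ) • (T : TorsionPoint) = 0 := T.2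
      rw [mem_fiber hc]
      refine ⟨?_, ?_⟩
      · simp only [zero_smul, zero_add, smul_add, hT, add_zero]
      · simp only
        module
    · exact Subtype.ext (add_left_cancel (congrArg Prod.snd h))
    · rw [mem_fiber hc] at hp
      obtain ⟨h1, h2⟩ := hp
      simp only [zero_smul, zero_add, one_smul] at h1 h2
      refine ⟨⟨p.2 - B, ?_⟩, Finset.mem_univ _, Prod.ext ?_ ?_⟩
      · rw [mem_torsion_iff, smul_sub, h1, sub_self]
      · simp only
        rw [eq_sub_of_add_eq h2]
        module
      · simp
  rw [e]
  exact fiberSum_mem hc h₁ h₂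

/-- Separating the weight three Eisenstein series from the products. -/
theorem exists_sub_mem_of_mem_productSpace {N : ℕ} (hH : H ≤ torsion N)
    {f : UpperHalfPlane → ℂ} (hf : f ∈ productSpace H) :
    ∃ g ∈ Submodule.span ℂ {f | ∃ P ∈ H, ∃ Q ∈ H, f = xForm P * lambdaForm Q},
      f - g ∈ eisensteinSpaceThree N := by
  rw [productSpace, Submodule.span_union, Submodule.mem_sup] at hf
  obtain ⟨g, hg, e, he, rfl⟩ := hf
  refine ⟨g, hg, ?_⟩
  rw [add_sub_cancel_left]
  refine Submodule.span_mono ?_ he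
  rintro _ ⟨P, hP, rfl⟩
  exact ⟨P, hH hP, rfl⟩

/-- The subgroup $H$ is generated by the right hand sides $nA$ and $sA+B$ of the system. An element
$u\,nA+v(sA+B)$ has coefficients $a=un+vs$ and $b=v$, so $a-sb=un$. -/
theorem exists_sum_torsion_sub_mem (n l : ℕ) [NeZero n] {A B : TorsionPoint}
    (hA : A ∈ torsion (n * l)) (hB : B ∈ torsion (n * l)) (s : ℤ) :
    ∃ g ∈ Submodule.span ℂ {f : UpperHalfPlane → ℂ | ∃ a b c d : ℤ,
        a - s * b ≡ 0 [ZMOD n] ∧ c - s * d ≡ 0 [ZMOD n] ∧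
        f = xForm (a • A + b • B) * lambdaForm (c • A + d • B)},
      (∑ T : torsion n, xForm (A + T) * lambdaForm (B - s • (T : TorsionPoint))) - g ∈
        eisensteinSpaceThree (n * l) := by
  set H := AddSubgroup.closure {(n : ℤ) • A, s • A + B} with hH
  have hHt : H ≤ torsion (n * l) := by
    rw [hH, AddSubgroup.closure_le]
    rintro P (rfl | rfl)
    · exact zsmul_mem hA _
    · exact add_mem (zsmul_mem hA _) hB
  have hrep : ∀ P ∈ H, ∃ a b : ℤ, a - s * b ≡ 0 [ZMOD n] ∧ P = a • A + b • B := by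
    intro P hP
    obtain ⟨u, v, rfl⟩ := AddSubgroup.mem_closure_pair.mp hP
    refine ⟨u * n + v * s, v, ?_, by module⟩
    rw [Int.modEq_zero_iff_dvd]
    exact ⟨u, by ring⟩
  obtain ⟨g, hg, hfg⟩ := exists_sub_mem_of_mem_productSpace hHt
    (sum_torsion_mem n (H := H) (A := A) (B := B) (s := s)
      (AddSubgroup.subset_closure (Or.inl rfl)) (AddSubgroup.subset_closure (Or.inr rfl)))
  refine ⟨g, Submodule.span_mono ?_ hg, hfg⟩
  rintro _ ⟨P, hP, Q, hQ, rfl⟩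
  obtain ⟨a, b, hab, rfl⟩ := hrep P hP
  obtain ⟨c, d, hcd, rfl⟩ := hrep Q hQ
  exact ⟨a, b, c, d, hab, hcd, rfl⟩

theorem exists_sum_torsion_sub_mem' (n l : ℕ) [NeZero n] {A B : TorsionPoint}
    (hA : A ∈ torsion (n * l)) (hB : B ∈ torsion (n * l)) (s : ℤ) :
    ∃ g ∈ Submodule.span ℂ {f : UpperHalfPlane → ℂ | ∃ a b c d : ℤ,
        -s * a + b ≡ 0 [ZMOD n] ∧ -s * c + d ≡ 0 [ZMOD n] ∧
        f = xForm (a • A + b • B) * lambdaForm (c • A + d • B)},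
      (∑ T : torsion n, xForm (A - s • (T : TorsionPoint)) * lambdaForm (B + T)) - g ∈
        eisensteinSpaceThree (n * l) := by
  set H := AddSubgroup.closure {(n : ℤ) • B, A + s • B} with hH
  have hHt : H ≤ torsion (n * l) := by
    rw [hH, AddSubgroup.closure_le]
    rintro P (rfl | rfl)
    · exact zsmul_mem hB _
    · exact add_mem hA (zsmul_mem hB _)
  have hrep : ∀ P ∈ H, ∃ a b : ℤ, -s * a + b ≡ 0 [ZMOD n] ∧ P = a • A + b • B := by
    intro P hP
    obtain ⟨u, v, rfl⟩ := AddSubgroup.mem_closure_pair.mp hP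
    refine ⟨v, u * n + v * s, ?_, by module⟩
    rw [Int.modEq_zero_iff_dvd]
    exact ⟨u, by ring⟩
  obtain ⟨g, hg, hfg⟩ := exists_sub_mem_of_mem_productSpace hHt
    (sum_torsion_mem' n (H := H) (A := A) (B := B) (s := s)
      (AddSubgroup.subset_closure (Or.inl rfl)) (AddSubgroup.subset_closure (Or.inr rfl)))
  refine ⟨g, Submodule.span_mono ?_ hg, hfg⟩
  rintro _ ⟨P, hP, Q, hQ, rfl⟩
  obtain ⟨a, b, hab, rfl⟩ := hrep P hP
  obtain ⟨c, d, hcd, rfl⟩ := hrep Q hQ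
  exact ⟨a, b, c, d, hab, hcd, rfl⟩

end TorsionSums

end TorsionForms

namespace TorsionForms

/-! ### The action of SL₂(ℤ) on the forms. -/

section Slash

/-- Homothetic lattices: multiplication by `c` as a bijection. -/
def latticeEquiv {L L' : PeriodPair} {c : ℂ} (hc : c ≠ 0)
    (h : ∀ z, z ∈ L'.lattice ↔ c * z ∈ L.lattice) : L'.lattice ≃ L.lattice where
  toFun z := ⟨c * z, (h z).mp z.2⟩
  invFun z := ⟨c⁻¹ * z, (h _).mpr (by rw [mul_inv_cancel_left₀ hc]; exact z.2)⟩
  left_inv z := Subtype.ext (inv_mul_cancel_left₀ hc _)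
  right_inv z := Subtype.ext (mul_inv_cancel_left₀ hc _)

section Homothety

variable {L L' : PeriodPair} {c : ℂ} (hc : c ≠ 0) (h : ∀ z, z ∈ L'.lattice ↔ c * z ∈ L.lattice)

include hc h

theorem weierstrassP_homothety (z : ℂ) :
    L'.weierstrassP z = c ^ 2 * L.weierstrassP (c * z) := by
  rw [PeriodPair.weierstrassP, PeriodPair.weierstrassP, ← (latticeEquiv hc h).tsum_eq,
    ← tsum_mul_left]
  refine tsum_congr fun l ↦ ?_
  change _ = c ^ 2 * (1 / (c * z - c * l) ^ 2 - 1 / (c * l) ^ 2)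
  rw [← mul_sub, mul_pow, mul_pow, mul_sub, ← mul_div_assoc, ← mul_div_assoc,
    mul_div_mul_left _ _ (pow_ne_zero 2 hc), mul_div_mul_left _ _ (pow_ne_zero 2 hc)]

theorem derivWeierstrassP_homothety (z : ℂ) :
    L'.derivWeierstrassP z = c ^ 3 * L.derivWeierstrassP (c * z) := by
  rw [PeriodPair.derivWeierstrassP, PeriodPair.derivWeierstrassP, mul_neg,
    ← (latticeEquiv hc h).tsum_eq, ← tsum_mul_left]
  congr 1
  refine tsum_congr fun l ↦ ?_
  change _ = c ^ 3 * (2 / (c * z - c * l) ^ 3)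
  rw [← mul_sub, mul_pow, ← mul_div_assoc, mul_div_mul_left _ _ (pow_ne_zero 3 hc)]

theorem weierstrassZeta_homothety (z : ℂ) :
    weierstrassZeta L' z = c * weierstrassZeta L (c * z) := by
  rw [weierstrassZeta, weierstrassZeta, ← (latticeEquiv hc h).tsum_eq, ← tsum_mul_left]
  refine tsum_congr fun l ↦ ?_
  change _ = c * (1 / (c * z - c * l) + 1 / (c * l) + c * z / (c * l) ^ 2)
  have e : c * (c * z / (c * l) ^ 2) = z / (l : ℂ) ^ 2 := by
    rw [mul_pow, ← mul_div_assoc, ← mul_assoc, ← sq, mul_div_mul_left _ _ (pow_ne_zero 2 hc)]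
  rw [← mul_sub, mul_add, mul_add, e, ← mul_div_assoc, ← mul_div_assoc, mul_div_mul_left _ _ hc,
    mul_div_mul_left _ _ hc]

theorem quasiPeriod_homothety (l : L'.lattice) :
    quasiPeriod L' l = c * quasiPeriod L (latticeEquiv hc h l) := by
  have e := two_mul_zeta_half L (latticeEquiv hc h l)
  rw [← two_mul_zeta_half, weierstrassZeta_homothety hc h, ← e,
    show ((latticeEquiv hc h l : L.lattice) : ℂ) = c * l from rfl]
  ring_nf

end Homothety

variable (γ : SL(2, ℤ)) (τ : UpperHalfPlane)

theorem denom_mul_coe_smul : UpperHalfPlane.denom γ τ * ((γ • τ : UpperHalfPlane) : ℂ) =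
    γ 0 0 * τ + γ 0 1 := by
  rw [UpperHalfPlane.coe_specialLinearGroup_apply]
  have := UpperHalfPlane.denom_ne_zero γ τ
  rw [ModularGroup.denom_apply] at this ⊢
  simp only [algebraMap_int_eq, eq_intCast, Complex.ofReal_intCast]
  rw [mul_div_cancel₀ _ this]

theorem det_eq : γ 0 0 * γ 1 1 - γ 0 1 * γ 1 0 = 1 := by
  have := γ.det_coe
  rwa [Matrix.det_fin_two] at this

theorem mem_lattice_smul_iff (z : ℂ) : z ∈ (latticeOf (γ • τ)).lattice ↔
    UpperHalfPlane.denom γ τ * z ∈ (latticeOf τ).lattice := by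
  have hj := UpperHalfPlane.denom_ne_zero γ τ
  have h1 := denom_mul_coe_smul γ τ
  have h2 : UpperHalfPlane.denom γ τ = γ 1 0 * τ + γ 1 1 := ModularGroup.denom_apply γ τ
  have hd : (γ 0 0 * γ 1 1 - γ 0 1 * γ 1 0 : ℂ) = 1 := by exact_mod_cast det_eq γ
  rw [PeriodPair.mem_lattice, PeriodPair.mem_lattice]
  simp only [latticeOf_ω₁, latticeOf_ω₂]
  constructor
  · rintro ⟨m, n, rfl⟩
    refine ⟨m * γ 1 1 + n * γ 0 1, m * γ 1 0 + n * γ 0 0, ?_⟩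
    push_cast
    linear_combination -(n : ℂ) * h1 - m * h2
  · rintro ⟨m, n, h⟩
    refine ⟨m * γ 0 0 - n * γ 0 1, n * γ 1 1 - m * γ 1 0, ?_⟩
    apply mul_left_cancel₀ hj
    push_cast
    linear_combination h + (n * γ 1 1 - m * γ 1 0) * h1 + (m * γ 0 0 - n * γ 0 1) * h2 +
      (m + n * τ) * hd

/-- Multiplication by $c\tau+d$ carries $L_{\gamma\tau}$ onto $L_\tau$ and transforms both the
periods and the quasi-periods linearly by γ, so $(r,s)$ is replaced by the row vector $(r,s)\gamma$.
-/
theorem zetaNorm_smul (r s : ℂ) : zetaNorm (latticeOf (γ • τ)) r s =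
    UpperHalfPlane.denom γ τ *
      zetaNorm (latticeOf τ) (r * γ 0 0 + s * γ 1 0) (r * γ 0 1 + s * γ 1 1) := by
  have hj := UpperHalfPlane.denom_ne_zero γ τ
  have h := mem_lattice_smul_iff γ τ
  have h1 := denom_mul_coe_smul γ τ
  have h2 : UpperHalfPlane.denom γ τ = γ 1 0 * τ + γ 1 1 := ModularGroup.denom_apply γ τ
  have e1 : latticeEquiv hj h (period₁ _) =
      γ 1 0 • period₂ (latticeOf τ) + γ 1 1 • period₁ (latticeOf τ) := by
    ext
    rw [coe_periods, latticeOf_ω₁, latticeOf_ω₂]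
    change UpperHalfPlane.denom γ τ * 1 = _
    linear_combination h2
  have e2 : latticeEquiv hj h (period₂ _) =
      γ 0 0 • period₂ (latticeOf τ) + γ 0 1 • period₁ (latticeOf τ) := by
    ext
    rw [coe_periods, latticeOf_ω₁, latticeOf_ω₂]
    change UpperHalfPlane.denom γ τ * ((γ • τ : UpperHalfPlane) : ℂ) = _
    linear_combination h1
  rw [zetaNorm, zetaNorm, weierstrassZeta_homothety hj h, quasiPeriod_homothety hj h,
    quasiPeriod_homothety hj h, e1, e2, quasiPeriod_eq, quasiPeriod_eq]
  simp only [latticeOf_ω₁, latticeOf_ω₂]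
  have e3 : UpperHalfPlane.denom γ τ * (r * ((γ • τ : UpperHalfPlane) : ℂ) + s * 1) =
      (r * γ 0 0 + s * γ 1 0) * τ + (r * γ 0 1 + s * γ 1 1) * 1 := by
    linear_combination r * h1 + s * h2
  rw [e3]
  ring

/-- The right action of `SL₂(ℤ)` on torsion points, as row vectors. -/
def act (γ : SL(2, ℤ)) (P : TorsionPoint) : TorsionPoint :=
  ![γ 0 0 • P 0 + γ 1 0 • P 1, γ 0 1 • P 0 + γ 1 1 • P 1]

theorem act_pt (r s : ℚ) :
    act γ (pt r s) = pt (r * γ 0 0 + s * γ 1 0) (r * γ 0 1 + s * γ 1 1) := by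
  have h : ∀ (m : ℤ) (t : ℚ), m • (t : AddCircle (1 : ℚ)) = ((t * m : ℚ) : AddCircle (1 : ℚ)) :=
    fun m t ↦ by rw [← AddCircle.coe_zsmul, zsmul_eq_mul, mul_comm]
  ext i
  fin_cases i
  · change γ 0 0 • (r : AddCircle (1 : ℚ)) + γ 1 0 • (s : AddCircle (1 : ℚ)) = _
    rw [h, h, ← AddCircle.coe_add]
    rfl
  · change γ 0 1 • (r : AddCircle (1 : ℚ)) + γ 1 1 • (s : AddCircle (1 : ℚ)) = _
    rw [h, h, ← AddCircle.coe_add]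
    rfl

theorem xForm_slash (P : TorsionPoint) : xForm P ∣[(2 : ℤ)] γ = xForm (act γ P) := by
  ext τ
  obtain ⟨r, s, rfl⟩ := exists_pt P
  have hj := UpperHalfPlane.denom_ne_zero γ τ
  have h1 := denom_mul_coe_smul γ τ
  have h2 : UpperHalfPlane.denom γ τ = γ 1 0 * τ + γ 1 1 := ModularGroup.denom_apply γ τ
  rw [ModularForm.SL_slash_apply, act_pt, xForm_pt, xForm_pt,
    weierstrassP_homothety hj (mem_lattice_smul_iff γ τ), mul_comm, ← mul_assoc, zpow_neg]
  have e : UpperHalfPlane.denom γ τ * (r * ((γ • τ : UpperHalfPlane) : ℂ) + s) =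
      ((r * γ 0 0 + s * γ 1 0 : ℚ) : ℂ) * τ + ((r * γ 0 1 + s * γ 1 1 : ℚ) : ℂ) := by
    push_cast
    linear_combination (r : ℂ) * h1 + s * h2
  rw [e, zpow_ofNat, inv_mul_cancel₀ (pow_ne_zero 2 hj), one_mul]

theorem yForm_slash (P : TorsionPoint) : yForm P ∣[(3 : ℤ)] γ = yForm (act γ P) := by
  ext τ
  obtain ⟨r, s, rfl⟩ := exists_pt P
  have hj := UpperHalfPlane.denom_ne_zero γ τ
  have h1 := denom_mul_coe_smul γ τ
  have h2 : UpperHalfPlane.denom γ τ = γ 1 0 * τ + γ 1 1 := ModularGroup.denom_apply γ τ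
  rw [ModularForm.SL_slash_apply, act_pt, yForm_pt, yForm_pt,
    derivWeierstrassP_homothety hj (mem_lattice_smul_iff γ τ), mul_div_assoc, mul_comm,
    ← mul_assoc, zpow_neg]
  have e : UpperHalfPlane.denom γ τ * (r * ((γ • τ : UpperHalfPlane) : ℂ) + s) =
      ((r * γ 0 0 + s * γ 1 0 : ℚ) : ℂ) * τ + ((r * γ 0 1 + s * γ 1 1 : ℚ) : ℂ) := by
    push_cast
    linear_combination (r : ℂ) * h1 + s * h2
  rw [e, zpow_ofNat, inv_mul_cancel₀ (pow_ne_zero 3 hj), one_mul]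

theorem lambdaForm_slash (P : TorsionPoint) :
    lambdaForm P ∣[(1 : ℤ)] γ = lambdaForm (act γ P) := by
  ext τ
  obtain ⟨r, s, rfl⟩ := exists_pt P
  have hj := UpperHalfPlane.denom_ne_zero γ τ
  rw [ModularForm.SL_slash_apply, act_pt, lambdaForm_pt, lambdaForm_pt, zetaNorm_smul, mul_comm,
    ← mul_neg, ← mul_assoc, zpow_neg, zpow_one, inv_mul_cancel₀ hj, one_mul]
  push_cast
  rfl

theorem mul_slash_three (P Q : TorsionPoint) : (xForm P * lambdaForm Q) ∣[(3 : ℤ)] γ =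
    xForm (act γ P) * lambdaForm (act γ Q) := by
  have := ModularForm.mul_slash_SL2 2 1 γ (xForm P) (lambdaForm Q)
  rwa [xForm_slash, lambdaForm_slash, show (2 + 1 : ℤ) = 3 by norm_num] at this

theorem act_add (P Q : TorsionPoint) : act γ (P + Q) = act γ P + act γ Q := by
  ext i
  fin_cases i
  · change γ 0 0 • (P 0 + Q 0) + γ 1 0 • (P 1 + Q 1) = (γ 0 0 • P 0 + γ 1 0 • P 1) +
      (γ 0 0 • Q 0 + γ 1 0 • Q 1)
    module
  · change γ 0 1 • (P 0 + Q 0) + γ 1 1 • (P 1 + Q 1) = (γ 0 1 • P 0 + γ 1 1 • P 1) +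
      (γ 0 1 • Q 0 + γ 1 1 • Q 1)
    module

/-- The action of a matrix on torsion points, as a homomorphism. -/
def actHom : TorsionPoint →+ TorsionPoint := AddMonoidHom.mk' (act γ) (act_add γ)

theorem act_zsmul (n : ℤ) (P : TorsionPoint) : act γ (n • P) = n • act γ P :=
  map_zsmul (actHom γ) n P

theorem act_mem_torsion {N : ℕ} {P : TorsionPoint} (h : P ∈ torsion N) : act γ P ∈ torsion N := by
  rw [mem_torsion_iff] at h ⊢
  rw [← act_zsmul, h]
  exact map_zero (actHom γ)

theorem act_eq_self {N : ℕ} {γ : SL(2, ℤ)} (hγ : γ ∈ CongruenceSubgroup.Gamma N)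
    {P : TorsionPoint} (h : P ∈ torsion N) : act γ P = P := by
  rw [CongruenceSubgroup.Gamma_mem] at hγ
  obtain ⟨h1, h2, h3, h4⟩ := hγ
  have hP : ∀ i, (N : ℤ) • P i = 0 := fun i ↦ congrFun h i
  have key : ∀ (m : ℤ) (i : Fin 2), (m : ZMod N) = 0 → m • P i = 0 := fun m i hm ↦ by
    obtain ⟨k, rfl⟩ := (ZMod.intCast_zmod_eq_zero_iff_dvd m N).mp hm
    rw [mul_comm, mul_smul, hP, smul_zero]
  have key' : ∀ (m : ℤ) (i : Fin 2), (m : ZMod N) = 1 → m • P i = P i := fun m i hm ↦ by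
    have := key (m - 1) i (by push_cast; rw [hm, sub_self])
    rwa [sub_smul, one_smul, sub_eq_zero] at this
  ext i
  fin_cases i
  · change γ 0 0 • P 0 + γ 1 0 • P 1 = P 0
    rw [key' _ _ h1, key _ _ h3, add_zero]
  · change γ 0 1 • P 0 + γ 1 1 • P 1 = P 1
    rw [key _ _ h2, key' _ _ h4, zero_add]

end Slash

end TorsionForms

namespace TorsionForms

/-! ### Lowering the level by one prime, modulo differences under Γ(ℓ). -/

section PrimeStep

theorem act_mul (γ γ' : SL(2, ℤ)) (P : TorsionPoint) : act (γ * γ') P = act γ' (act γ P) := by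
  have e : ∀ i j, (γ * γ') i j = γ i 0 * γ' 0 j + γ i 1 * γ' 1 j := fun i j ↦ by
    rw [Matrix.SpecialLinearGroup.coe_mul, Matrix.mul_apply, Fin.sum_univ_two]
  ext i
  fin_cases i
  · change (γ * γ') 0 0 • P 0 + (γ * γ') 1 0 • P 1 =
      γ' 0 0 • (γ 0 0 • P 0 + γ 1 0 • P 1) + γ' 1 0 • (γ 0 1 • P 0 + γ 1 1 • P 1)
    rw [e, e]
    module
  · change (γ * γ') 0 1 • P 0 + (γ * γ') 1 1 • P 1 =
      γ' 0 1 • (γ 0 0 • P 0 + γ 1 0 • P 1) + γ' 1 1 • (γ 0 1 • P 0 + γ 1 1 • P 1)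
    rw [e, e]
    module

/-- The transvection `X ↦ X + k ⟨X, v⟩ v` with `v = (a, b)`. -/
def transvection (k a b : ℤ) : SL(2, ℤ) :=
  ⟨!![1 + k * a * b, k * b ^ 2; -k * a ^ 2, 1 - k * a * b], by rw [Matrix.det_fin_two_of]; ring⟩

theorem act_transvection (k a b : ℤ) (r s : ℚ) : act (transvection k a b) (pt r s) =
    pt (r + k * (r * b - s * a) * a) (s + k * (r * b - s * a) * b) := by
  rw [act_pt]
  change pt (r * ((1 + k * a * b : ℤ) : ℚ) + s * ((-k * a ^ 2 : ℤ) : ℚ))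
    (r * ((k * b ^ 2 : ℤ) : ℚ) + s * ((1 - k * a * b : ℤ) : ℚ)) = _
  congr 1 <;> push_cast <;> ring

theorem transvection_mem_Gamma {l : ℕ} {k : ℤ} (h : (l : ℤ) ∣ k) (a b : ℤ) :
    transvection k a b ∈ CongruenceSubgroup.Gamma l := by
  have hk : (k : ZMod l) = 0 := (ZMod.intCast_zmod_eq_zero_iff_dvd k l).mpr h
  rw [CongruenceSubgroup.Gamma_mem]
  refine ⟨?_, ?_, ?_, ?_⟩
  · change ((1 + k * a * b : ℤ) : ZMod l) = 1
    push_cast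
    rw [hk]; ring
  · change ((k * b ^ 2 : ℤ) : ZMod l) = 0
    push_cast
    rw [hk]; ring
  · change ((-k * a ^ 2 : ℤ) : ZMod l) = 0
    push_cast
    rw [hk]; ring
  · change ((1 - k * a * b : ℤ) : ZMod l) = 1
    push_cast
    rw [hk]; ring

variable {p l : ℕ}

theorem pt_div_mem_torsion_iff (hp : p ≠ 0) (hl : l ≠ 0) {a b : ℤ} :
    pt (a / (p * l : ℕ)) (b / (p * l : ℕ)) ∈ torsion l ↔ (p : ℤ) ∣ a ∧ (p : ℤ) ∣ b := by
  have hp' : (p : ℚ) ≠ 0 := by exact_mod_cast hp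
  have hl' : (l : ℚ) ≠ 0 := by exact_mod_cast hl
  have e : ∀ c : ℤ, (((l : ℤ) : ℚ) * (c / (p * l : ℕ))) = c / p := fun c ↦ by
    push_cast
    field_simp
  rw [mem_torsion_iff, pt_zsmul, e, e, pt_div_eq_zero_iff hp]

/-- The transvection along $(t,u)$ with parameter $jl$ adds $\frac{j(au-bt)}p(t,u)$, and $j$ is
chosen as an inverse of $au-bt$ modulo $p$. -/
theorem exists_act_eq_of_not_dvd (hp : p.Prime) (hl : l ≠ 0) {a b t u : ℤ}
    (h : ¬(p : ℤ) ∣ a * u - b * t) : ∃ γ ∈ CongruenceSubgroup.Gamma l,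
      act γ (pt (a / (p * l : ℕ)) (b / (p * l : ℕ))) =
        pt ((a + l * t : ℤ) / (p * l : ℕ)) ((b + l * u : ℤ) / (p * l : ℕ)) := by
  have hp' : (p : ℚ) ≠ 0 := by exact_mod_cast hp.ne_zero
  have hl' : (l : ℚ) ≠ 0 := by exact_mod_cast hl
  have hcop : IsCoprime (p : ℤ) (a * u - b * t) :=
    (Nat.prime_iff_prime_int.mp hp).coprime_iff_not_dvd.mpr h
  obtain ⟨m, j, hmj⟩ := hcop
  refine ⟨transvection (j * l) t u, transvection_mem_Gamma (dvd_mul_left _ _) _ _, ?_⟩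
  rw [act_transvection, pt_eq_pt_iff]
  have hq : (m * p + j * (a * u - b * t) : ℚ) = 1 := by exact_mod_cast hmj
  refine ⟨-m * t, -m * u, ?_, ?_⟩
  · push_cast
    field_simp
    linear_combination (t : ℚ) * l * hq
  · push_cast
    field_simp
    linear_combination (u : ℚ) * l * hq

/-- One transvection suffices unless $T$ is parallel to $Q$ modulo $p$. In that case the translation
is split in two, first along a coordinate vector not parallel to $Q$; that $Q+T$ is not in $E[l]$
makes the second step nondegenerate as well. -/
theorem exists_act_eq_add (hp : p.Prime) (hl : l ≠ 0) {Q T : TorsionPoint}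
    (hQ : Q ∈ torsion (p * l)) (hQl : Q ∉ torsion l) (hT : T ∈ torsion p)
    (hQT : Q + T ∉ torsion l) : ∃ γ ∈ CongruenceSubgroup.Gamma l, act γ Q = Q + T := by
  have hp' : (p : ℚ) ≠ 0 := by exact_mod_cast hp.ne_zero
  have hl' : (l : ℚ) ≠ 0 := by exact_mod_cast hl
  have hpi : Prime (p : ℤ) := Nat.prime_iff_prime_int.mp hp
  obtain ⟨a, b, rfl⟩ := exists_pt_div (mul_ne_zero hp.ne_zero hl) hQ
  obtain ⟨t, u, rfl⟩ := exists_pt_div hp.ne_zero hT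
  have e : pt (a / (p * l : ℕ)) (b / (p * l : ℕ)) + pt (t / p) (u / p) =
      pt ((a + l * t : ℤ) / (p * l : ℕ)) ((b + l * u : ℤ) / (p * l : ℕ)) := by
    rw [pt_add]
    congr 1 <;> push_cast <;> field_simp
  rw [e] at hQT ⊢
  rw [pt_div_mem_torsion_iff hp.ne_zero hl] at hQl hQT
  by_cases h : (p : ℤ) ∣ a * u - b * t
  swap
  · exact exists_act_eq_of_not_dvd hp hl h
  by_cases ha : (p : ℤ) ∣ a
  · have hb : ¬(p : ℤ) ∣ b := fun hb ↦ hQl ⟨ha, hb⟩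
    obtain ⟨γ, hγ, h1⟩ := exists_act_eq_of_not_dvd (t := 1) (u := 0) hp hl (a := a) (b := b)
      (by simpa using hb)
    obtain ⟨γ', hγ', h2⟩ := exists_act_eq_of_not_dvd (t := t - 1) (u := u) hp hl
      (a := a + l * 1) (b := b + l * 0) (by
        intro h3
        have h4 : (p : ℤ) ∣ b + l * u := by
          have := dvd_sub h3 h
          ring_nf at this ⊢
          exact this
        have h5 : (p : ℤ) ∣ b * (a + l * t) := by
          have := dvd_sub (h4.mul_left a) (h.mul_left l)
          ring_nf at this ⊢
          exact this
        exact hQT ⟨(hpi.dvd_or_dvd h5).resolve_left hb, h4⟩)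
    refine ⟨γ * γ', mul_mem hγ hγ', ?_⟩
    rw [act_mul, h1, h2]
    ring_nf
  · obtain ⟨γ, hγ, h1⟩ := exists_act_eq_of_not_dvd (t := 0) (u := 1) hp hl (a := a) (b := b)
      (by simpa using ha)
    obtain ⟨γ', hγ', h2⟩ := exists_act_eq_of_not_dvd (t := t) (u := u - 1) hp hl
      (a := a + l * 0) (b := b + l * 1) (by
        intro h3
        have h4 : (p : ℤ) ∣ a + l * t := by
          have := dvd_sub h h3
          ring_nf at this ⊢
          exact this
        have h5 : (p : ℤ) ∣ a * (b + l * u) := by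
          have := dvd_add (h4.mul_left b) (h.mul_left l)
          ring_nf at this ⊢
          exact this
        exact hQT ⟨h4, (hpi.dvd_or_dvd h5).resolve_left ha⟩)
    refine ⟨γ * γ', mul_mem hγ hγ', ?_⟩
    rw [act_mul, h1, h2]
    ring_nf

/-- The slash operator of weight three as a linear map. -/
def slashThree (γ : SL(2, ℤ)) : (UpperHalfPlane → ℂ) →ₗ[ℂ] (UpperHalfPlane → ℂ) where
  toFun f := f ∣[(3 : ℤ)] γ
  map_add' f g := SlashAction.add_slash 3 γ f g
  map_smul' c f := ModularForm.SL_smul_slash 3 γ f c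

theorem slashThree_mem {N : ℕ} {f : UpperHalfPlane → ℂ} (hf : f ∈ productSpace (torsion N))
    (γ : SL(2, ℤ)) : slashThree γ f ∈ productSpace (torsion N) := by
  rw [productSpace] at hf
  induction hf using Submodule.span_induction with
  | mem f hf =>
    rcases hf with ⟨P, hP, Q, hQ, rfl⟩ | ⟨P, hP, rfl⟩
    · change (xForm P * lambdaForm Q) ∣[(3 : ℤ)] γ ∈ _
      rw [mul_slash_three]
      exact mul_mem_productSpace (act_mem_torsion γ hP) (act_mem_torsion γ hQ)
    · change yForm P ∣[(3 : ℤ)] γ ∈ _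
      rw [yForm_slash]
      exact yForm_mem_productSpace (act_mem_torsion γ hP)
  | zero => rw [map_zero]; exact zero_mem _
  | add f g _ _ hf hg => rw [map_add]; exact add_mem hf hg
  | smul c f _ hf => rw [map_smul]; exact Submodule.smul_mem _ _ hf

theorem slashThree_eq_self {N : ℕ} {f : UpperHalfPlane → ℂ} (hf : f ∈ productSpace (torsion N))
    {γ : SL(2, ℤ)} (hγ : γ ∈ CongruenceSubgroup.Gamma N) : slashThree γ f = f := by
  rw [productSpace] at hf
  induction hf using Submodule.span_induction with
  | mem f hf =>
    rcases hf with ⟨P, hP, Q, hQ, rfl⟩ | ⟨P, hP, rfl⟩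
    · change (xForm P * lambdaForm Q) ∣[(3 : ℤ)] γ = _
      rw [mul_slash_three, act_eq_self hγ hP, act_eq_self hγ hQ]
    · change yForm P ∣[(3 : ℤ)] γ = _
      rw [yForm_slash, act_eq_self hγ hP]
  | zero => rw [map_zero]
  | add f g _ _ hf hg => rw [map_add, hf, hg]
  | smul c f _ hf => rw [map_smul, hf]

/-- The span of the differences `f - f |₃ γ`, for `f` of level `N` and `γ ∈ Γ(M)`. -/
def slashDiff (N M : ℕ) : Submodule ℂ (UpperHalfPlane → ℂ) :=
  Submodule.span ℂ {f | ∃ g ∈ productSpace (torsion N), ∃ γ ∈ CongruenceSubgroup.Gamma M,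
    f = g - slashThree γ g}

/-- If the sum of an equivariant family over a coset of `E[p]` lies in the space of level `l`, so
does each member of the family, up to differences. -/
theorem mem_of_sum_torsion_mem (hp : p.Prime) [NeZero p] (hl : l ≠ 0)
    (F : TorsionPoint → UpperHalfPlane → ℂ) {Q : TorsionPoint} (hQ : Q ∈ torsion (p * l))
    (hQl : Q ∉ torsion l) (hF : F Q ∈ productSpace (torsion (p * l)))
    (hsmall : ∀ R ∈ torsion l, F R ∈ productSpace (torsion l))
    (hact : ∀ γ ∈ CongruenceSubgroup.Gamma l, slashThree γ (F Q) = F (act γ Q))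
    (hsum : ∑ T : torsion p, F (Q + T) ∈ productSpace (torsion l)) :
    F Q ∈ productSpace (torsion l) ⊔ slashDiff (p * l) l := by
  classical
  set S := productSpace (torsion l) ⊔ slashDiff (p * l) l with hS
  -- Translates outside $E[l]$ are conjugate to $Q$ under $\Gamma(l)$, and at translates inside
  -- $E[l]$ the value of $F$ already has level $l$. Summing leaves $F(Q)$ times the number of
  -- translates of the first kind, which is positive because of $T=0$.
  have h1 : ∀ T : torsion p, (if Q + T ∈ torsion l then 0 else F Q) - F (Q + T) ∈ S := by
    intro T
    split_ifs with h
    · rw [zero_sub]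
      exact neg_mem (Submodule.mem_sup_left (hsmall _ h))
    · obtain ⟨γ, hγ, h2⟩ := exists_act_eq_add hp hl hQ hQl T.2 h
      rw [← h2, ← hact γ hγ]
      exact Submodule.mem_sup_right (Submodule.subset_span ⟨_, hF, γ, hγ, rfl⟩)
  have h2 := add_mem (Submodule.sum_mem S fun T (_ : T ∈ Finset.univ) ↦ h1 T)
    (Submodule.mem_sup_left hsum)
  rw [Finset.sum_sub_distrib, sub_add_cancel, Finset.sum_ite, Finset.sum_const_zero, zero_add, Finset.sum_const,
    ← Nat.cast_smul_eq_nsmul ℂ] at h2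
  refine (Submodule.smul_mem_iff _ ?_).mp h2
  rw [Nat.cast_ne_zero]
  refine Finset.card_ne_zero_of_mem (a := 0) ?_
  rw [Finset.mem_filter]
  exact ⟨Finset.mem_univ _, by simpa using hQl⟩

theorem smul_mem_torsion_of_mem_mul {Q : TorsionPoint} (h : Q ∈ torsion (p * l)) :
    (p : ℤ) • Q ∈ torsion l := by
  rw [mem_torsion_iff] at h ⊢
  rw [smul_smul, mul_comm, ← Nat.cast_mul, h]

theorem torsion_le {N M : ℕ} (h : N ∣ M) : torsion N ≤ torsion M := by
  intro P hP
  obtain ⟨k, rfl⟩ := h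
  rw [mem_torsion_iff] at hP ⊢
  rw [Nat.cast_mul, mul_comm, mul_smul, hP, smul_zero]

theorem yForm_mem_sup (hp : p.Prime) (hl : l ≠ 0) {Q : TorsionPoint}
    (hQ : Q ∈ torsion (p * l)) :
    yForm Q ∈ productSpace (torsion l) ⊔ slashDiff (p * l) l := by
  have : NeZero p := ⟨hp.ne_zero⟩
  by_cases hQl : Q ∈ torsion l
  · exact Submodule.mem_sup_left (yForm_mem_productSpace hQl)
  refine mem_of_sum_torsion_mem hp hl yForm hQ hQl (yForm_mem_productSpace hQ)
    (fun R hR ↦ yForm_mem_productSpace hR) (fun γ _ ↦ yForm_slash γ Q) ?_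
  rw [sum_yForm_add_torsion]
  exact Submodule.smul_mem _ _ (yForm_mem_productSpace (smul_mem_torsion_of_mem_mul hQ))

theorem mul_mem_sup_of_left (hp : p.Prime) (hl : l ≠ 0) {P Q : TorsionPoint}
    (hP : P ∈ torsion l) (hQ : Q ∈ torsion (p * l)) :
    xForm P * lambdaForm Q ∈ productSpace (torsion l) ⊔ slashDiff (p * l) l := by
  have : NeZero p := ⟨hp.ne_zero⟩
  by_cases hQl : Q ∈ torsion l
  · exact Submodule.mem_sup_left (mul_mem_productSpace hP hQl)
  refine mem_of_sum_torsion_mem hp hl (fun R ↦ xForm P * lambdaForm R) hQ hQl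
    (mul_mem_productSpace (torsion_le (dvd_mul_left l p) hP) hQ)
    (fun R hR ↦ mul_mem_productSpace hP hR) (fun γ hγ ↦ ?_) ?_
  · change (xForm P * lambdaForm Q) ∣[(3 : ℤ)] γ = _
    rw [mul_slash_three, act_eq_self hγ hP]
  · rw [← Finset.mul_sum, sum_lambdaForm_add_torsion, mul_smul_comm]
    exact Submodule.smul_mem _ _ (mul_mem_productSpace hP (smul_mem_torsion_of_mem_mul hQ))

/-- The aligned case. Summed over $P+E[p]$, the family $x_X\lambda_{wX+R}$ becomes a sum as in (1)
with $s=-w$; here $sP+(wP+R)=R$ has level $l$, so the fibre sums apply with $H=E[l]$. -/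
theorem mul_mem_sup_of_smul_add (hp : p.Prime) (hl : l ≠ 0) {P R : TorsionPoint} (w : ℤ)
    (hP : P ∈ torsion (p * l)) (hPl : P ∉ torsion l) (hR : R ∈ torsion l) :
    xForm P * lambdaForm (w • P + R) ∈ productSpace (torsion l) ⊔ slashDiff (p * l) l := by
  have : NeZero p := ⟨hp.ne_zero⟩
  have hR' := torsion_le (dvd_mul_left l p) hR
  refine mem_of_sum_torsion_mem hp hl (fun X ↦ xForm X * lambdaForm (w • X + R)) hP hPl
    (mul_mem_productSpace hP (add_mem (zsmul_mem hP _) hR'))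
    (fun X hX ↦ mul_mem_productSpace hX (add_mem (zsmul_mem hX _) hR)) (fun γ hγ ↦ ?_) ?_
  · change (xForm P * lambdaForm (w • P + R)) ∣[(3 : ℤ)] γ = _
    rw [mul_slash_three, act_add, act_zsmul, act_eq_self hγ hR]
  · have h := sum_torsion_mem p (H := torsion l) (A := P) (B := w • P + R) (s := -w)
      (smul_mem_torsion_of_mem_mul hP) (by rwa [neg_smul, neg_add_cancel_left])
    have e : ∀ T : TorsionPoint, w • (P + T) + R = w • P + R - (-w) • T := fun T ↦ by module
    simp only [e]
    exact h

theorem sum_exp_eq_zero {m : ℤ} (hp : p ≠ 0) (h : ¬(p : ℤ) ∣ m) :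
    ∑ j ∈ Finset.range p, Complex.exp (m / p * (2 * Real.pi * Complex.I)) ^ j = 0 := by
  have hp' : (p : ℂ) ≠ 0 := by exact_mod_cast hp
  have h1 : Complex.exp (m / p * (2 * Real.pi * Complex.I)) ≠ 1 := by
    rw [Ne, Complex.exp_eq_one_iff]
    rintro ⟨k, hk⟩
    have h2 := mul_right_cancel₀ Complex.two_pi_I_ne_zero hk
    rw [div_eq_iff hp'] at h2
    exact h ⟨k, by rw [mul_comm]; exact_mod_cast h2⟩
  have h2 : Complex.exp (m / p * (2 * Real.pi * Complex.I)) ^ p = 1 := by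
    rw [← Complex.exp_nat_mul, ← mul_assoc, mul_div_cancel₀ _ hp', Complex.exp_int_mul_two_pi_mul_I]
  have h3 := mul_neg_geom_sum (Complex.exp (m / p * (2 * Real.pi * Complex.I))) p
  rw [h2, sub_self] at h3
  exact (mul_eq_zero.mp h3).resolve_left (sub_ne_zero.mpr h1.symm)

/-- Modulo differences $Q$ may be replaced by its average over the transvections along $P$, which
fix $P$. After Fourier expansion of $\lambda$ the average kills every point that is not aligned with
$P$ modulo $p$. -/
theorem mul_mem_sup (hp : p.Prime) (hl : l ≠ 0) {P Q : TorsionPoint}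
    (hP : P ∈ torsion (p * l)) (hQ : Q ∈ torsion (p * l)) :
    xForm P * lambdaForm Q ∈ productSpace (torsion l) ⊔ slashDiff (p * l) l := by
  have hpl : p * l ≠ 0 := mul_ne_zero hp.ne_zero hl
  have : NeZero (p * l) := ⟨hpl⟩
  have hp' : (p : ℚ) ≠ 0 := by exact_mod_cast hp.ne_zero
  have hl' : (l : ℚ) ≠ 0 := by exact_mod_cast hl
  have hpC : (p : ℂ) ≠ 0 := by exact_mod_cast hp.ne_zero
  have hlC : (l : ℂ) ≠ 0 := by exact_mod_cast hl
  have hpi : Prime (p : ℤ) := Nat.prime_iff_prime_int.mp hp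
  by_cases hPl : P ∈ torsion l
  · exact mul_mem_sup_of_left hp hl hPl hQ
  obtain ⟨a, b, hPab⟩ := exists_pt_div hpl hP
  have hab : ¬((p : ℤ) ∣ a ∧ (p : ℤ) ∣ b) := by
    rwa [hPab, pt_div_mem_torsion_iff hp.ne_zero hl] at hPl
  have aligned : ∀ i j : ℤ, (p : ℤ) ∣ j * a - i * b →
      xForm P * lambdaForm (pt (i / (p * l : ℕ)) (j / (p * l : ℕ))) ∈
        productSpace (torsion l) ⊔ slashDiff (p * l) l := by
    intro i j hij
    -- A vector parallel to $(a,b)\ne0$ over the field with $p$ elements is a multiple of it; $w$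
    -- comes from inverting a coordinate of $(a,b)$ prime to $p$.
    obtain ⟨w, hw1, hw2⟩ : ∃ w : ℤ, (p : ℤ) ∣ i - w * a ∧ (p : ℤ) ∣ j - w * b := by
      by_cases ha : (p : ℤ) ∣ a
      · have hb : ¬(p : ℤ) ∣ b := fun hb ↦ hab ⟨ha, hb⟩
        obtain ⟨m, c, hc⟩ := hpi.coprime_iff_not_dvd.mpr hb
        have h2 : (p : ℤ) ∣ j - c * j * b := ⟨m * j, by linear_combination (-j) * hc⟩
        have h3 : (p : ℤ) ∣ i * b := by
          have := dvd_sub (ha.mul_left j) hij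
          rwa [sub_sub_cancel] at this
        exact ⟨c * j, dvd_sub ((hpi.dvd_or_dvd h3).resolve_right hb) (ha.mul_left _), h2⟩
      · obtain ⟨m, c, hc⟩ := hpi.coprime_iff_not_dvd.mpr ha
        refine ⟨c * i, ⟨m * i, by linear_combination (-i) * hc⟩, ?_⟩
        obtain ⟨k, hk⟩ := hij
        exact ⟨m * j + c * k, by linear_combination (-j) * hc + c * hk⟩
    have e : pt (i / (p * l : ℕ)) (j / (p * l : ℕ)) =
        w • P + pt ((i - w * a : ℤ) / (p * l : ℕ)) ((j - w * b : ℤ) / (p * l : ℕ)) := by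
      rw [hPab, pt_zsmul, pt_add]
      congr 1 <;> push_cast <;> ring
    rw [e]
    exact mul_mem_sup_of_smul_add hp hl w hP hPl
      ((pt_div_mem_torsion_iff hp.ne_zero hl).mpr ⟨hw1, hw2⟩)
  obtain ⟨c, d, hQcd⟩ := exists_pt_div hpl hQ
  by_cases he : (p : ℤ) ∣ d * a - c * b
  · rw [hQcd]
    exact aligned c d he
  set e := d * a - c * b with he_def
  -- the translates of `Q` under the transvections fixing `P`
  have htrans : ∀ k : ℕ, ∃ γ ∈ CongruenceSubgroup.Gamma l, act γ P = P ∧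
      act γ Q = pt ((c - k * l * e * a : ℤ) / (p * l : ℕ)) ((d - k * l * e * b : ℤ) / (p * l : ℕ)) := by
    intro k
    refine ⟨transvection (k * l) a b, transvection_mem_Gamma (dvd_mul_left _ _) _ _, ?_, ?_⟩
    · rw [hPab, act_transvection]
      congr 1 <;> push_cast <;> ring
    · rw [hQcd, act_transvection, he_def]
      congr 1 <;> push_cast <;> ring
  -- The Fourier formula excludes the origin. The determinant of each translate with $(a,b)$ stays
  -- equal to $e$, which is prime to $p$, so no translate is zero.
  have hne : ∀ k : ℕ,
      pt ((c - k * l * e * a : ℤ) / (p * l : ℕ)) ((d - k * l * e * b : ℤ) / (p * l : ℕ)) ≠ 0 := by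
    intro k h0
    rw [pt_div_eq_zero_iff hpl] at h0
    apply he
    have hd : (p : ℤ) ∣ ((p * l : ℕ) : ℤ) := ⟨l, by push_cast; ring⟩
    have h1 := dvd_sub ((hd.trans h0.2).mul_right a) ((hd.trans h0.1).mul_right b)
    rwa [show (d - k * l * e * b) * a - (c - k * l * e * a) * b = e by rw [he_def]; ring] at h1
  have hweil : ∀ (k : ℕ) (i j : ℤ),
      weilPairing (p * l) (c - k * l * e * a) (d - k * l * e * b) i j =
      weilPairing (p * l) c d i j *
        Complex.exp ((-(e * (j * a - i * b)) : ℤ) / p * (2 * Real.pi * Complex.I)) ^ k := by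
    intro k i j
    rw [weilPairing, weilPairing, ← Complex.exp_nat_mul, ← Complex.exp_add]
    congr 1
    push_cast
    field_simp
    ring
  have hsum : ∑ k ∈ Finset.range p, xForm P * lambdaForm
      (pt ((c - k * l * e * a : ℤ) / (p * l : ℕ)) ((d - k * l * e * b : ℤ) / (p * l : ℕ))) ∈
        productSpace (torsion l) ⊔ slashDiff (p * l) l := by
    have e1 : ∀ k ∈ Finset.range p, xForm P * lambdaForm
        (pt ((c - k * l * e * a : ℤ) / (p * l : ℕ)) ((d - k * l * e * b : ℤ) / (p * l : ℕ))) =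
        (-(1 / (p * l : ℕ)) : ℂ) • ∑ i ∈ Finset.range (p * l), ∑ j ∈ Finset.range (p * l),
          (weilPairing (p * l) c d i j *
            Complex.exp ((-(e * (j * a - i * b)) : ℤ) / p * (2 * Real.pi * Complex.I)) ^ k) •
          (xForm P * lambdaForm (pt (i / (p * l : ℕ)) (j / (p * l : ℕ)))) := by
      intro k _
      rw [lambdaForm_eq_sum _ _ _ (hne k), mul_smul_comm]
      simp only [Finset.mul_sum, mul_smul_comm, hweil]
    rw [Finset.sum_congr rfl e1, ← Finset.smul_sum, Finset.sum_comm]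
    refine Submodule.smul_mem _ _ (Submodule.sum_mem _ fun i _ ↦ ?_)
    rw [Finset.sum_comm]
    refine Submodule.sum_mem _ fun j _ ↦ ?_
    -- For a point not aligned with $P$ the sum over $k$ is a full geometric sum of powers of a
    -- nontrivial $p$-th root of unity.
    by_cases hij : (p : ℤ) ∣ (j : ℤ) * a - i * b
    · exact Submodule.sum_mem _ fun k _ ↦ Submodule.smul_mem _ _ (by simpa using aligned i j hij)
    · rw [← Finset.sum_smul, ← Finset.mul_sum, sum_exp_eq_zero hp.ne_zero, mul_zero, zero_smul]
      · exact zero_mem _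
      · rw [dvd_neg]
        exact fun h ↦ (hpi.dvd_or_dvd h).elim he hij
  have hU := mul_mem_productSpace hP hQ
  have hdiff : ∀ k ∈ Finset.range p, xForm P * lambdaForm Q - xForm P * lambdaForm
      (pt ((c - k * l * e * a : ℤ) / (p * l : ℕ)) ((d - k * l * e * b : ℤ) / (p * l : ℕ))) ∈
        productSpace (torsion l) ⊔ slashDiff (p * l) l := by
    intro k _
    obtain ⟨γ, hγ, h1, h2⟩ := htrans k
    refine Submodule.mem_sup_right (Submodule.subset_span ⟨_, hU, γ, hγ, ?_⟩)
    change _ = _ - (xForm P * lambdaForm Q) ∣[(3 : ℤ)] γ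
    rw [mul_slash_three, h1, h2]
  have htot := add_mem (Submodule.sum_mem _ hdiff) hsum
  rw [Finset.sum_sub_distrib, sub_add_cancel, Finset.sum_const, Finset.card_range,
    ← Nat.cast_smul_eq_nsmul ℂ] at htot
  exact (Submodule.smul_mem_iff _ hpC).mp htot

theorem productSpace_le_of_prime (hp : p.Prime) (hl : l ≠ 0) :
    productSpace (torsion (p * l)) ≤ productSpace (torsion l) ⊔ slashDiff (p * l) l := by
  refine Submodule.span_le.mpr ?_
  rintro _ (⟨P, hP, Q, hQ, rfl⟩ | ⟨P, hP, rfl⟩)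
  · exact mul_mem_sup hp hl hP hQ
  · exact yForm_mem_sup hp hl hP

theorem Gamma_le {N M : ℕ} (h : M ∣ N) :
    CongruenceSubgroup.Gamma N ≤ CongruenceSubgroup.Gamma M := by
  intro γ hγ
  rw [CongruenceSubgroup.Gamma_mem] at hγ ⊢
  have key : ∀ m k : ℤ, (m : ZMod N) = k → (m : ZMod M) = k := fun m k hm ↦ by
    rw [ZMod.intCast_eq_intCast_iff_dvd_sub] at hm ⊢
    exact (Int.natCast_dvd_natCast.mpr h).trans hm
  obtain ⟨h1, h2, h3, h4⟩ := hγ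
  refine ⟨?_, ?_, ?_, ?_⟩
  · exact_mod_cast key _ 1 (by exact_mod_cast h1)
  · exact_mod_cast key _ 0 (by exact_mod_cast h2)
  · exact_mod_cast key _ 0 (by exact_mod_cast h3)
  · exact_mod_cast key _ 1 (by exact_mod_cast h4)

theorem slashDiff_mono {N N' M M' : ℕ} (hN : N ∣ N') (hM : M' ∣ M) :
    slashDiff N M ≤ slashDiff N' M' := by
  refine Submodule.span_mono ?_
  rintro _ ⟨g, hg, γ, hγ, rfl⟩
  exact ⟨g, productSpace_mono (torsion_le hN) hg, γ, Gamma_le hM hγ, rfl⟩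

theorem productSpace_le_sup (n : ℕ) (hn : n ≠ 0) (hl : l ≠ 0) :
    productSpace (torsion (n * l)) ≤ productSpace (torsion l) ⊔ slashDiff (n * l) l := by
  induction n using induction_on_primes with
  | zero => exact absurd rfl hn
  | one =>
    rw [one_mul]
    exact le_sup_left
  | prime_mul p m hp ih =>
    have hm : m ≠ 0 := right_ne_zero_of_mul hn
    rw [mul_assoc]
    refine (productSpace_le_of_prime hp (mul_ne_zero hm hl)).trans (sup_le ((ih hm).trans ?_) ?_)
    · exact sup_le_sup_left (slashDiff_mono (dvd_mul_left _ _) dvd_rfl) _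
    · exact (slashDiff_mono dvd_rfl (dvd_mul_left _ _)).trans le_sup_right

end PrimeStep

end TorsionForms

namespace TorsionForms

/-! ### The trace from Γ(nℓ) to Γ(ℓ). -/

section Trace

open CongruenceSubgroup

theorem slashThree_mul (γ γ' : SL(2, ℤ)) (f : UpperHalfPlane → ℂ) :
    slashThree (γ * γ') f = slashThree γ' (slashThree γ f) :=
  SlashAction.slash_mul (3 : ℤ) γ γ' f

theorem slashThree_inv_congr {N M : ℕ} {f : UpperHalfPlane → ℂ} (hf : f ∈ productSpace (torsion N))
    {g h : Gamma M} (e : (g : Gamma M ⧸ (Gamma N).subgroupOf (Gamma M)) = h) :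
    slashThree (g : SL(2, ℤ))⁻¹ f = slashThree (h : SL(2, ℤ))⁻¹ f := by
  have h1 : (g : SL(2, ℤ))⁻¹ * h ∈ Gamma N := by
    have := QuotientGroup.eq.mp e
    rwa [Subgroup.mem_subgroupOf] at this
  have h2 : (g : SL(2, ℤ))⁻¹ = (g : SL(2, ℤ))⁻¹ * h * (h : SL(2, ℤ))⁻¹ := by group
  rw [h2, slashThree_mul, slashThree_eq_self hf h1]

variable (N M : ℕ) [NeZero N]

instance fintypeGammaQuotient : Fintype (Gamma M ⧸ (Gamma N).subgroupOf (Gamma M)) :=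
  Subgroup.fintypeQuotientOfFiniteIndex

theorem traceThree_eq_sum (f : UpperHalfPlane → ℂ) : traceThree N M f =
    ∑ q : Gamma M ⧸ (Gamma N).subgroupOf (Gamma M),
      slashThree ((Quotient.out q : Gamma M) : SL(2, ℤ))⁻¹ f := rfl

/-- The trace as a linear map. -/
def traceLinear : (UpperHalfPlane → ℂ) →ₗ[ℂ] (UpperHalfPlane → ℂ) :=
  ∑ q : Gamma M ⧸ (Gamma N).subgroupOf (Gamma M),
    slashThree ((Quotient.out q : Gamma M) : SL(2, ℤ))⁻¹

theorem traceLinear_apply (f : UpperHalfPlane → ℂ) : traceLinear N M f = traceThree N M f := by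
  rw [traceLinear, LinearMap.sum_apply, traceThree_eq_sum]

variable {N M}

/-- Slashing by γ first permutes the cosets by right multiplication by $\gamma^{-1}$, which is well
defined because $\Gamma(N)$ is normal. Hence the trace kills the differences in `slashDiff`. -/
theorem traceThree_slashThree {f : UpperHalfPlane → ℂ} (hf : f ∈ productSpace (torsion N))
    {γ : SL(2, ℤ)} (hγ : γ ∈ Gamma M) :
    traceThree N M (slashThree γ f) = traceThree N M f := by
  have : (Gamma N).Normal := Gamma_normal N
  set K := (Gamma N).subgroupOf (Gamma M) with hK
  let γ' : Gamma M := ⟨γ, hγ⟩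
  rw [traceThree_eq_sum, traceThree_eq_sum]
  refine Fintype.sum_equiv (Equiv.mulRight ((γ'⁻¹ : Gamma M) : Gamma M ⧸ K)) _ _ fun q ↦ ?_
  rw [← slashThree_mul]
  have e : γ * ((Quotient.out q : Gamma M) : SL(2, ℤ))⁻¹ =
      ((Quotient.out q * γ'⁻¹ : Gamma M) : SL(2, ℤ))⁻¹ := by
    simp [γ']
  rw [e]
  refine slashThree_inv_congr hf ?_
  rw [QuotientGroup.mk_mul, Equiv.coe_mulRight]
  erw [QuotientGroup.out_eq', QuotientGroup.out_eq']

theorem traceThree_of_mem {f : UpperHalfPlane → ℂ} (hf : f ∈ productSpace (torsion M)) :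
    traceThree N M f ∈ productSpace (torsion M) := by
  rw [traceThree_eq_sum]
  exact Submodule.sum_mem _ fun q _ ↦ slashThree_mem hf _

theorem traceThree_mem_of_mem_sup {f : UpperHalfPlane → ℂ}
    (hf : f ∈ productSpace (torsion M) ⊔ slashDiff N M) :
    traceThree N M f ∈ productSpace (torsion M) := by
  rw [← traceLinear_apply]
  change f ∈ (productSpace (torsion M)).comap (traceLinear N M)
  refine (sup_le (fun g hg ↦ ?_) (Submodule.span_le.mpr ?_) :
    productSpace (torsion M) ⊔ slashDiff N M ≤ _) hf
  · rw [Submodule.mem_comap, traceLinear_apply]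
    exact traceThree_of_mem hg
  · rintro _ ⟨g, hg, γ, hγ, rfl⟩
    rw [SetLike.mem_coe, Submodule.mem_comap, map_sub, traceLinear_apply, traceLinear_apply,
      traceThree_slashThree hg hγ, sub_self]
    exact zero_mem _

theorem exists_trace_sub_mem (n l : ℕ) [NeZero n] [NeZero l] {P Q : TorsionPoint}
    (hP : P ∈ torsion (n * l)) (hQ : Q ∈ torsion (n * l)) :
    ∃ g ∈ Submodule.span ℂ {f : UpperHalfPlane → ℂ | ∃ R ∈ torsion l, ∃ S ∈ torsion l,
        f = xForm R * lambdaForm S},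
      traceThree (n * l) l (xForm P * lambdaForm Q) - g ∈ eisensteinSpaceThree l :=
  exists_sub_mem_of_mem_productSpace le_rfl (traceThree_mem_of_mem_sup
    (productSpace_le_sup n (NeZero.ne n) (NeZero.ne l) (mul_mem_productSpace hP hQ)))

end Trace

end TorsionForms

end

theorem proposition4p11 (n l : ℕ) [NeZero n] [NeZero l] :
    -- the sums of `x_{A ⊕ T} λ_{B ⊖ [s]T}`
    (∀ A ∈ TorsionForms.torsion (n * l), ∀ B ∈ TorsionForms.torsion (n * l), ∀ s : ℤ,
      ∃ g ∈ Submodule.span ℂ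
          {f : UpperHalfPlane → ℂ | ∃ a b c d : ℤ,
            a - s * b ≡ 0 [ZMOD n] ∧ c - s * d ≡ 0 [ZMOD n] ∧
            f = TorsionForms.xForm (a • A + b • B) * TorsionForms.lambdaForm (c • A + d • B)},
        (∑ T : TorsionForms.torsion n,
          TorsionForms.xForm (A + T) * TorsionForms.lambdaForm (B - s • (T : TorsionForms.TorsionPoint)))
          - g ∈ TorsionForms.eisensteinSpaceThree (n * l)) ∧
    -- the sums of `x_{A ⊖ [s]T} λ_{B ⊕ T}`
    (∀ A ∈ TorsionForms.torsion (n * l), ∀ B ∈ TorsionForms.torsion (n * l), ∀ s : ℤ,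
      ∃ g ∈ Submodule.span ℂ
          {f : UpperHalfPlane → ℂ | ∃ a b c d : ℤ,
            -s * a + b ≡ 0 [ZMOD n] ∧ -s * c + d ≡ 0 [ZMOD n] ∧
            f = TorsionForms.xForm (a • A + b • B) * TorsionForms.lambdaForm (c • A + d • B)},
        (∑ T : TorsionForms.torsion n,
          TorsionForms.xForm (A - s • (T : TorsionForms.TorsionPoint)) * TorsionForms.lambdaForm (B + T))
          - g ∈ TorsionForms.eisensteinSpaceThree (n * l)) ∧
    -- the trace from `Γ(n l)` to `Γ(l)` of `x_P λ_Q`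
    (∀ P ∈ TorsionForms.torsion (n * l), ∀ Q ∈ TorsionForms.torsion (n * l),
      ∃ g ∈ Submodule.span ℂ
          {f : UpperHalfPlane → ℂ | ∃ R ∈ TorsionForms.torsion l, ∃ S ∈ TorsionForms.torsion l,
            f = TorsionForms.xForm R * TorsionForms.lambdaForm S},
        TorsionForms.traceThree (n * l) l (TorsionForms.xForm P * TorsionForms.lambdaForm Q)
          - g ∈ TorsionForms.eisensteinSpaceThree l) := by
  exact ⟨fun A hA B hB s ↦ TorsionForms.exists_sum_torsion_sub_mem n l hA hB s,
    fun A hA B hB s ↦ TorsionForms.exists_sum_torsion_sub_mem' n l hA hB s,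
    fun P hP Q hQ ↦ TorsionForms.exists_trace_sub_mem n l hP hQ⟩
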